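/- **The calculus.** Fix a collection of ground types. *Types* are generated by $A,B::=G\mid 1\mid A\to B\mid A\times B\mid \mathcal S A\mid\mathcal T A$ ($G$ ground); below $\mathcal X\in\{\mathcal S,\mathcal T\}$. *Terms*, up to $\alpha$-equivalence, are variables, term constants $c$ (each with a type, and available in every context), $*$, $\lambda x^A.M$, $MN$, $\langle M,N\rangle$, $\pi_iM$, $\mathtt{ret}_{\mathcal X}M$, $\iota M$ and $\mathtt{do}_{\mathcal X}\,x\leftarrow M;N$; application, $\pi_i$, $\iota$ and $\mathtt{do}$ carry the types at which they are used (not displayed). The typing rules are those of the simply-typed $\lambda$-calculus with $1$ and $\times$, closed under conversion along provable type equality, together with: $\Gamma\vdash M:A$ gives $\Gamma\vdash\mathtt{ret}_{\mathcal X}M:\mathcal XA$; $\Gamma\vdash M:\mathcal SA$ gives $\Gamma\vdash\iota M:\mathcal TA$; $\Gamma\vdash M:\mathcal XA$ and $\Gamma,x:A\vdash N:\mathcal XB$ give $\Gamma\vdash\mathtt{do}_{\mathcal X}\,x\leftarrow M;N:\mathcal XB$. A *CSC-theory* consists of ground types, typed term constants, a set of equality axioms $\vdash A=B$ between types and a set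 of equality axioms $\Gamma\vdash M=N:A$ between well-typed terms. Provable equality of types is the congruence generated by the type axioms. Provable equality of well-typed terms is the least congruence (terms whose carried types are provably equal being identified) that contains the axioms, is closed under type conversion, weakening, permutation of contexts and substitution, contains $\beta\eta$ for $1,\times,\to$, and contains, for all well-typed instances, - $\mathtt{do}_{\mathcal X}\,x\leftarrow\mathtt{ret}_{\mathcal X}M;N=N[M/x]$, $\ \mathtt{do}_{\mathcal X}\,x\leftarrow M;\mathtt{ret}_{\mathcal X}x=M$, $\ \mathtt{do}_{\mathcal X}\,y\leftarrow(\mathtt{do}_{\mathcal X}\,x\leftarrow M;N);P=\mathtt{do}_{\mathcal X}\,x\leftarrow M;\mathtt{do}_{\mathcal X}\,y\leftarrow N;P$ ($x$ not free in $P$); - $\mathtt{do}_{\mathcal T}\,x\leftarrow\iota M;\mathtt{do}_{\mathcal T}\,y\leftarrow N;P=\mathtt{do}_{\mathcal T}\,y\leftarrow N;\mathtt{do}_{\mathcal T}\,x\leftarrow\iota M;P$ for $\Gamma\vdash M:\mathcal SA$, $\Gamma\vdash N:\mathcal TB$, $\Gamma,x:A,y:B\vdash P:\mathcal TC$; - $\mathtt{do}_{\mathcal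 T}\,x\leftarrow\iota M;\iota N=\iota(\mathtt{do}_{\mathcal S}\,x\leftarrow M;N)$ and $\iota(\mathtt{ret}_{\mathcal S}M)=\mathtt{ret}_{\mathcal T}M$; and is such that $\Gamma\vdash\iota M=\iota N:\mathcal TA$ implies $\Gamma\vdash M=N:\mathcal SA$. A *translation* $V:\mathrm{Th}\to\mathrm{Th}'$ maps types to types and terms to terms, preserves derivability of typing, type equality and term equality judgements, and commutes strictly with all type and term formers (including variables; not with ground types and constants). A *transformation* $\alpha:V\Rightarrow V'$ is a family of terms $x:V(A)\vdash\alpha_A:V'(A)$, indexed by the types $A$ of $\mathrm{Th}$, with $x:V(A)\vdash\alpha_B[V(f)/x]=V'(f)[\alpha_A/x]:V'(B)$ provable in $\mathrm{Th}'$ whenever $x:A\vdash f:B$ in $\mathrm{Th}$. Transformations compose by substitution and are identified when provably equal. Theories, translations and transformations form the 2-category $\mathbf{Tr}(\mathrm{CSC})$. **Models.** A *CSC-model* is a category $\mathbf C$ with chosen finite products and exponentials, strong monads $(\mathcal T,\eta,\mu,\tau)$ and $(\mathcal S,\eta^{\mathcal S},\mu^{\mathcal S},\tau^{\mathcal S})$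 on $\mathbf C$, and a morphism of strong monads $\iota:\mathcal S\Rightarrow\mathcal T$ with monic components that is central: for all $X,Y$ the morphisms $\mu\circ\mathcal T\tau'\circ\tau$ and $\mu\circ\mathcal T\tau\circ\tau'$ from $\mathcal TX\times\mathcal TY$ to $\mathcal T(X\times Y)$ agree after precomposition with $\iota_X\times\mathcal TY$, where $\tau'$ is the right strength induced by $\tau$. A *morphism* of CSC-models is a functor that strictly preserves the chosen cartesian closed structure, both strong monads and $\iota$. With natural transformations as 2-cells, this gives the 2-category $\mathbf{Mod}(\mathrm{CSC})$. **Syntactic model.** $S(\mathrm{Th})$ has as objects the types modulo provable equality, as morphisms $[A]\to[B]$ the judgements $x:A\vdash f:B$ modulo provable equality, composition by substitution, the evident cartesian closed structure, and $\mathcal X[A]=[\mathcal XA]$, $\mathcal X[f]=[y\vdash\mathtt{do}_{\mathcal X}\,x\leftarrow y;\mathtt{ret}_{\mathcal X}f]$, $\eta=[x\vdash\mathtt{ret}_{\mathcal X}x]$, $\mu=[x\vdash\mathtt{do}_{\mathcal X}\,y\leftarrow x;y]$, $\tau=[x\vdash\mathtt{do}_{\mathcal X}\,y\leftarrow\pi_2x;\mathtt{ret}_{\mathcal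 X}\langle\pi_1x,y\rangle]$, $\iota=[x\vdash\iota x]$. **Internal language.** $L(\mathbf C)$ has a ground type $A^*$ for each object $A$ of $\mathbf C$ and a constant $c_f:A^*\to B^*$ for each morphism $f:A\to B$. Types and terms are interpreted in $\mathbf C$ in the standard way, with $[\![A^*]\!]=A$, $[\![c_f]\!]$ the currying of $f$, $[\![\mathtt{ret}_{\mathcal X}M]\!]=\eta^{\mathcal X}\circ[\![M]\!]$, $[\![\iota M]\!]=\iota\circ[\![M]\!]$ and $[\![\mathtt{do}_{\mathcal X}\,x\leftarrow M;N]\!]=\mu^{\mathcal X}\circ\mathcal X[\![N]\!]\circ\tau^{\mathcal X}\circ\langle\mathrm{id},[\![M]\!]\rangle$. Its axioms are all equalities $\vdash A=B$ with $[\![A]\!]=[\![B]\!]$ and all $\Gamma\vdash M=N:A$ with $[\![\Gamma\vdash M:A]\!]=[\![\Gamma\vdash N:A]\!]$. **Theorem 7.** 1. Every CSC-model $\mathbf C$ is equivalent to $SL(\mathbf C)$ in $\mathbf{Mod}(\mathrm{CSC})$: there are CSC-model morphisms $F:\mathbf C\to SL(\mathbf C)$ and $G:SL(\mathbf C)\to\mathbf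 C$ with $F\circ G\cong\mathrm{Id}$ and $\mathrm{Id}\cong G\circ F$. 2. Every CSC-theory $\mathrm{Th}$ is equivalent to $LS(\mathrm{Th})$ in $\mathbf{Tr}(\mathrm{CSC})$: there are translations $V:\mathrm{Th}\to LS(\mathrm{Th})$ and $W:LS(\mathrm{Th})\to\mathrm{Th}$ with $V\circ W\cong\mathrm{Id}$ and $\mathrm{Id}\cong W\circ V$. -/

import Mathlib

open CategoryTheory MonoidalCategory

universe g k g' k' g'' k'' u v u' v' u'' v''

namespace CSC

noncomputable section

/-! ## Types and terms -/

/-- The two monadic type formers: `S` (central computations) and `T` (all computations). -/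
inductive Eff : Type
  | S
  | T

/-- Types over a collection `G` of ground types; `mon X A` is the type `𝒳 A`, for `𝒳 ∈ {𝒮, 𝒯}`. -/
inductive Ty (G : Type g) : Type g
  | unit : Ty G
  | ground : G → Ty G
  | arr : Ty G → Ty G → Ty G
  | prod : Ty G → Ty G → Ty G
  | mon : Eff → Ty G → Ty G

/-- Terms over ground types `G` and term constants `K`, up to `α`-equivalence: variables are
de Bruijn indices, and `lam` and the second argument of `bind` bind the variable `0`.

* `lam A M` is `λ x^A. M`;
* `app A B M N` is the application `M N` of `M : A → B` to `N : A`;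
* `fst A B M`, `snd A B M` are `π₁ M`, `π₂ M`, for `M : A × B`;
* `ret X M` is `ret_𝒳 M`;
* `iota A M` is `ι M`, for `M : 𝒮 A`;
* `bind X A B M N` is `do_𝒳 x ← M; N`, for `M : 𝒳 A` and `x : A ⊢ N : 𝒳 B`.

Elimination forms record the types at which they are used. Type formers need not be injective for
provable equality of types, so without this record one term would stand for several typed terms
(`π₂ M` could be the projection from `A × B` and also from a provably equal `A' × B`). Recorded
types matter only up to provable equality, see `Theory.EqTm`. -/
inductive Tm (G : Type g) (K : Type k) : Type (max g k)
  | var : ℕ → Tm G K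
  | const : K → Tm G K
  | star : Tm G K
  | lam : Ty G → Tm G K → Tm G K
  | app : Ty G → Ty G → Tm G K → Tm G K → Tm G K
  | pair : Tm G K → Tm G K → Tm G K
  | fst : Ty G → Ty G → Tm G K → Tm G K
  | snd : Ty G → Ty G → Tm G K → Tm G K
  | ret : Eff → Tm G K → Tm G K
  | iota : Ty G → Tm G K → Tm G K
  | bind : Eff → Ty G → Ty G → Tm G K → Tm G K → Tm G K

namespace Tm

variable {G : Type g} {K : Type k}

/-- Extend a renaming under a binder. -/
def upr (r : ℕ → ℕ) : ℕ → ℕ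
  | 0 => 0
  | n + 1 => r n + 1

/-- Renaming of variables. -/
def rename (r : ℕ → ℕ) : Tm G K → Tm G K
  | var n => var (r n)
  | const c => const c
  | star => star
  | lam A M => lam A (M.rename (upr r))
  | app A B M N => app A B (M.rename r) (N.rename r)
  | pair M N => pair (M.rename r) (N.rename r)
  | fst A B M => fst A B (M.rename r)
  | snd A B M => snd A B (M.rename r)
  | ret X M => ret X (M.rename r)
  | iota A M => iota A (M.rename r)
  | bind X A B M N => bind X A B (M.rename r) (N.rename (upr r))

/-- Weakening by a new variable `0`. -/
def wk (M : Tm G K) : Tm G K := M.rename Nat.succ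

/-- Extend a substitution under a binder. -/
def up (s : ℕ → Tm G K) : ℕ → Tm G K
  | 0 => var 0
  | n + 1 => (s n).wk

/-- Simultaneous (capture-avoiding) substitution. -/
def subst (s : ℕ → Tm G K) : Tm G K → Tm G K
  | var n => s n
  | const c => const c
  | star => star
  | lam A M => lam A (M.subst (up s))
  | app A B M N => app A B (M.subst s) (N.subst s)
  | pair M N => pair (M.subst s) (N.subst s)
  | fst A B M => fst A B (M.subst s)
  | snd A B M => snd A B (M.subst s)
  | ret X M => ret X (M.subst s)
  | iota A M => iota A (M.subst s)
  | bind X A B M N => bind X A B (M.subst s) (N.subst (up s))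

/-- The substitution `0 ↦ M`, `n + 1 ↦ n`. -/
def single (M : Tm G K) : ℕ → Tm G K
  | 0 => M
  | n + 1 => var n

/-- `N.inst M` is `N[M/x]`, where `x` is the variable `0` of `N`. -/
def inst (N M : Tm G K) : Tm G K := N.subst (single M)

/-- The renaming that exchanges the variables `0` and `1`. -/
def exch : ℕ → ℕ
  | 0 => 1
  | 1 => 0
  | n + 2 => n + 2

theorem upr_comp (r r' : ℕ → ℕ) : upr (fun n => r' (r n)) = fun n => upr r' (upr r n) := by
  funext n; cases n <;> rfl

theorem rename_rename (M : Tm G K) : ∀ r r' : ℕ → ℕ,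
    (M.rename r).rename r' = M.rename (fun n => r' (r n)) := by
  induction M <;> intro r r' <;> simp_all [rename, upr_comp]

theorem up_upr (r : ℕ → ℕ) (s : ℕ → Tm G K) : up (fun n => s (r n)) = fun n => up s (upr r n) := by
  funext n; cases n <;> rfl

theorem subst_rename (M : Tm G K) : ∀ (r : ℕ → ℕ) (s : ℕ → Tm G K),
    (M.rename r).subst s = M.subst (fun n => s (r n)) := by
  induction M <;> intro r s <;> simp_all [rename, subst, up_upr]

theorem upr_up (s : ℕ → Tm G K) (r : ℕ → ℕ) :
    up (fun n => (s n).rename r) = fun n => (up s n).rename (upr r) := by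
  funext n
  cases n with
  | zero => rfl
  | succ n => simp only [up, wk, rename_rename]; rfl

theorem rename_subst (M : Tm G K) : ∀ (s : ℕ → Tm G K) (r : ℕ → ℕ),
    (M.subst s).rename r = M.subst (fun n => (s n).rename r) := by
  induction M <;> intro s r <;> simp_all [rename, subst, upr_up]

theorem up_up (s t : ℕ → Tm G K) :
    up (fun n => (s n).subst t) = fun n => (up s n).subst (up t) := by
  funext n
  cases n with
  | zero => rfl
  | succ n => simp only [up, wk, rename_subst, subst_rename]

theorem subst_subst (M : Tm G K) : ∀ s t : ℕ → Tm G K,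
    (M.subst s).subst t = M.subst (fun n => (s n).subst t) := by
  induction M <;> intro s t <;> simp_all [subst, up_up]

theorem up_var : up (var : ℕ → Tm G K) = var := by
  funext n; cases n <;> rfl

theorem subst_var (M : Tm G K) : M.subst var = M := by
  induction M <;> simp_all [subst, up_var]

end Tm

/-! ## Signatures, type equality, typing -/

/-- The part of a theory that the formation of terms depends on: ground types, term constants (each
with a type, and available in every context) and equalities between types. -/
structure Sig : Type (max (g + 1) (k + 1)) where
  /-- ground types -/
  G : Type g
  /-- term constants -/
  K : Type k
  /-- the type of a constant -/
  tyOf : K → Ty G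
  /-- the new equalities between types -/
  tyAx : Ty G → Ty G → Prop

namespace Sig

variable (P : Sig.{g, k})

/-- The judgement `⊢ A = B : type`. -/
inductive TyEq : Ty P.G → Ty P.G → Prop
  | ax {A B} : P.tyAx A B → TyEq A B
  | refl (A) : TyEq A A
  | symm {A B} : TyEq A B → TyEq B A
  | trans {A B C} : TyEq A B → TyEq B C → TyEq A C
  | prod {A A' B B'} : TyEq A A' → TyEq B B' → TyEq (.prod A B) (.prod A' B')
  | arr {A A' B B'} : TyEq A A' → TyEq B B' → TyEq (.arr A B) (.arr A' B')
  | mon (X) {A B} : TyEq A B → TyEq (.mon X A) (.mon X B)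

/-- The judgement `Γ ⊢ M : A`. A context is a list of types; its head is the type of variable `0`.
Conversion of the types in the context is admissible: `HasType.conv_ctx`. -/
inductive HasType : List (Ty P.G) → Tm P.G P.K → Ty P.G → Prop
  | var {Γ n A} : Γ[n]? = some A → HasType Γ (.var n) A
  | const {Γ} (c) : HasType Γ (.const c) (P.tyOf c)
  | star {Γ} : HasType Γ .star .unit
  | lam {Γ A B M} : HasType (A :: Γ) M B → HasType Γ (.lam A M) (.arr A B)
  | app {Γ A B M N} : HasType Γ M (.arr A B) → HasType Γ N A → HasType Γ (.app A B M N) B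
  | pair {Γ A B M N} : HasType Γ M A → HasType Γ N B → HasType Γ (.pair M N) (.prod A B)
  | fst {Γ A B M} : HasType Γ M (.prod A B) → HasType Γ (.fst A B M) A
  | snd {Γ A B M} : HasType Γ M (.prod A B) → HasType Γ (.snd A B M) B
  | ret {Γ A M} (X) : HasType Γ M A → HasType Γ (.ret X M) (.mon X A)
  | iota {Γ A M} : HasType Γ M (.mon .S A) → HasType Γ (.iota A M) (.mon .T A)
  | bind {Γ X A B M N} : HasType Γ M (.mon X A) → HasType (A :: Γ) N (.mon X B) →
      HasType Γ (.bind X A B M N) (.mon X B)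
  | conv {Γ A B M} : P.TyEq A B → HasType Γ M A → HasType Γ M B

/-- `s` is a substitution from the context `Γ` to the context `Δ`. -/
def HasSubst (Δ : List (Ty P.G)) (s : ℕ → Tm P.G P.K) (Γ : List (Ty P.G)) : Prop :=
  ∀ n A, Γ[n]? = some A → P.HasType Δ (s n) A

variable {P}

theorem HasType.rename {Γ M A} (h : P.HasType Γ M A) : ∀ {Δ} {r : ℕ → ℕ},
    (∀ n A, Γ[n]? = some A → Δ[r n]? = some A) → P.HasType Δ (M.rename r) A := by
  have key : ∀ {Γ Δ : List (Ty P.G)} {r : ℕ → ℕ} {B},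
      (∀ n A, Γ[n]? = some A → Δ[r n]? = some A) →
      ∀ n A, (B :: Γ)[n]? = some A → (B :: Δ)[Tm.upr r n]? = some A := by
    intro Γ Δ r B hr n A hn
    cases n with
    | zero => exact hn
    | succ n => exact hr n A hn
  induction h with
  | var h => intro Δ r hr; exact .var (hr _ _ h)
  | const c => intro Δ r hr; exact .const c
  | star => intro Δ r hr; exact .star
  | lam _ ih => intro Δ r hr; exact .lam (ih (key hr))
  | app _ _ ih₁ ih₂ => intro Δ r hr; exact .app (ih₁ hr) (ih₂ hr)
  | pair _ _ ih₁ ih₂ => intro Δ r hr; exact .pair (ih₁ hr) (ih₂ hr)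
  | fst _ ih => intro Δ r hr; exact .fst (ih hr)
  | snd _ ih => intro Δ r hr; exact .snd (ih hr)
  | ret X _ ih => intro Δ r hr; exact .ret X (ih hr)
  | iota _ ih => intro Δ r hr; exact .iota (ih hr)
  | bind _ _ ih₁ ih₂ => intro Δ r hr; exact .bind (ih₁ hr) (ih₂ (key hr))
  | conv e _ ih => intro Δ r hr; exact .conv e (ih hr)

theorem HasType.wk {Γ M A} (h : P.HasType Γ M A) (B) : P.HasType (B :: Γ) M.wk A :=
  h.rename fun _ _ hn => hn

theorem HasSubst.up {Δ s Γ} (h : P.HasSubst Δ s Γ) (B) :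
    P.HasSubst (B :: Δ) (Tm.up s) (B :: Γ) := by
  intro n A hn
  cases n with
  | zero => exact .var hn
  | succ n => exact (h n A hn).wk B

theorem HasType.subst {Γ M A} (h : P.HasType Γ M A) : ∀ {Δ s},
    P.HasSubst Δ s Γ → P.HasType Δ (M.subst s) A := by
  induction h with
  | var h => intro Δ s hs; exact hs _ _ h
  | const c => intro Δ s hs; exact .const c
  | star => intro Δ s hs; exact .star
  | lam _ ih => intro Δ s hs; exact .lam (ih (hs.up _))
  | app _ _ ih₁ ih₂ => intro Δ s hs; exact .app (ih₁ hs) (ih₂ hs)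
  | pair _ _ ih₁ ih₂ => intro Δ s hs; exact .pair (ih₁ hs) (ih₂ hs)
  | fst _ ih => intro Δ s hs; exact .fst (ih hs)
  | snd _ ih => intro Δ s hs; exact .snd (ih hs)
  | ret X _ ih => intro Δ s hs; exact .ret X (ih hs)
  | iota _ ih => intro Δ s hs; exact .iota (ih hs)
  | bind _ _ ih₁ ih₂ => intro Δ s hs; exact .bind (ih₁ hs) (ih₂ (hs.up _))
  | conv e _ ih => intro Δ s hs; exact .conv e (ih hs)

theorem HasType.subst_congr {Γ M A} (h : P.HasType Γ M A) : ∀ {s t : ℕ → Tm P.G P.K},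
    (∀ n, n < Γ.length → s n = t n) → M.subst s = M.subst t := by
  have key : ∀ {Γ : List (Ty P.G)} {s t : ℕ → Tm P.G P.K} {B : Ty P.G},
      (∀ n, n < Γ.length → s n = t n) →
      ∀ n, n < (B :: Γ).length → Tm.up s n = Tm.up t n := by
    intro Γ s t B h n hn
    cases n with
    | zero => rfl
    | succ n => simp only [Tm.up]; rw [h n (by simpa using hn)]
  induction h with
  | var h =>
    intro s t hs
    exact hs _ (List.getElem?_eq_some_iff.mp h).1
  | const c => intro s t hs; rfl
  | star => intro s t hs; rfl
  | lam _ ih => intro s t hs; simp only [Tm.subst, ih (key hs)]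
  | app _ _ ih₁ ih₂ => intro s t hs; simp only [Tm.subst, ih₁ hs, ih₂ hs]
  | pair _ _ ih₁ ih₂ => intro s t hs; simp only [Tm.subst, ih₁ hs, ih₂ hs]
  | fst _ ih => intro s t hs; simp only [Tm.subst, ih hs]
  | snd _ ih => intro s t hs; simp only [Tm.subst, ih hs]
  | ret X _ ih => intro s t hs; simp only [Tm.subst, ih hs]
  | iota _ ih => intro s t hs; simp only [Tm.subst, ih hs]
  | bind _ _ ih₁ ih₂ => intro s t hs; simp only [Tm.subst, ih₁ hs, ih₂ (key hs)]
  | conv e _ ih => exact ih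

theorem HasType.conv_ctx {Γ A B C D M} (e : P.TyEq A B) (e' : P.TyEq C D)
    (h : P.HasType (A :: Γ) M C) : P.HasType (B :: Γ) M D := by
  have h' := h.subst (Δ := B :: Γ) (s := .var) (by
    intro n E hn
    cases n with
    | zero =>
      obtain rfl : A = E := by simpa using hn
      exact .conv (.symm e) (.var rfl)
    | succ n => exact .var hn)
  rw [Tm.subst_var] at h'
  exact .conv e' h'

theorem HasSubst.single {Γ A M} (h : P.HasType Γ M A) : P.HasSubst Γ (Tm.single M) (A :: Γ) := by
  intro n B hn
  cases n with
  | zero =>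
    obtain rfl : A = B := by simpa using hn
    exact h
  | succ n => exact .var hn

theorem HasType.inst {Γ A B M N} (hN : P.HasType (A :: Γ) N B) (hM : P.HasType Γ M A) :
    P.HasType Γ (N.inst M) B :=
  hN.subst (.single hM)

end Sig

/-! ## Theories and provable equality of terms -/

/-- A `CSC`-theory: ground types, term constants, equalities between types, and equalities
`Γ ⊢ M = N : A` between well-formed terms. -/
structure Theory : Type (max (g + 1) (k + 1)) extends Sig.{g, k} where
  /-- the new equalities between terms -/
  tmAx : List (Ty G) → Tm G K → Tm G K → Ty G → Prop
  /-- both sides of a new equality are well-formed -/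
  tmAx_typed : ∀ {Γ M N A}, tmAx Γ M N A → toSig.HasType Γ M A ∧ toSig.HasType Γ N A

namespace Theory

open Ty Tm Eff

/-- The judgement `Γ ⊢ M = N : A` of the theory `P`.

Contexts are considered up to permutation and weakening. So weakening, substitution of a term for a
variable, permutation of the context and conversion of its types are all instances of the single
rule `subst` for simultaneous substitutions. -/
inductive EqTm (P : Theory.{g, k}) : List (Ty P.G) → Tm P.G P.K → Tm P.G P.K → Ty P.G → Prop
  | ax {Γ M N A} : P.tmAx Γ M N A → EqTm P Γ M N A
  | refl {Γ M A} : P.HasType Γ M A → EqTm P Γ M M A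
  | symm {Γ M N A} : EqTm P Γ M N A → EqTm P Γ N M A
  | trans {Γ M N L A} : EqTm P Γ M N A → EqTm P Γ N L A → EqTm P Γ M L A
  | conv {Γ M N A B} : P.TyEq A B → EqTm P Γ M N A → EqTm P Γ M N B
  | subst {Γ Δ s M N A} : P.HasSubst Δ s Γ → EqTm P Γ M N A → EqTm P Δ (M.subst s) (N.subst s) A
  | unit_eta {Γ} : EqTm P (unit :: Γ) star (var 0) unit
  | pair_eq {Γ M M' N N' A B} : EqTm P Γ M M' A → EqTm P Γ N N' B →
      EqTm P Γ (pair M N) (pair M' N') (prod A B)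
  | fst_eq {Γ M M' A A' B B'} : P.TyEq A A' → P.TyEq B B' → EqTm P Γ M M' (prod A B) →
      EqTm P Γ (fst A B M) (fst A' B' M') A
  | snd_eq {Γ M M' A A' B B'} : P.TyEq A A' → P.TyEq B B' → EqTm P Γ M M' (prod A B) →
      EqTm P Γ (snd A B M) (snd A' B' M') B
  | fst_beta {Γ M N A B} : P.HasType Γ M A → P.HasType Γ N B →
      EqTm P Γ (fst A B (pair M N)) M A
  | snd_beta {Γ M N A B} : P.HasType Γ M A → P.HasType Γ N B →
      EqTm P Γ (snd A B (pair M N)) N B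
  | pair_eta {Γ M A B} : P.HasType Γ M (prod A B) →
      EqTm P Γ (pair (fst A B M) (snd A B M)) M (prod A B)
  | app_eq {Γ M M' N N' A A' B B'} : P.TyEq A A' → P.TyEq B B' →
      EqTm P Γ M M' (arr A B) → EqTm P Γ N N' A →
      EqTm P Γ (app A B M N) (app A' B' M' N') B
  | lam_eq {Γ M N A A' B} : P.TyEq A A' → EqTm P (A :: Γ) M N B →
      EqTm P Γ (lam A M) (lam A' N) (arr A B)
  | lam_beta {Γ M N A B} : P.HasType (A :: Γ) M B → P.HasType Γ N A →
      EqTm P Γ (app A B (lam A M) N) (M.inst N) B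
  | lam_eta {Γ M A B} : P.HasType Γ M (arr A B) →
      EqTm P Γ (lam A (app A B M.wk (var 0))) M (arr A B)
  | ret_eq {Γ M N A} (X) : EqTm P Γ M N A → EqTm P Γ (ret X M) (ret X N) (mon X A)
  | bind_eq {Γ M M' N N' A A' B B'} (X) : P.TyEq A A' → P.TyEq B B' →
      EqTm P Γ M M' (mon X A) → EqTm P (A :: Γ) N N' (mon X B) →
      EqTm P Γ (bind X A B M N) (bind X A' B' M' N') (mon X B)
  | bind_beta {Γ M N A B} (X) : P.HasType Γ M A → P.HasType (A :: Γ) N (mon X B) →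
      EqTm P Γ (bind X A B (ret X M) N) (N.inst M) (mon X B)
  | bind_eta {Γ M A} (X) : P.HasType Γ M (mon X A) →
      EqTm P Γ (bind X A A M (ret X (var 0))) M (mon X A)
  | bind_assoc {Γ M N L A B C} (X) : P.HasType Γ M (mon X A) →
      P.HasType (A :: Γ) N (mon X B) → P.HasType (B :: Γ) L (mon X C) →
      EqTm P Γ (bind X B C (bind X A B M N) L)
        (bind X A C M (bind X B C N (L.rename (upr Nat.succ)))) (mon X C)
  | central {Γ M N L A B C} : P.HasType Γ M (mon S A) → P.HasType Γ N (mon T B) →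
      P.HasType (B :: A :: Γ) L (mon T C) →
      EqTm P Γ (bind T A C (iota A M) (bind T B C N.wk L))
        (bind T B C N (bind T A C (iota A M.wk) (L.rename exch))) (mon T C)
  | iota_eq {Γ M N A A'} : P.TyEq A A' → EqTm P Γ M N (mon S A) →
      EqTm P Γ (iota A M) (iota A' N) (mon T A)
  | iota_mono {Γ M N A} : P.HasType Γ M (mon S A) → P.HasType Γ N (mon S A) →
      EqTm P Γ (iota A M) (iota A N) (mon T A) → EqTm P Γ M N (mon S A)
  | iota_bind {Γ M N A B} : P.HasType Γ M (mon S A) → P.HasType (A :: Γ) N (mon S B) →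
      EqTm P Γ (bind T A B (iota A M) (iota B N)) (iota B (bind S A B M N)) (mon T B)
  | iota_ret {Γ M A} : P.HasType Γ M A →
      EqTm P Γ (iota A (ret S M)) (ret T M) (mon T A)

end Theory

namespace Sig

variable {P : Sig.{g, k}}

theorem HasType.subst_one {A B M} (h : P.HasType [A] M B) (s : ℕ → Tm P.G P.K) :
    M.subst s = M.subst (fun _ => s 0) :=
  h.subst_congr fun n hn => by
    obtain rfl : n = 0 := by simpa using hn
    rfl

theorem HasType.subst_id {A B M} (h : P.HasType [A] M B) (s : ℕ → Tm P.G P.K)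
    (hs : s 0 = .var 0) : M.subst s = M := by
  rw [h.subst_one, hs, ← h.subst_one .var, Tm.subst_var]

theorem HasType.subst_zero {A B M} (h : P.HasType [A] M B) :
    M.subst (fun _ => .var 0) = M := h.subst_id _ rfl

theorem HasType.inst_one {A B M} (h : P.HasType [A] M B) (N : Tm P.G P.K) :
    M.inst N = M.subst (fun _ => N) := h.subst_one _

theorem HasType.weaken {A B M} (h : P.HasType [A] M B) (Γ) : P.HasType (A :: Γ) M B := by
  have := h.subst (Δ := A :: Γ) (s := .var) fun n C hn => by
    cases n with
    | zero => exact .var hn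
    | succ n => simp at hn
  rwa [Tm.subst_var] at this

theorem HasType.subst' {Γ A B M N} (h : P.HasType [A] M B) (hN : P.HasType Γ N A) :
    P.HasType Γ (M.subst fun _ => N) B :=
  h.subst fun n C hn => by
    cases n with
    | zero =>
      obtain rfl : A = C := by simpa using hn
      exact hN
    | succ n => simp at hn

/-- Types modulo provable equality. -/
instance tySetoid (P : Sig.{g, k}) : Setoid (Ty P.G) :=
  ⟨P.TyEq, .refl, .symm, .trans⟩

end Sig

namespace Theory

variable {P : Theory.{g, k}}

open Ty Tm Eff

/-- Both sides of a provable equality are well-formed. -/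
theorem EqTm.typed {Γ M N A} (h : P.EqTm Γ M N A) : P.HasType Γ M A ∧ P.HasType Γ N A := by
  induction h with
  | ax h => exact P.tmAx_typed h
  | refl h => exact ⟨h, h⟩
  | symm _ ih => exact ih.symm
  | trans _ _ ih₁ ih₂ => exact ⟨ih₁.1, ih₂.2⟩
  | conv e _ ih => exact ⟨.conv e ih.1, .conv e ih.2⟩
  | subst hs _ ih => exact ⟨ih.1.subst hs, ih.2.subst hs⟩
  | unit_eta => exact ⟨.star, .var rfl⟩
  | pair_eq _ _ ih₁ ih₂ => exact ⟨.pair ih₁.1 ih₂.1, .pair ih₁.2 ih₂.2⟩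
  | fst_eq e e' _ ih => exact ⟨.fst ih.1, .conv e.symm (.fst (.conv (.prod e e') ih.2))⟩
  | snd_eq e e' _ ih => exact ⟨.snd ih.1, .conv e'.symm (.snd (.conv (.prod e e') ih.2))⟩
  | fst_beta h h' => exact ⟨.fst (.pair h h'), h⟩
  | snd_beta h h' => exact ⟨.snd (.pair h h'), h'⟩
  | pair_eta h => exact ⟨.pair (.fst h) (.snd h), h⟩
  | app_eq e e' _ _ ih₁ ih₂ =>
    exact ⟨.app ih₁.1 ih₂.1, .conv e'.symm (.app (.conv (.arr e e') ih₁.2) (.conv e ih₂.2))⟩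
  | lam_eq e _ ih =>
    exact ⟨.lam ih.1, .conv (.arr e.symm (.refl _)) (.lam (ih.2.conv_ctx e (.refl _)))⟩
  | lam_beta h h' => exact ⟨.app (.lam h) h', h.inst h'⟩
  | lam_eta h => exact ⟨.lam (.app (h.wk _) (.var rfl)), h⟩
  | ret_eq X _ ih => exact ⟨.ret X ih.1, .ret X ih.2⟩
  | bind_eq X e e' _ _ ih₁ ih₂ =>
    exact ⟨.bind ih₁.1 ih₂.1, .conv (.mon X e'.symm)
      (.bind (.conv (.mon X e) ih₁.2) (ih₂.2.conv_ctx e (.mon X e')))⟩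
  | bind_beta X h h' => exact ⟨.bind (.ret X h) h', h'.inst h⟩
  | bind_eta X h => exact ⟨.bind h (.ret X (.var rfl)), h⟩
  | bind_assoc X h h' h'' =>
    refine ⟨.bind (.bind h h') h'', .bind h (.bind h' (h''.rename ?_))⟩
    intro n A hn
    cases n with
    | zero => exact hn
    | succ n => exact hn
  | central h h' h'' =>
    refine ⟨.bind (.iota h) (.bind (h'.wk _) h''), .bind h' (.bind (.iota (h.wk _)) (h''.rename ?_))⟩
    intro n A hn
    match n with
    | 0 => exact hn
    | 1 => exact hn
    | n + 2 => exact hn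
  | iota_eq e _ ih =>
    exact ⟨.iota ih.1, .conv (.mon _ e.symm) (.iota (.conv (.mon _ e) ih.2))⟩
  | iota_mono h h' => exact ⟨h, h'⟩
  | iota_bind h h' => exact ⟨.bind (.iota h) (.iota h'), .iota (.bind h h')⟩
  | iota_ret h => exact ⟨.iota (.ret _ h), .ret _ h⟩

theorem EqTm.conv_ctx {Γ A B C D M N} (e : P.TyEq A B) (e' : P.TyEq C D)
    (h : P.EqTm (A :: Γ) M N C) : P.EqTm (B :: Γ) M N D := by
  have h' := h.subst (Δ := B :: Γ) (s := .var) (by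
    intro n E hn
    cases n with
    | zero =>
      obtain rfl : A = E := by simpa using hn
      exact .conv (.symm e) (.var rfl)
    | succ n => exact .var hn)
  rw [Tm.subst_var, Tm.subst_var] at h'
  exact .conv e' h'

theorem EqTm.weaken {A B M N} (h : P.EqTm [A] M N B) (Γ) : P.EqTm (A :: Γ) M N B := by
  have := h.subst (Δ := A :: Γ) (s := .var) fun n C hn => by
    cases n with
    | zero => exact .var hn
    | succ n => simp at hn
  rwa [Tm.subst_var, Tm.subst_var] at this

theorem EqTm.inst {Γ A B M M' N N'} (h : P.EqTm (A :: Γ) N N' B) (h' : P.EqTm Γ M M' A) :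
    P.EqTm Γ (N.inst M) (N'.inst M') B :=
  .trans (.symm (.lam_beta h.typed.1 h'.typed.1)) <|
    .trans (.app_eq (.refl _) (.refl _) (.lam_eq (.refl _) h) h')
      (.lam_beta h.typed.2 h'.typed.2)

/-- Congruence of substitution into a term with one free variable. -/
theorem EqTm.comp {Γ A B M M' N N'} (h : P.EqTm [A] N N' B) (h' : P.EqTm Γ M M' A) :
    P.EqTm Γ (N.subst fun _ => M) (N'.subst fun _ => M') B := by
  have := (h.weaken Γ).inst h'
  simp only [Tm.inst] at this
  rwa [h.typed.1.subst_one, h.typed.2.subst_one] at this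

/-! ## The syntactic category -/

/-- Objects of the syntactic category: types modulo provable equality. -/
def Obj (P : Theory.{g, k}) : Type g := Quotient P.toSig.tySetoid

namespace Obj

/-- The class of a type. -/
def cls (A : Ty P.G) : Obj P := Quotient.mk _ A

theorem sound {A B : Ty P.G} (h : P.TyEq A B) : cls A = (cls B : Obj P) := Quotient.sound h

theorem exact {A B : Ty P.G} (h : cls A = (cls B : Obj P)) : P.TyEq A B := Quotient.exact h

theorem ind {p : Obj P → Prop} (h : ∀ A, p (cls A)) (X) : p X := Quotient.ind h X

/-- A type in the given class. -/
def rep (X : Obj P) : Ty P.G := Quotient.out X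

theorem cls_rep (X : Obj P) : cls X.rep = X := Quotient.out_eq X

/-- The class of `A × B`. -/
def prod : Obj P → Obj P → Obj P :=
  Quotient.map₂ Ty.prod fun _ _ h _ _ hh => Sig.TyEq.prod h hh

/-- The class of `A → B`. -/
def arr : Obj P → Obj P → Obj P :=
  Quotient.map₂ Ty.arr fun _ _ h _ _ hh => Sig.TyEq.arr h hh

/-- The class of `𝒳 A`. -/
def mon (X : Eff) : Obj P → Obj P := Quotient.map (Ty.mon X) fun _ _ h => Sig.TyEq.mon X h

end Obj

/-- A judgement `x : A ⊢ f : B` with `[A] = X` and `[B] = Y`. -/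
structure Judgement (X Y : Obj P) where
  /-- the type of the variable -/
  dom : Ty P.G
  /-- the type of the term -/
  cod : Ty P.G
  /-- the term -/
  tm : Tm P.G P.K
  dom_eq : Obj.cls dom = X
  cod_eq : Obj.cls cod = Y
  typed : P.HasType [dom] tm cod

/-- Judgements modulo provable equality of terms. -/
instance judgementSetoid (X Y : Obj P) : Setoid (Judgement X Y) where
  r f f' := P.EqTm [f.dom] f.tm f'.tm f.cod
  iseqv :=
    { refl := fun f => .refl f.typed
      symm := fun {f f'} h => (h.symm).conv_ctx
        (Obj.exact (f.dom_eq.trans f'.dom_eq.symm)) (Obj.exact (f.cod_eq.trans f'.cod_eq.symm))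
      trans := fun {f f' _} h h' => h.trans (h'.conv_ctx
        (Obj.exact (f'.dom_eq.trans f.dom_eq.symm)) (Obj.exact (f'.cod_eq.trans f.cod_eq.symm))) }

/-- The syntactic category `S(P)`: `[y : B ⊢ g : C] ∘ [x : A ⊢ f : B] = [x : A ⊢ g[f/y] : C]`. -/
instance : Category (Obj P) where
  Hom X Y := Quotient (judgementSetoid X Y)
  id X := Quotient.mk _ ⟨X.rep, X.rep, var 0, X.cls_rep, X.cls_rep, .var rfl⟩
  comp {X Y Z} := Quotient.map₂
    (fun f g => ⟨f.dom, g.cod, g.tm.inst f.tm, f.dom_eq, g.cod_eq,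
      (g.typed.weaken _).inst (.conv (Obj.exact (f.cod_eq.trans g.dom_eq.symm)) f.typed)⟩)
    (fun f f' hf g g' hg => (EqTm.weaken hg _).inst
      (.conv (Obj.exact (f.cod_eq.trans g.dom_eq.symm)) hf))
  id_comp {X Y} f := by
    induction f using Quotient.ind with | _ f =>
    refine Quotient.sound ?_
    have e : P.TyEq f.dom X.rep := Obj.exact (f.dom_eq.trans X.cls_rep.symm)
    refine EqTm.conv_ctx e (.refl _) ?_
    show P.EqTm _ (f.tm.inst (var 0)) f.tm _
    rw [f.typed.inst_one, f.typed.subst_zero]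
    exact .refl f.typed
  comp_id {X Y} f := by
    induction f using Quotient.ind with | _ f =>
    refine Quotient.sound ?_
    exact .refl (.conv (Obj.exact (f.cod_eq.trans Y.cls_rep.symm)) f.typed)
  assoc {W X Y Z} f g h := by
    induction f using Quotient.ind with | _ f =>
    induction g using Quotient.ind with | _ g =>
    induction h using Quotient.ind with | _ h =>
    refine Quotient.sound ?_
    have hg := h.typed.inst_one
    show P.EqTm _ (h.tm.inst (g.tm.inst f.tm)) ((h.tm.inst g.tm).inst f.tm) _
    have hf : P.HasType [f.dom] f.tm g.dom :=
      .conv (Obj.exact (f.cod_eq.trans g.dom_eq.symm)) f.typed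
    have hg : P.HasType [g.dom] g.tm h.dom :=
      .conv (Obj.exact (g.cod_eq.trans h.dom_eq.symm)) g.typed
    have e : h.tm.inst (g.tm.inst f.tm) = (h.tm.inst g.tm).inst f.tm := by
      rw [h.typed.inst_one, h.typed.inst_one, hg.inst_one, (h.typed.subst' hg).inst_one,
        subst_subst]
    rw [← e]
    exact .refl ((h.typed.weaken _).inst ((hg.weaken _).inst hf))

/-- The morphism `[x : A ⊢ f : B]`, with domain and codomain given up to equality. -/
def homOf {X Y : Obj P} (A B : Ty P.G) (hA : Obj.cls A = X) (hB : Obj.cls B = Y) (f : Tm P.G P.K)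
    (h : P.HasType [A] f B) : X ⟶ Y :=
  Quotient.mk _ ⟨A, B, f, hA, hB, h⟩

/-- The morphism `[x : A ⊢ f : B]`. -/
def hom {A B : Ty P.G} (f : Tm P.G P.K) (h : P.HasType [A] f B) :
    (Obj.cls A : Obj P) ⟶ Obj.cls B :=
  homOf A B rfl rfl f h

theorem homOf_eq {A B A' B' : Ty P.G} {hA hB f f'} {h : P.HasType [A] f B} {h' : P.HasType [A'] f' B'}
    (e : P.EqTm [A] f f' B) : homOf A' B' hA hB f' h' = hom f h :=
  (Quotient.sound e).symm

theorem hom_eq {A B : Ty P.G} {f f'} {h : P.HasType [A] f B} {h' : P.HasType [A] f' B}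
    (e : P.EqTm [A] f f' B) : hom f h = hom f' h' :=
  Quotient.sound e

theorem hom_exact {A B : Ty P.G} {f f'} {h : P.HasType [A] f B} {h' : P.HasType [A] f' B}
    (e : hom f h = hom f' h') : P.EqTm [A] f f' B :=
  Quotient.exact e

theorem exists_hom {A B : Ty P.G} (f : (Obj.cls A : Obj P) ⟶ Obj.cls B) :
    ∃ (t : Tm P.G P.K) (h : P.HasType [A] t B), f = hom t h := by
  induction f using Quotient.ind with | _ f =>
  have h := f.typed.conv_ctx (Obj.exact f.dom_eq) (Obj.exact f.cod_eq)
  exact ⟨f.tm, h, homOf_eq (.refl h)⟩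

theorem comp_hom {A B C : Ty P.G} {f g} (hf : P.HasType [A] f B) (hg : P.HasType [B] g C) :
    hom f hf ≫ hom g hg = hom (g.subst fun _ => f) (hg.subst' hf) := by
  refine hom_eq (h := (hg.weaken _).inst hf) ?_
  rw [← hg.inst_one]
  exact .refl ((hg.weaken _).inst hf)

theorem id_hom (A : Ty P.G) : 𝟙 (Obj.cls A : Obj P) = hom (var 0) (.var rfl) :=
  homOf_eq (.refl (.var rfl))

/-! ### Finite products -/

/-- The first projection `[x : A × B ⊢ π₁ x : A]`. -/
def fstHom (X Y : Obj P) : Obj.prod X Y ⟶ X :=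
  homOf (prod X.rep Y.rep) X.rep (congrArg₂ Obj.prod X.cls_rep Y.cls_rep) X.cls_rep
    (fst X.rep Y.rep (var 0)) (.fst (.var rfl))

/-- The second projection `[x : A × B ⊢ π₂ x : B]`. -/
def sndHom (X Y : Obj P) : Obj.prod X Y ⟶ Y :=
  homOf (prod X.rep Y.rep) Y.rep (congrArg₂ Obj.prod X.cls_rep Y.cls_rep) Y.cls_rep
    (snd X.rep Y.rep (var 0)) (.snd (.var rfl))

/-- The pairing `[z : C ⊢ ⟨f, g⟩ : A × B]`. -/
def pairHom {Z X Y : Obj P} : (Z ⟶ X) → (Z ⟶ Y) → (Z ⟶ Obj.prod X Y) :=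
  Quotient.map₂
    (fun f g => ⟨f.dom, prod f.cod g.cod, pair f.tm g.tm, f.dom_eq,
      congrArg₂ Obj.prod f.cod_eq g.cod_eq,
      .pair f.typed (g.typed.conv_ctx (Obj.exact (g.dom_eq.trans f.dom_eq.symm)) (.refl _))⟩)
    (fun f _ hf g _ hg => .pair_eq hf
      (EqTm.conv_ctx (Obj.exact (g.dom_eq.trans f.dom_eq.symm)) (.refl _) hg))

theorem rep_eq (A : Ty P.G) : P.TyEq A (Obj.rep (Obj.cls A : Obj P)) :=
  Obj.exact (Obj.cls_rep (Obj.cls A)).symm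

theorem fstHom_hom (A B : Ty P.G) : fstHom (Obj.cls A : Obj P) (Obj.cls B) =
    hom (A := prod A B) (fst A B (var 0)) (.fst (.var rfl)) :=
  homOf_eq (.fst_eq (rep_eq A) (rep_eq B) (.refl (.var rfl)))

theorem sndHom_hom (A B : Ty P.G) : sndHom (Obj.cls A : Obj P) (Obj.cls B) =
    hom (A := prod A B) (snd A B (var 0)) (.snd (.var rfl)) :=
  homOf_eq (.snd_eq (rep_eq A) (rep_eq B) (.refl (.var rfl)))

theorem pairHom_hom {C A B : Ty P.G} {f g} (hf : P.HasType [C] f A) (hg : P.HasType [C] g B) :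
    pairHom (hom f hf) (hom g hg) = hom (pair f g) (.pair hf hg) := rfl

theorem pairHom_fst {Z X Y : Obj P} (f : Z ⟶ X) (g : Z ⟶ Y) : pairHom f g ≫ fstHom X Y = f := by
  induction X using Obj.ind with | _ A
  induction Y using Obj.ind with | _ B
  induction Z using Obj.ind with | _ C
  obtain ⟨f, hf, rfl⟩ := exists_hom f
  obtain ⟨g, hg, rfl⟩ := exists_hom g
  rw [pairHom_hom, fstHom_hom]
  exact (comp_hom _ _).trans (hom_eq (.fst_beta hf hg))

theorem pairHom_snd {Z X Y : Obj P} (f : Z ⟶ X) (g : Z ⟶ Y) : pairHom f g ≫ sndHom X Y = g := by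
  induction X using Obj.ind with | _ A
  induction Y using Obj.ind with | _ B
  induction Z using Obj.ind with | _ C
  obtain ⟨f, hf, rfl⟩ := exists_hom f
  obtain ⟨g, hg, rfl⟩ := exists_hom g
  rw [pairHom_hom, sndHom_hom]
  exact (comp_hom _ _).trans (hom_eq (.snd_beta hf hg))

theorem pairHom_eta {Z X Y : Obj P} (f : Z ⟶ Obj.prod X Y) :
    pairHom (f ≫ fstHom X Y) (f ≫ sndHom X Y) = f := by
  induction X using Obj.ind with | _ A
  induction Y using Obj.ind with | _ B
  induction Z using Obj.ind with | _ C
  obtain ⟨f, hf, rfl⟩ := exists_hom (B := prod A B) f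
  rw [fstHom_hom, sndHom_hom]
  exact (congrArg₂ pairHom (comp_hom hf _) (comp_hom hf _)).trans (hom_eq (.pair_eta hf))

/-- The terminal morphism `[x : A ⊢ * : 1]`. -/
def unitHom (X : Obj P) : X ⟶ Obj.cls unit :=
  homOf X.rep unit X.cls_rep rfl star .star

theorem unitHom_unique {X : Obj P} (f : X ⟶ Obj.cls unit) : f = unitHom X := by
  induction X using Obj.ind with | _ A
  obtain ⟨f, hf, rfl⟩ := exists_hom f
  refine Eq.trans ?_ (homOf_eq (h := .star) (.refl .star)).symm
  have := (EqTm.unit_eta (P := P) (Γ := [])).comp (.refl hf)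
  exact hom_eq this.symm

/-- The chosen finite products of the syntactic category are given by `1` and `A × B`. -/
instance : CartesianMonoidalCategory (Obj P) :=
  .ofChosenFiniteProducts
    { cone := Limits.asEmptyCone (Obj.cls unit)
      isLimit := Limits.IsTerminal.ofUniqueHom unitHom fun _ f => unitHom_unique f }
    fun X Y =>
    { cone := Limits.BinaryFan.mk (fstHom X Y) (sndHom X Y)
      isLimit := Limits.BinaryFan.IsLimit.mk _ (fun f g => pairHom f g)
        (fun f g => pairHom_fst f g) (fun f g => pairHom_snd f g)
        (fun f g m hf hg => by
          rw [← pairHom_eta m]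
          exact congrArg₂ pairHom hf hg) }

theorem tensorObj_def (X Y : Obj P) : X ⊗ Y = Obj.prod X Y := rfl

theorem tensorUnit_def : 𝟙_ (Obj P) = Obj.cls unit := rfl

theorem fst_def (X Y : Obj P) : CartesianMonoidalCategory.fst X Y = fstHom X Y := rfl

theorem snd_def (X Y : Obj P) : CartesianMonoidalCategory.snd X Y = sndHom X Y := rfl

theorem lift_def {X Y Z : Obj P} (f : Z ⟶ X) (g : Z ⟶ Y) :
    CartesianMonoidalCategory.lift f g = pairHom f g := by
  apply CartesianMonoidalCategory.hom_ext
  · exact (CartesianMonoidalCategory.lift_fst f g).trans (pairHom_fst f g).symm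
  · exact (CartesianMonoidalCategory.lift_snd f g).trans (pairHom_snd f g).symm

theorem whiskerLeft_def {X Y : Obj P} (Z : Obj P) (f : X ⟶ Y) :
    Z ◁ f = pairHom (fstHom Z X) (sndHom Z X ≫ f) := by
  rw [← lift_def]
  apply CartesianMonoidalCategory.hom_ext
  · exact (CartesianMonoidalCategory.whiskerLeft_fst Z f).trans
      (CartesianMonoidalCategory.lift_fst _ _).symm
  · exact (CartesianMonoidalCategory.whiskerLeft_snd Z f).trans
      (CartesianMonoidalCategory.lift_snd _ _).symm

/-! ### Exponentials -/

/-- The evaluation `[p : A × (A → B) ⊢ (π₂ p) (π₁ p) : B]`. -/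
def evHom (X Y : Obj P) : Obj.prod X (Obj.arr X Y) ⟶ Y :=
  homOf (prod X.rep (arr X.rep Y.rep)) Y.rep
    (congrArg₂ Obj.prod X.cls_rep (congrArg₂ Obj.arr X.cls_rep Y.cls_rep)) Y.cls_rep
    (app X.rep Y.rep (snd X.rep (arr X.rep Y.rep) (var 0)) (fst X.rep (arr X.rep Y.rep) (var 0)))
    (.app (.snd (.var rfl)) (.fst (.var rfl)))

theorem evHom_hom (A B : Ty P.G) : evHom (Obj.cls A : Obj P) (Obj.cls B) =
    hom (A := prod A (arr A B)) (app A B (snd A (arr A B) (var 0)) (fst A (arr A B) (var 0)))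
      (.app (.snd (.var rfl)) (.fst (.var rfl))) :=
  homOf_eq (.app_eq (rep_eq A) (rep_eq B)
    (.snd_eq (rep_eq A) (.arr (rep_eq A) (rep_eq B)) (.refl (.var rfl)))
    (.fst_eq (rep_eq A) (.arr (rep_eq A) (rep_eq B)) (.refl (.var rfl))))

theorem hasType_pair (A C : Ty P.G) (Γ) :
    P.HasType (A :: C :: Γ) (pair (var 0) (var 1)) (prod A C) :=
  .pair (.var rfl) (.var rfl)

/-- The currying `[z : C ⊢ λ x^A. f[⟨x, z⟩] : A → B]` of `f : A × C → B`. -/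
def curryHom {X Y Z : Obj P} : (Obj.prod X Z ⟶ Y) → (Z ⟶ Obj.arr X Y) :=
  Quotient.map
    (fun f => ⟨Z.rep, arr X.rep f.cod, lam X.rep (f.tm.subst fun _ => pair (var 0) (var 1)),
      Z.cls_rep, congrArg₂ Obj.arr X.cls_rep f.cod_eq,
      .lam (f.typed.subst' (.conv (Obj.exact ((congrArg₂ Obj.prod X.cls_rep Z.cls_rep).trans
        f.dom_eq.symm)) (hasType_pair _ _ _)))⟩)
    (fun f _ hf => .lam_eq (.refl _) (EqTm.comp hf
      (.refl (.conv (Obj.exact ((congrArg₂ Obj.prod X.cls_rep Z.cls_rep).trans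
        f.dom_eq.symm)) (hasType_pair _ _ _)))))

theorem curryHom_hom {A B C : Ty P.G} {f} (hf : P.HasType [prod A C] f B) :
    curryHom (X := Obj.cls A) (Z := Obj.cls C) (hom f hf) =
      hom (B := arr A B) (lam A (f.subst fun _ => pair (var 0) (var 1)))
        (.lam (hf.subst' (hasType_pair A C []))) := by
  refine homOf_eq (.lam_eq (rep_eq A) (.refl (hf.subst' (hasType_pair A C []))))

/-- The inverse of currying. -/
def uncurryHom {X Y Z : Obj P} (f : Z ⟶ Obj.arr X Y) : Obj.prod X Z ⟶ Y :=
  pairHom (fstHom X Z) (sndHom X Z ≫ f) ≫ evHom X Y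

theorem uncurryHom_hom {A B C : Ty P.G} {f} (hf : P.HasType [C] f (arr A B)) :
    uncurryHom (X := Obj.cls A) (Y := Obj.cls B) (hom f hf) =
      hom (A := prod A C) (app A B (f.subst fun _ => snd A C (var 0)) (fst A C (var 0)))
        (.app (hf.subst' (.snd (.var rfl))) (.fst (.var rfl))) := by
  have h₂ : P.HasType [prod A C] (f.subst fun _ => snd A C (var 0)) (arr A B) :=
    hf.subst' (.snd (.var rfl))
  have h₁ : P.HasType [prod A C] (fst A C (var 0)) A := .fst (.var rfl)
  have e : pairHom (fstHom (Obj.cls A) (Obj.cls C)) (sndHom (Obj.cls A) (Obj.cls C) ≫ hom f hf) =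
      hom (A := prod A C) (B := prod A (arr A B))
        (pair (fst A C (var 0)) (f.subst fun _ => snd A C (var 0)))
        (.pair (.fst (.var rfl)) (hf.subst' (.snd (.var rfl)))) := by
    rw [fstHom_hom, sndHom_hom]
    exact congrArg (pairHom _) (comp_hom _ hf)
  unfold uncurryHom
  refine (congrArg₂ (· ≫ ·) e (evHom_hom A B)).trans ((comp_hom _ _).trans (hom_eq ?_))
  exact .app_eq (.refl _) (.refl _) (.snd_beta h₁ h₂) (.fst_beta h₁ h₂)

theorem curryHom_uncurryHom {X Y Z : Obj P} (f : Z ⟶ Obj.arr X Y) :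
    curryHom (uncurryHom f) = f := by
  induction X using Obj.ind with | _ A
  induction Y using Obj.ind with | _ B
  induction Z using Obj.ind with | _ C
  obtain ⟨f, hf, rfl⟩ := exists_hom (B := arr A B) f
  refine (congrArg curryHom (uncurryHom_hom hf)).trans ((curryHom_hom _).trans (hom_eq ?_))
  refine .trans (.lam_eq (.refl _) ?_) (.lam_eta hf)
  have e : (f.subst fun _ => snd A C (var 0)).subst (fun _ => pair (var 0) (var 1)) =
      f.subst fun _ => snd A C (pair (var 0) (var 1)) := subst_subst _ _ _
  have e' : f.wk = f.subst fun _ => var 1 := by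
    rw [← subst_var f.wk]
    exact (subst_rename _ _ _).trans (hf.subst_one _)
  simp only [Tm.subst, e, e']
  exact .app_eq (.refl _) (.refl _)
    ((EqTm.refl hf).comp (.snd_beta (.var rfl) (.var rfl))) (.fst_beta (.var rfl) (.var rfl))

theorem uncurryHom_curryHom {X Y Z : Obj P} (f : Obj.prod X Z ⟶ Y) :
    uncurryHom (curryHom f) = f := by
  induction X using Obj.ind with | _ A
  induction Y using Obj.ind with | _ B
  induction Z using Obj.ind with | _ C
  obtain ⟨f, hf, rfl⟩ := exists_hom (A := prod A C) f
  refine (congrArg uncurryHom (curryHom_hom hf)).trans ((uncurryHom_hom _).trans (hom_eq ?_))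
  have hp : P.HasType [A, prod A C] (pair (var 0) (snd A C (var 1))) (prod A C) :=
    .pair (.var rfl) (.snd (.var rfl))
  have e : (f.subst fun _ => pair (var 0) (var 1)).subst (up fun _ => snd A C (var 0)) =
      f.subst fun _ => pair (var 0) (snd A C (var 1)) := subst_subst _ _ _
  simp only [Tm.subst, e]
  refine .trans (.lam_beta (hf.subst' hp) (.fst (.var rfl))) ?_
  have e' : (f.subst fun _ => pair (var 0) (snd A C (var 1))).inst (fst A C (var 0)) =
      f.subst fun _ => pair (fst A C (var 0)) (snd A C (var 0)) := subst_subst _ _ _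
  rw [e']
  have := (EqTm.refl hf).comp (.pair_eta (.var (Γ := [prod A C]) (n := 0) rfl))
  rwa [hf.subst_zero] at this

theorem uncurryHom_comp {X Y Z Z' : Obj P} (g : Z' ⟶ Z) (f : Z ⟶ Obj.arr X Y) :
    uncurryHom (g ≫ f) = X ◁ g ≫ uncurryHom f := by
  unfold uncurryHom
  rw [whiskerLeft_def]
  refine Eq.trans ?_ (Category.assoc (pairHom (fstHom X Z') (sndHom X Z' ≫ g)) _ _)
  congr 1
  rw [← pairHom_eta (pairHom (fstHom X Z') (sndHom X Z' ≫ g) ≫ _), Category.assoc, pairHom_fst,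
    pairHom_fst, Category.assoc, pairHom_snd, ← Category.assoc (pairHom _ _), pairHom_snd,
    Category.assoc]

/-- The bijection `(A × C ⟶ B) ≃ (C ⟶ B^A)`. -/
def curryEquiv (X Z Y : Obj P) : ((tensorLeft X).obj Z ⟶ Y) ≃ (Z ⟶ Obj.arr X Y) where
  toFun := curryHom
  invFun := uncurryHom
  left_inv := uncurryHom_curryHom
  right_inv := curryHom_uncurryHom

theorem curryEquiv_natural (X Z' Z Y : Obj P) (g : Z' ⟶ Z) (f : (tensorLeft X).obj Z ⟶ Y) :
    curryEquiv X Z' Y ((tensorLeft X).map g ≫ f) = g ≫ curryEquiv X Z Y f := by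
  rw [← Equiv.eq_symm_apply]
  refine Eq.trans ?_ (uncurryHom_comp g _).symm
  exact congrArg (X ◁ g ≫ ·) (uncurryHom_curryHom f).symm

/-- The chosen exponentials of the syntactic category are given by `A → B`. -/
instance : MonoidalClosed (Obj P) where
  closed X :=
    { rightAdj := Adjunction.rightAdjointOfEquiv (curryEquiv X) (curryEquiv_natural X)
      adj := Adjunction.adjunctionOfEquivRight (curryEquiv X) (curryEquiv_natural X) }

theorem ihom_def (X Y : Obj P) : (ihom X).obj Y = Obj.arr X Y := rfl

theorem ihom_ev_def (X Y : Obj P) : (ihom.ev X).app Y = evHom X Y := by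
  refine (Eq.refl (uncurryHom (𝟙 (Obj.arr X Y)))).trans ?_
  unfold uncurryHom
  rw [Category.comp_id]
  have := pairHom_eta (𝟙 (Obj.prod X (Obj.arr X Y)))
  rw [Category.id_comp, Category.id_comp] at this
  rw [this, Category.id_comp]

end Theory

/-! ## Strong monads, central submonads, models -/

open CartesianMonoidalCategory in
/-- A strong monad on a category with chosen finite products: a monad with a natural (left)
strength `X × T Y ⟶ T (X × Y)` subject to the usual coherence conditions. -/
structure StrongMonad (C : Type u) [Category.{v} C] [CartesianMonoidalCategory C] extends
    CategoryTheory.Monad C where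
  /-- the strength `τ` -/
  str (X Y : C) : X ⊗ toFunctor.obj Y ⟶ toFunctor.obj (X ⊗ Y)
  str_natural : ∀ {X X' Y Y' : C} (f : X ⟶ X') (g : Y ⟶ Y'),
    (f ⊗ₘ toFunctor.map g) ≫ str X' Y' = str X Y ≫ toFunctor.map (f ⊗ₘ g)
  str_unit : ∀ X : C, str (𝟙_ C) X ≫ toFunctor.map (λ_ X).hom = (λ_ (toFunctor.obj X)).hom
  str_assoc : ∀ X Y Z : C, str (X ⊗ Y) Z ≫ toFunctor.map (α_ X Y Z).hom =
    (α_ X Y (toFunctor.obj Z)).hom ≫ X ◁ str Y Z ≫ str X (Y ⊗ Z)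
  str_η : ∀ X Y : C, X ◁ η.app Y ≫ str X Y = η.app (X ⊗ Y)
  str_μ : ∀ X Y : C, X ◁ μ.app Y ≫ str X Y =
    str X (toFunctor.obj Y) ≫ toFunctor.map (str X Y) ≫ μ.app (X ⊗ Y)

namespace StrongMonad

variable {C : Type u} [Category.{v} C] [CartesianMonoidalCategory C]

/-- The symmetry `X × Y ⟶ Y × X`. -/
def swap (X Y : C) : X ⊗ Y ⟶ Y ⊗ X :=
  CartesianMonoidalCategory.lift (CartesianMonoidalCategory.snd X Y)
    (CartesianMonoidalCategory.fst X Y)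

variable (T : StrongMonad C)

/-- The right strength `τ' : T X × Y ⟶ T (X × Y)`. -/
def rstr (X Y : C) : T.obj X ⊗ Y ⟶ T.obj (X ⊗ Y) :=
  swap (T.obj X) Y ≫ T.str Y X ≫ T.map (swap Y X)

/-- `(Z, f)`, with `f : Z ⟶ T X`, is a central cone of `T` at `X`: for each `Y`, the two ways
`μ ∘ T τ' ∘ τ` and `μ ∘ T τ ∘ τ'` from `T X × T Y` to `T (X × Y)` agree on `Z × T Y`. -/
def IsCentralCone {X Z : C} (f : Z ⟶ T.obj X) : Prop :=
  ∀ Y : C, f ▷ T.obj Y ≫ T.str (T.obj X) Y ≫ T.map (T.rstr X Y) ≫ T.μ.app (X ⊗ Y) =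
    f ▷ T.obj Y ≫ T.rstr X (T.obj Y) ≫ T.map (T.str X Y) ≫ T.μ.app (X ⊗ Y)

/-- A morphism of strong monads: a natural transformation that commutes with units,
multiplications and strengths. -/
structure Hom (S T : StrongMonad C) extends MonadHom S.toMonad T.toMonad where
  app_str : ∀ X Y : C, S.str X Y ≫ app (X ⊗ Y) = X ◁ app Y ≫ T.str X Y

end StrongMonad

/-- A `CSC`-model: a cartesian closed category with a strong monad `T` and a central submonad `S`
of `T`, with inclusion `ι`. -/
structure Model : Type (max (u + 1) (v + 1)) where
  /-- the underlying category -/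
  C : Type u
  [cat : Category.{v} C]
  [cart : CartesianMonoidalCategory C]
  [closed : MonoidalClosed C]
  /-- the monad of computations -/
  T : StrongMonad C
  /-- the submonad of central computations -/
  S : StrongMonad C
  /-- the inclusion of `S` into `T` -/
  ι : StrongMonad.Hom S T
  mono_ι : ∀ X : C, Mono (ι.app X)
  central : ∀ X : C, T.IsCentralCone (ι.app X)

attribute [instance] Model.cat Model.cart Model.closed

/-- The strong monad of a model that interprets `𝒳`. -/
def Model.mon (M : Model.{u, v}) : Eff → StrongMonad M.C
  | .S => M.S
  | .T => M.T

namespace Theory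

variable {P : Theory.{g, k}}

open Ty Tm Eff

/-! ### The monads of the syntactic category -/

theorem whiskerRight_def {X Y : Obj P} (f : X ⟶ Y) (Z : Obj P) :
    f ▷ Z = pairHom (fstHom X Z ≫ f) (sndHom X Z) := by
  rw [← lift_def]
  apply CartesianMonoidalCategory.hom_ext
  · exact (CartesianMonoidalCategory.whiskerRight_fst f Z).trans
      (CartesianMonoidalCategory.lift_fst _ _).symm
  · exact (CartesianMonoidalCategory.whiskerRight_snd f Z).trans
      (CartesianMonoidalCategory.lift_snd _ _).symm

theorem whiskerLeft_hom {A B : Ty P.G} (C : Ty P.G) {f} (hf : P.HasType [A] f B) :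
    (Obj.cls C : Obj P) ◁ hom f hf = hom (A := prod C A) (B := prod C B)
      (pair (fst C A (var 0)) (f.subst fun _ => snd C A (var 0)))
      (.pair (.fst (.var rfl)) (hf.subst' (.snd (.var rfl)))) := by
  rw [whiskerLeft_def, fstHom_hom, sndHom_hom]
  exact congrArg (pairHom _) (comp_hom _ hf)

theorem whiskerRight_hom {A B : Ty P.G} (C : Ty P.G) {f} (hf : P.HasType [A] f B) :
    hom f hf ▷ (Obj.cls C : Obj P) = hom (A := prod A C) (B := prod B C)
      (pair (f.subst fun _ => fst A C (var 0)) (snd A C (var 0)))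
      (.pair (hf.subst' (.fst (.var rfl))) (.snd (.var rfl))) := by
  rw [whiskerRight_def, fstHom_hom, sndHom_hom]
  exact congrArg (fun x => pairHom x _) (comp_hom _ hf)

theorem tensorHom_hom {A B C D : Ty P.G} {f f'} (hf : P.HasType [A] f B)
    (hf' : P.HasType [C] f' D) :
    hom f hf ⊗ₘ hom f' hf' = hom (A := prod A C) (B := prod B D)
      (pair (f.subst fun _ => fst A C (var 0)) (f'.subst fun _ => snd A C (var 0)))
      (.pair (hf.subst' (.fst (.var rfl))) (hf'.subst' (.snd (.var rfl)))) := by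
  have e : hom f hf ⊗ₘ hom f' hf' = pairHom (fstHom (Obj.cls A) (Obj.cls C) ≫ hom f hf)
      (sndHom (Obj.cls A) (Obj.cls C) ≫ hom f' hf') := by
    rw [← lift_def]
    apply CartesianMonoidalCategory.hom_ext
    · exact (CartesianMonoidalCategory.tensorHom_fst _ _).trans
        (CartesianMonoidalCategory.lift_fst _ _).symm
    · exact (CartesianMonoidalCategory.tensorHom_snd _ _).trans
        (CartesianMonoidalCategory.lift_snd _ _).symm
  rw [e, fstHom_hom, sndHom_hom]
  exact congrArg₂ pairHom (comp_hom _ hf) (comp_hom _ hf')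

/-- The substitution `0 ↦ N`, `n + 1 ↦ n + 1`. -/
def repl (N : Tm P.G P.K) : ℕ → Tm P.G P.K
  | 0 => N
  | n + 1 => var (n + 1)

theorem HasType.repl {Γ : List (Ty P.G)} {A B C : Ty P.G} {N L : Tm P.G P.K}
    (hN : P.HasType (A :: Γ) N B) (hL : P.HasType (B :: Γ) L C) :
    P.HasType (A :: Γ) (L.subst (repl N)) C :=
  hL.subst fun n D hn => by
    cases n with
    | zero =>
      obtain rfl : B = D := by simpa using hn
      exact hN
    | succ n => exact .var hn

theorem HasType.upr {Γ : List (Ty P.G)} {A B C : Ty P.G} {L : Tm P.G P.K}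
    (hL : P.HasType (B :: Γ) L C) : P.HasType (B :: A :: Γ) (L.rename (upr Nat.succ)) C :=
  hL.rename fun n D hn => by
    cases n with
    | zero => exact hn
    | succ n => exact hn

/-- `do y ← (do x ← M; ret N); L` equals `do x ← M; L[N/y]`. -/
theorem EqTm.bind_ret {Γ M N L A B C} (X : Eff) (hM : P.HasType Γ M (mon X A))
    (hN : P.HasType (A :: Γ) N B) (hL : P.HasType (B :: Γ) L (mon X C)) :
    P.EqTm Γ (bind X B C (bind X A B M (ret X N)) L) (bind X A C M (L.subst (repl N)))
      (mon X C) := by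
  refine .trans (.bind_assoc X hM (.ret X hN) hL)
    (.bind_eq X (.refl _) (.refl _) (.refl hM) ?_)
  have e : L.subst (repl N) = (L.rename (upr Nat.succ)).inst N := by
    refine Eq.trans ?_ (subst_rename _ _ _).symm
    congr 1
    funext n
    cases n <;> rfl
  rw [e]
  exact .bind_beta X hN (HasType.upr hL)

/-- The action of `𝒳` on a morphism `f : A ⟶ B`: `[y : 𝒳 A ⊢ do x ← y; ret f : 𝒳 B]`. -/
def monMap (X : Eff) {Y Z : Obj P} : (Y ⟶ Z) → (Obj.mon X Y ⟶ Obj.mon X Z) :=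
  Quotient.map
    (fun f => ⟨mon X f.dom, mon X f.cod, bind X f.dom f.cod (var 0) (ret X f.tm),
      congrArg (Obj.mon X) f.dom_eq, congrArg (Obj.mon X) f.cod_eq, .bind (.var rfl) (.ret X (f.typed.weaken _))⟩)
    (fun f f' hf => .bind_eq X (Obj.exact (f.dom_eq.trans f'.dom_eq.symm))
      (Obj.exact (f.cod_eq.trans f'.cod_eq.symm)) (.refl (.var rfl))
      (.ret_eq X (EqTm.weaken hf _)))

theorem hasType_map (X : Eff) {A B : Ty P.G} {f} (hf : P.HasType [A] f B) :
    P.HasType [mon X A] (bind X A B (var 0) (ret X f)) (mon X B) :=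
  .bind (.var rfl) (.ret X (hf.weaken _))

theorem monMap_hom (X : Eff) {A B : Ty P.G} {f} (hf : P.HasType [A] f B) :
    monMap X (hom f hf) = hom (A := mon X A) (B := mon X B)
      (bind X A B (var 0) (ret X f)) (hasType_map X hf) := rfl

/-- The unit `[x : A ⊢ ret x : 𝒳 A]`. -/
def monUnit (X : Eff) (Y : Obj P) : Y ⟶ Obj.mon X Y :=
  homOf Y.rep (mon X Y.rep) Y.cls_rep (congrArg (Obj.mon X) Y.cls_rep) (ret X (var 0))
    (.ret X (.var rfl))

theorem monUnit_hom (X : Eff) (A : Ty P.G) : monUnit X (Obj.cls A : Obj P) =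
    hom (B := mon X A) (ret X (var 0)) (.ret X (.var rfl)) :=
  homOf_eq (.refl (.ret X (.var rfl)))

theorem hasType_mult (X : Eff) (A : Ty P.G) :
    P.HasType [mon X (mon X A)] (bind X (mon X A) A (var 0) (var 0)) (mon X A) :=
  .bind (.var rfl) (.var rfl)

/-- The multiplication `[x : 𝒳 𝒳 A ⊢ do y ← x; y : 𝒳 A]`. -/
def monMult (X : Eff) (Y : Obj P) : Obj.mon X (Obj.mon X Y) ⟶ Obj.mon X Y :=
  homOf (mon X (mon X Y.rep)) (mon X Y.rep) (congrArg (Obj.mon X ∘ Obj.mon X) Y.cls_rep)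
    (congrArg (Obj.mon X) Y.cls_rep) (bind X (mon X Y.rep) Y.rep (var 0) (var 0))
    (hasType_mult X Y.rep)

theorem monMult_hom (X : Eff) (A : Ty P.G) : monMult X (Obj.cls A : Obj P) =
    hom (A := mon X (mon X A)) (B := mon X A) (bind X (mon X A) A (var 0) (var 0))
      (hasType_mult X A) :=
  homOf_eq (.bind_eq X (.mon X (rep_eq A)) (rep_eq A) (.refl (.var rfl)) (.refl (.var rfl)))

theorem hasType_str (X : Eff) (A B : Ty P.G) : P.HasType [prod A (mon X B)]
    (bind X B (prod A B) (snd A (mon X B) (var 0)) (ret X (pair (fst A (mon X B) (var 1)) (var 0))))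
    (mon X (prod A B)) :=
  .bind (.snd (.var rfl)) (.ret X (.pair (.fst (.var rfl)) (.var rfl)))

/-- The strength `[x : A × 𝒳 B ⊢ do y ← π₂ x; ret ⟨π₁ x, y⟩ : 𝒳 (A × B)]`. -/
def monStr (X : Eff) (Y Z : Obj P) : Obj.prod Y (Obj.mon X Z) ⟶ Obj.mon X (Obj.prod Y Z) :=
  homOf (prod Y.rep (mon X Z.rep)) (mon X (prod Y.rep Z.rep))
    (congrArg₂ Obj.prod Y.cls_rep (congrArg (Obj.mon X) Z.cls_rep))
    (congrArg (Obj.mon X) (congrArg₂ Obj.prod Y.cls_rep Z.cls_rep))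
    (bind X Z.rep (prod Y.rep Z.rep) (snd Y.rep (mon X Z.rep) (var 0))
      (ret X (pair (fst Y.rep (mon X Z.rep) (var 1)) (var 0))))
    (hasType_str X Y.rep Z.rep)

theorem monStr_hom (X : Eff) (A B : Ty P.G) : monStr X (Obj.cls A : Obj P) (Obj.cls B) =
    hom (A := prod A (mon X B)) (B := mon X (prod A B))
    (bind X B (prod A B) (snd A (mon X B) (var 0)) (ret X (pair (fst A (mon X B) (var 1)) (var 0))))
    (hasType_str X A B) :=
  homOf_eq (.bind_eq X (rep_eq B) (.prod (rep_eq A) (rep_eq B))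
    (.snd_eq (rep_eq A) (.mon X (rep_eq B)) (.refl (.var rfl)))
    (.ret_eq X (.pair_eq (.fst_eq (rep_eq A) (.mon X (rep_eq B)) (.refl (.var rfl)))
      (.refl (.var rfl)))))

theorem monMap_id (X : Eff) (Y : Obj P) : monMap X (𝟙 Y) = 𝟙 (Obj.mon X Y) := by
  induction Y using Obj.ind with | _ A
  refine (congrArg _ (id_hom A)).trans (.trans ?_ (id_hom (mon X A)).symm)
  exact hom_eq (.bind_eta X (.var (Γ := [mon X A]) (n := 0) rfl))

theorem monMap_comp (X : Eff) {Y Z W : Obj P} (f : Y ⟶ Z) (g : Z ⟶ W) :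
    monMap X (f ≫ g) = monMap X f ≫ monMap X g := by
  induction Y using Obj.ind with | _ A
  induction Z using Obj.ind with | _ B
  induction W using Obj.ind with | _ C
  obtain ⟨f, hf, rfl⟩ := exists_hom f
  obtain ⟨g, hg, rfl⟩ := exists_hom g
  refine (congrArg _ (comp_hom hf hg)).trans (.trans ?_
    (comp_hom (hasType_map X hf) (hasType_map X hg)).symm)
  refine hom_eq (.symm ?_)
  simp only [Tm.subst]
  rw [hg.subst_id (up _) rfl]
  refine .trans (.bind_ret X (.var rfl) (hf.weaken _) (.ret X (hg.weaken _))) ?_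
  simp only [Tm.subst]
  rw [hg.subst_one]
  exact .refl (.bind (.var rfl) (.ret X (hg.subst' (hf.weaken _))))

theorem monUnit_natural (X : Eff) {Y Z : Obj P} (f : Y ⟶ Z) :
    f ≫ monUnit X Z = monUnit X Y ≫ monMap X f := by
  induction Y using Obj.ind with | _ A
  induction Z using Obj.ind with | _ B
  obtain ⟨f, hf, rfl⟩ := exists_hom f
  rw [monUnit_hom, monUnit_hom]
  refine (comp_hom hf _).trans (.trans ?_ (comp_hom _ (hasType_map X hf)).symm)
  refine hom_eq (.symm ?_)
  simp only [Tm.subst]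
  rw [hf.subst_id (up _) rfl]
  refine .trans (.bind_beta X (.var rfl) (.ret X (hf.weaken _))) ?_
  have e : (ret X f).inst (var 0) = ret X f := by
    simp only [Tm.inst, Tm.subst]
    rw [hf.subst_id (single (var 0)) rfl]
  rw [e]
  exact .refl (.ret X hf)

theorem monMult_natural (X : Eff) {Y Z : Obj P} (f : Y ⟶ Z) :
    monMap X (monMap X f) ≫ monMult X Z = monMult X Y ≫ monMap X f := by
  induction Y using Obj.ind with | _ A
  induction Z using Obj.ind with | _ B
  obtain ⟨f, hf, rfl⟩ := exists_hom f
  rw [monMult_hom, monMult_hom]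
  refine (comp_hom (hasType_map X (hasType_map X hf)) (hasType_mult X B)).trans
    (.trans ?_ (comp_hom (hasType_mult X A) (hasType_map X hf)).symm)
  refine hom_eq ?_
  simp only [Tm.subst, up]
  rw [hf.subst_id (up _) rfl]
  refine .trans (.bind_ret X (.var rfl) ((hasType_map X hf).weaken _) (.var rfl)) (.symm ?_)
  refine .trans (.bind_assoc X (.var rfl) (.var rfl) (.ret X (hf.weaken _))) ?_
  have e : (ret X f).rename (upr Nat.succ) = ret X f := by
    refine ((subst_var _).symm.trans (subst_rename _ _ _)).trans ?_
    simp only [Tm.subst]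
    rw [hf.subst_id (fun n => var (upr Nat.succ n)) rfl]
  rw [e]
  exact .refl (.bind (.var rfl) (.bind (.var rfl) (.ret X (hf.weaken _))))

theorem monMult_assoc (X : Eff) (Y : Obj P) :
    monMap X (monMult X Y) ≫ monMult X Y = monMult X (Obj.mon X Y) ≫ monMult X Y := by
  induction Y using Obj.ind with | _ A
  rw [monMult_hom]
  refine (comp_hom (hasType_map X (hasType_mult X A)) (hasType_mult X A)).trans (.trans ?_
    ((congrArg (· ≫ _) (monMult_hom X (mon X A))).trans
      (comp_hom (hasType_mult X (mon X A)) (hasType_mult X A))).symm)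
  refine hom_eq ?_
  simp only [Tm.subst, up]
  refine .trans (.bind_ret X (.var rfl) ((hasType_mult X A).weaken _) (.var rfl)) (.symm ?_)
  exact .bind_assoc X (.var rfl) (.var rfl) (.var rfl)

theorem monUnit_mult (X : Eff) (Y : Obj P) :
    monUnit X (Obj.mon X Y) ≫ monMult X Y = 𝟙 (Obj.mon X Y) := by
  induction Y using Obj.ind with | _ A
  rw [monMult_hom]
  refine ((congrArg (· ≫ _) (monUnit_hom X (mon X A))).trans
    (comp_hom _ (hasType_mult X A))).trans (.trans ?_ (id_hom (mon X A)).symm)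
  exact hom_eq (.bind_beta X (.var rfl) (.var rfl))

theorem monMap_unit_mult (X : Eff) (Y : Obj P) :
    monMap X (monUnit X Y) ≫ monMult X Y = 𝟙 (Obj.mon X Y) := by
  induction Y using Obj.ind with | _ A
  rw [monMult_hom, monUnit_hom]
  refine (comp_hom (hasType_map X (.ret X (.var rfl))) (hasType_mult X A)).trans
    (.trans ?_ (id_hom (mon X A)).symm)
  refine hom_eq ?_
  simp only [Tm.subst, up]
  refine .trans (.bind_ret X (.var rfl) (.ret X (.var rfl)) (.var rfl)) ?_
  exact .bind_eta X (.var rfl)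

/-- The typing of `do y ← M; ret ⟨N, y⟩`. -/
theorem hasType_bindPair (X : Eff) {Γ : List (Ty P.G)} {A B : Ty P.G} {M N}
    (hM : P.HasType Γ M (mon X B)) (hN : P.HasType (B :: Γ) N A) :
    P.HasType Γ (bind X B (prod A B) M (ret X (pair N (var 0)))) (mon X (prod A B)) :=
  .bind hM (.ret X (.pair hN (.var rfl)))

theorem hasType_bindRet (X : Eff) {Γ : List (Ty P.G)} {A B : Ty P.G} {M N}
    (hM : P.HasType Γ M (mon X A)) (hN : P.HasType (A :: Γ) N B) :
    P.HasType Γ (bind X A B M (ret X N)) (mon X B) :=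
  .bind hM (.ret X hN)

theorem wk_subst (M N : Tm P.G P.K) :
    (M.subst fun _ => N).wk = M.subst fun _ => N.wk := rename_subst _ _ _

theorem pair_str (X : Eff) {A B D : Ty P.G} {M N} (hM : P.HasType [D] M A)
    (hN : P.HasType [D] N (mon X B)) :
    hom (B := prod A (mon X B)) (pair M N) (.pair hM hN) ≫ monStr X (Obj.cls A) (Obj.cls B) =
      hom (B := mon X (prod A B)) (bind X B (prod A B) N (ret X (pair M.wk (var 0))))
        (hasType_bindPair X hN (hM.wk B)) := by
  refine (congrArg _ (monStr_hom X A B)).trans ((comp_hom _ (hasType_str X A B)).trans ?_)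
  refine hom_eq ?_
  exact .bind_eq X (.refl _) (.refl _) (.snd_beta hM hN)
    (.ret_eq X (.pair_eq (.fst_beta (hM.wk B) (hN.wk B)) (.refl (.var rfl))))

theorem bindRet_map (X : Eff) {A B C D : Ty P.G} {M N L} (hM : P.HasType [D] M (mon X A))
    (hN : P.HasType [A, D] N B) (hL : P.HasType [B] L C) :
    hom (B := mon X B) (bind X A B M (ret X N)) (hasType_bindRet X hM hN) ≫ monMap X (hom L hL) =
      hom (B := mon X C) (bind X A C M (ret X (L.subst fun _ => N)))
        (hasType_bindRet X hM (hL.subst' hN)) := by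
  refine (comp_hom _ (hasType_map X hL)).trans (hom_eq ?_)
  simp only [Tm.subst]
  rw [hL.subst_id (up _) rfl]
  refine .trans (.bind_ret X hM hN (.ret X (hL.weaken _))) ?_
  simp only [Tm.subst]
  rw [hL.subst_one]
  exact .refl (hasType_bindRet X hM (hL.subst' hN))

theorem bindRet_mult (X : Eff) {A B D : Ty P.G} {M N} (hM : P.HasType [D] M (mon X A))
    (hN : P.HasType [A, D] N (mon X B)) :
    hom (B := mon X (mon X B)) (bind X A (mon X B) M (ret X N)) (hasType_bindRet X hM hN) ≫
      monMult X (Obj.cls B) = hom (B := mon X B) (bind X A B M N) (.bind hM hN) := by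
  refine (congrArg _ (monMult_hom X B)).trans ((comp_hom _ (hasType_mult X B)).trans (hom_eq ?_))
  exact .bind_ret X hM hN (.var rfl)

theorem monStr_natural (X : Eff) {Y Y' Z Z' : Obj P} (f : Y ⟶ Y') (g : Z ⟶ Z') :
    (f ⊗ₘ monMap X g) ≫ monStr X Y' Z' = monStr X Y Z ≫ monMap X (f ⊗ₘ g) := by
  induction Y using Obj.ind with | _ A
  induction Y' using Obj.ind with | _ A'
  induction Z using Obj.ind with | _ B
  induction Z' using Obj.ind with | _ B'
  obtain ⟨f, hf, rfl⟩ := exists_hom f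
  obtain ⟨g, hg, rfl⟩ := exists_hom g
  have hv : P.HasType [prod A (mon X B)] (var 0) (prod A (mon X B)) := .var rfl
  have hv1 : ∀ C, P.HasType [C, prod A (mon X B)] (var 1) (prod A (mon X B)) := fun _ => .var rfl
  have hfg : P.HasType [prod A B] (pair (f.subst fun _ => fst A B (var 0))
      (g.subst fun _ => snd A B (var 0))) (prod A' B') :=
    .pair (hf.subst' (.fst (.var rfl))) (hg.subst' (.snd (.var rfl)))
  have hsub : P.HasType [prod A (mon X B)] (bind X B B' (snd A (mon X B) (var 0)) (ret X g))
      (mon X B') := .bind (.snd hv) (.ret X (hg.weaken _))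
  have hp : P.HasType [prod A (mon X B)] (pair (f.subst fun _ => fst A (mon X B) (var 0))
      (bind X B B' (snd A (mon X B) (var 0)) (ret X g))) (prod A' (mon X B')) :=
    .pair (hf.subst' (.fst hv)) hsub
  have e₁ : hom f hf ⊗ₘ monMap X (hom g hg) = hom _ hp := by
    refine (tensorHom_hom hf (hasType_map X hg)).trans (hom_eq ?_)
    simp only [Tm.subst]
    rw [hg.subst_id (up _) rfl]
    exact .refl hp
  have e₂ : monMap X (hom f hf ⊗ₘ hom g hg) = hom (A := mon X (prod A B)) (B := mon X (prod A' B'))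
      _ (hasType_map X hfg) := congrArg (monMap X) (tensorHom_hom hf hg)
  rw [e₁]
  refine (pair_str X (hf.subst' (.fst hv)) hsub).trans (.trans ?_
    ((congrArg₂ (· ≫ ·) (monStr_hom X A B) e₂).trans
      (bindRet_map X (.snd hv) (.pair (.fst (hv1 B)) (.var rfl)) hfg)).symm)
  have e : (f.subst fun _ => fst A (mon X B) (var 0)).wk =
      f.subst fun _ => fst A (mon X B) (var 1) := wk_subst _ _
  have e' : (f.subst fun _ => fst A (mon X B) (var 1)).subst (repl g) =
      f.subst fun _ => fst A (mon X B) (var 1) := subst_subst _ _ _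
  have e₃ : ∀ M, (f.subst fun _ => fst A B (var 0)).subst (fun _ => M) =
      f.subst fun _ => fst A B M := fun _ => subst_subst _ _ _
  have e₄ : ∀ M, (g.subst fun _ => snd A B (var 0)).subst (fun _ => M) =
      g.subst fun _ => snd A B M := fun _ => subst_subst _ _ _
  refine hom_eq (.trans (.bind_ret X (.snd hv) (hg.weaken _) ?_) ?_)
  · exact .ret X (.pair ((hf.subst' (.fst hv)).wk _) (.var rfl))
  · simp only [Tm.subst, e, e', e₃, e₄, repl]
    refine .bind_eq X (.refl _) (.refl _) (.refl (.snd hv)) (.ret_eq X (.pair_eq ?_ ?_))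
    · exact (EqTm.refl hf).comp (.symm (.fst_beta (.fst (hv1 B)) (.var rfl)))
    · have := (EqTm.refl hg).comp (.symm (.snd_beta (Γ := [B, prod A (mon X B)]) (M :=
        fst A (mon X B) (var 1)) (N := var 0) (.fst (hv1 B)) (.var rfl)))
      rwa [hg.subst_zero] at this

theorem leftUnitor_hom (A : Ty P.G) : (λ_ (Obj.cls A : Obj P)).hom =
    hom (A := prod unit A) (snd unit A (var 0)) (.snd (.var rfl)) := by
  rw [← sndHom_hom]
  exact CartesianMonoidalCategory.leftUnitor_hom _

theorem associator_hom (A B C : Ty P.G) : (α_ (Obj.cls A : Obj P) (Obj.cls B) (Obj.cls C)).hom =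
    hom (A := prod (prod A B) C) (B := prod A (prod B C))
      (pair (fst A B (fst (prod A B) C (var 0)))
        (pair (snd A B (fst (prod A B) C (var 0))) (snd (prod A B) C (var 0))))
      (.pair (.fst (.fst (.var rfl))) (.pair (.snd (.fst (.var rfl))) (.snd (.var rfl)))) := by
  have e : (α_ (Obj.cls A : Obj P) (Obj.cls B) (Obj.cls C)).hom =
      pairHom (fstHom (Obj.prod (Obj.cls A) (Obj.cls B)) (Obj.cls C) ≫ fstHom _ _)
        (pairHom (fstHom (Obj.prod (Obj.cls A) (Obj.cls B)) (Obj.cls C) ≫ sndHom _ _)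
          (sndHom _ _)) := by
    rw [← lift_def, ← lift_def]
    apply CartesianMonoidalCategory.hom_ext
    · exact (CartesianMonoidalCategory.associator_hom_fst _ _ _).trans
        (CartesianMonoidalCategory.lift_fst _ _).symm
    · refine Eq.trans ?_ (CartesianMonoidalCategory.lift_snd _ _).symm
      apply CartesianMonoidalCategory.hom_ext
      · exact (Category.assoc _ _ _).trans <|
          (CartesianMonoidalCategory.associator_hom_snd_fst _ _ _).trans
          (CartesianMonoidalCategory.lift_fst _ _).symm
      · exact (Category.assoc _ _ _).trans <|
          (CartesianMonoidalCategory.associator_hom_snd_snd _ _ _).trans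
          (CartesianMonoidalCategory.lift_snd _ _).symm
  have e₁ := fstHom_hom (P := P) (prod A B) C
  have e₂ := sndHom_hom (P := P) (prod A B) C
  have hv : P.HasType [prod (prod A B) C] (var 0) (prod (prod A B) C) := .var rfl
  rw [e, fstHom_hom A B, sndHom_hom A B]
  exact congrArg₂ pairHom ((congrArg (· ≫ _) e₁).trans (comp_hom (.fst hv) (.fst (.var rfl))))
    (congrArg₂ pairHom ((congrArg (· ≫ _) e₁).trans (comp_hom (.fst hv) (.snd (.var rfl)))) e₂)

theorem monStr_unit (X : Eff) (Y : Obj P) :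
    monStr X (𝟙_ (Obj P)) Y ≫ monMap X (λ_ Y).hom = (λ_ (Obj.mon X Y)).hom := by
  induction Y using Obj.ind with | _ A
  have hv : P.HasType [prod unit (mon X A)] (var 0) (prod unit (mon X A)) := .var rfl
  have hv1 : P.HasType [A, prod unit (mon X A)] (var 1) (prod unit (mon X A)) := .var rfl
  refine (congrArg₂ (· ≫ ·) (monStr_hom X unit A) (congrArg _ (leftUnitor_hom A))).trans
    ((bindRet_map X (.snd hv) (.pair (.fst hv1) (.var rfl)) (.snd (.var rfl))).trans
      (.trans ?_ (leftUnitor_hom (mon X A)).symm))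
  refine hom_eq (.trans (.bind_eq X (.refl _) (.refl _) (.refl (.snd hv))
    (.ret_eq X (.snd_beta (.fst hv1) (.var rfl)))) ?_)
  exact .bind_eta X (.snd hv)

theorem monStr_η (X : Eff) (Y Z : Obj P) :
    Y ◁ monUnit X Z ≫ monStr X Y Z = monUnit X (Obj.prod Y Z) := by
  induction Y using Obj.ind with | _ A
  induction Z using Obj.ind with | _ B
  have hv : P.HasType [prod A B] (var 0) (prod A B) := .var rfl
  have hv1 : P.HasType [B, prod A B] (var 1) (prod A B) := .var rfl
  rw [monUnit_hom]
  refine (congrArg (· ≫ _) (whiskerLeft_hom A (.ret X (.var rfl)))).trans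
    ((pair_str X (.fst hv) (.ret X (.snd hv))).trans
      (.trans ?_ (monUnit_hom X (prod A B)).symm))
  refine hom_eq (.trans (.bind_beta X (.snd hv) (.ret X (.pair (.fst hv1) (.var rfl)))) ?_)
  exact .ret_eq X (.pair_eta hv)

theorem monStr_μ (X : Eff) (Y Z : Obj P) :
    Y ◁ monMult X Z ≫ monStr X Y Z =
      monStr X Y (Obj.mon X Z) ≫ monMap X (monStr X Y Z) ≫ monMult X (Obj.prod Y Z) := by
  induction Y using Obj.ind with | _ A
  induction Z using Obj.ind with | _ B
  have hv : P.HasType [prod A (mon X (mon X B))] (var 0) (prod A (mon X (mon X B))) := .var rfl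
  have hv1 : ∀ C, P.HasType [C, prod A (mon X (mon X B))] (var 1) (prod A (mon X (mon X B))) :=
    fun _ => .var rfl
  have hv2 : P.HasType [B, mon X B, prod A (mon X (mon X B))] (var 2)
    (prod A (mon X (mon X B))) := .var rfl
  have hq : P.HasType [mon X B, prod A (mon X (mon X B))]
    (pair (fst A (mon X (mon X B)) (var 1)) (var 0)) (prod A (mon X B)) :=
    .pair (.fst (hv1 _)) (.var rfl)
  have hs := (hasType_str (P := P) X A B).subst' hq
  refine (congrArg (· ≫ _) ((congrArg _ (monMult_hom X B)).trans
    (whiskerLeft_hom A (hasType_mult X B)))).trans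
    ((pair_str X (.fst hv) (.bind (.snd hv) (.var rfl))).trans (.trans ?_
      ((Category.assoc _ _ _).symm.trans ((congrArg (· ≫ _) ((congrArg₂ (· ≫ ·)
        (monStr_hom X A (mon X B)) (congrArg _ (monStr_hom X A B))).trans
          (bindRet_map X (.snd hv) hq (hasType_str X A B)))).trans
            (bindRet_mult (B := prod A B) X (.snd hv) hs))).symm))
  refine hom_eq (.trans (.bind_assoc X (.snd hv) (.var rfl)
    (.ret X (.pair (.fst (hv1 _)) (.var rfl)))) ?_)
  refine .bind_eq X (.refl _) (.refl _) (.refl (.snd hv)) (.symm ?_)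
  refine .bind_eq X (.refl _) (.refl _) (.snd_beta (.fst (hv1 _)) (.var rfl))
    (.ret_eq X (.pair_eq (.fst_beta (.fst hv2) (.var rfl)) (.refl (.var rfl))))

theorem monStr_assoc (X : Eff) (Y Z W : Obj P) :
    monStr X (Y ⊗ Z) W ≫ monMap X (α_ Y Z W).hom =
      (α_ Y Z (Obj.mon X W)).hom ≫ Y ◁ monStr X Z W ≫ monStr X Y (Z ⊗ W) := by
  induction Y using Obj.ind with | _ A
  induction Z using Obj.ind with | _ B
  induction W using Obj.ind with | _ C
  have hv : P.HasType [prod (prod A B) (mon X C)] (var 0) (prod (prod A B) (mon X C)) := .var rfl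
  have hv1 : ∀ D, P.HasType [D, prod (prod A B) (mon X C)] (var 1) (prod (prod A B) (mon X C)) :=
    fun _ => .var rfl
  have hq : P.HasType [C, prod (prod A B) (mon X C)]
    (pair (fst (prod A B) (mon X C) (var 1)) (var 0)) (prod (prod A B) C) :=
    .pair (.fst (hv1 _)) (.var rfl)
  have hα : P.HasType [prod (prod A B) C] (pair (fst A B (fst (prod A B) C (var 0)))
      (pair (snd A B (fst (prod A B) C (var 0))) (snd (prod A B) C (var 0))))
      (prod A (prod B C)) :=
    .pair (.fst (.fst (.var rfl))) (.pair (.snd (.fst (.var rfl))) (.snd (.var rfl)))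
  have h₁ : P.HasType [prod (prod A B) (mon X C)] (fst A B (fst (prod A B) (mon X C) (var 0))) A :=
    .fst (.fst hv)
  have h₂ : ∀ D, P.HasType [D, prod (prod A B) (mon X C)]
      (snd A B (fst (prod A B) (mon X C) (var 1))) B := fun D => .snd (.fst (hv1 D))
  have h₂' : P.HasType [prod (prod A B) (mon X C)]
      (snd A B (fst (prod A B) (mon X C) (var 0))) B := .snd (.fst hv)
  have h₃ : P.HasType [prod (prod A B) (mon X C)] (snd (prod A B) (mon X C) (var 0)) (mon X C) :=
    .snd hv
  have hb : P.HasType [prod (prod A B) (mon X C)] (bind X C (prod B C)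
      (snd (prod A B) (mon X C) (var 0))
      (ret X (pair (snd A B (fst (prod A B) (mon X C) (var 1))) (var 0)))) (mon X (prod B C)) :=
    hasType_bindPair X h₃ (h₂ _)
  have e : (α_ (Obj.cls A : Obj P) (Obj.cls B) (Obj.mon X (Obj.cls C))).hom ≫
      Obj.cls A ◁ monStr X (Obj.cls B) (Obj.cls C) =
      hom (A := prod (prod A B) (mon X C)) (B := prod A (mon X (prod B C))) _ (.pair h₁ hb) := by
    refine (congrArg₂ (· ≫ ·) (associator_hom A B (mon X C)) ((congrArg _ (monStr_hom X B C)).trans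
      (whiskerLeft_hom A (hasType_str X B C)))).trans ((comp_hom
        (.pair h₁ (.pair h₂' h₃)) (.pair (.fst (.var rfl))
          ((hasType_str X B C).subst' (.snd (.var rfl))))).trans (hom_eq ?_))
    refine .pair_eq (.fst_beta h₁ (.pair h₂' h₃)) ?_
    have e0 : P.EqTm [prod (prod A B) (mon X C)] _ _ _ := .snd_beta h₁ (.pair h₂' h₃)
    have e1 : P.EqTm [C, prod (prod A B) (mon X C)] _ _ _ :=
      .snd_beta (h₁.wk C) ((Sig.HasType.pair h₂' h₃).wk C)
    refine .bind_eq X (.refl _) (.refl _) (.trans (.snd_eq (.refl _) (.refl _) e0)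
      (.snd_beta h₂' h₃)) (.ret_eq X (.pair_eq ?_ (.refl (.var rfl))))
    exact .trans (.fst_eq (.refl _) (.refl _) e1) (.fst_beta (h₂'.wk C) (h₃.wk C))
  refine Eq.trans ?_ (((congrArg (· ≫ _) e).trans (pair_str (B := prod B C) X h₁ hb)).symm.trans
    (Category.assoc _ _ _))
  refine (congrArg₂ (· ≫ ·) (monStr_hom X (prod A B) C)
    (congrArg (monMap X) (associator_hom A B C))).trans ((bindRet_map X h₃ hq hα).trans ?_)
  refine hom_eq (.trans ?_ (.symm (.bind_ret X h₃ (.pair (h₂ _) (.var rfl))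
    (.ret X (.pair (h₁.wk _) (.var rfl))))))
  have f1 : P.EqTm [C, prod (prod A B) (mon X C)] _ _ _ :=
    .fst_beta (.fst (hv1 C)) (.var (n := 0) rfl)
  exact .bind_eq X (.refl _) (.refl _) (.refl h₃) (.ret_eq X
    (.pair_eq (.fst_eq (.refl _) (.refl _) f1) (.pair_eq (.snd_eq (.refl _) (.refl _) f1)
      (.snd_beta (.fst (hv1 C)) (.var rfl)))))

/-- The strong monad `𝒳` on the syntactic category. -/
def synMonad (P : Theory.{g, k}) (X : Eff) : StrongMonad (Obj P) where
  obj := Obj.mon X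
  map := monMap X
  map_id := monMap_id X
  map_comp := monMap_comp X
  η := { app := monUnit X, naturality := fun _ _ f => monUnit_natural X f }
  μ := { app := monMult X, naturality := fun _ _ f => monMult_natural X f }
  assoc := monMult_assoc X
  left_unit := monUnit_mult X
  right_unit := monMap_unit_mult X
  str := monStr X
  str_natural := monStr_natural X
  str_unit := monStr_unit X
  str_assoc := monStr_assoc X
  str_η := monStr_η X
  str_μ := monStr_μ X

/-! ### The central submonad of the syntactic category -/

/-- The inclusion `[x : 𝒮 A ⊢ ι x : 𝒯 A]`. -/
def iotaHom (Y : Obj P) : Obj.mon S Y ⟶ Obj.mon T Y :=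
  homOf (mon S Y.rep) (mon T Y.rep) (congrArg (Obj.mon S) Y.cls_rep)
    (congrArg (Obj.mon T) Y.cls_rep) (iota Y.rep (var 0)) (.iota (.var rfl))

theorem iotaHom_hom (A : Ty P.G) : iotaHom (Obj.cls A : Obj P) =
    hom (A := mon S A) (B := mon T A) (iota A (var 0)) (.iota (.var rfl)) :=
  homOf_eq (.iota_eq (rep_eq A) (.refl (.var rfl)))

theorem comp_map (X : Eff) {A B D : Ty P.G} {M L} (hM : P.HasType [D] M (mon X A))
    (hL : P.HasType [A] L B) :
    hom (B := mon X A) M hM ≫ monMap X (hom L hL) =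
      hom (B := mon X B) (bind X A B M (ret X L)) (hasType_bindRet X hM (hL.weaken _)) := by
  refine (comp_hom _ (hasType_map X hL)).trans (hom_eq ?_)
  simp only [Tm.subst]
  rw [hL.subst_id (up _) rfl]
  exact .refl (hasType_bindRet X hM (hL.weaken _))

/-- `ι (do x ← M; ret N)` equals `do x ← ι M; ret N`. -/
theorem EqTm.iota_bindRet {Γ M N A B} (hM : P.HasType Γ M (mon S A))
    (hN : P.HasType (A :: Γ) N B) :
    P.EqTm Γ (iota B (bind S A B M (ret S N))) (bind T A B (iota A M) (ret T N)) (mon T B) :=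
  .trans (.symm (.iota_bind hM (.ret S hN)))
    (.bind_eq T (.refl _) (.refl _) (.refl (.iota hM)) (.iota_ret hN))

theorem iotaHom_natural {Y Z : Obj P} (f : Y ⟶ Z) :
    monMap S f ≫ iotaHom Z = iotaHom Y ≫ monMap T f := by
  induction Y using Obj.ind with | _ A
  induction Z using Obj.ind with | _ B
  obtain ⟨f, hf, rfl⟩ := exists_hom f
  rw [iotaHom_hom, iotaHom_hom]
  refine (comp_hom (hasType_map S hf) (.iota (.var rfl))).trans (.trans ?_
    (comp_map T (.iota (.var rfl)) hf).symm)
  exact hom_eq (.iota_bindRet (.var rfl) (hf.weaken _))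

theorem iotaHom_η (Y : Obj P) : monUnit S Y ≫ iotaHom Y = monUnit T Y := by
  induction Y using Obj.ind with | _ A
  rw [iotaHom_hom, monUnit_hom, monUnit_hom]
  refine (comp_hom (B := mon S A) (C := mon T A) (.ret S (.var rfl)) (.iota (.var rfl))).trans ?_
  exact hom_eq (.iota_ret (.var rfl))

theorem iotaHom_μ (Y : Obj P) : monMult S Y ≫ iotaHom Y =
    (monMap S (iotaHom Y) ≫ iotaHom (Obj.mon T Y)) ≫ monMult T Y := by
  rw [iotaHom_natural]
  induction Y using Obj.ind with | _ A
  have hv : P.HasType [mon S (mon S A)] (var 0) (mon S (mon S A)) := .var rfl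
  have hi : P.HasType [mon S A] (iota A (var 0)) (mon T A) := .iota (.var rfl)
  rw [iotaHom_hom]
  refine ((congrArg (· ≫ _) (monMult_hom S A)).trans (comp_hom (hasType_mult S A) hi)).trans
    (.trans ?_ ((congrArg (· ≫ _) ((congrArg (· ≫ _) (iotaHom_hom (mon S A))).trans
      (comp_map T (.iota hv) hi))).trans (bindRet_mult T (.iota hv) (hi.weaken _))).symm)
  exact hom_eq (.symm (.iota_bind hv (.var rfl)))

theorem iotaHom_str (Y Z : Obj P) : monStr S Y Z ≫ iotaHom (Obj.prod Y Z) =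
    Y ◁ iotaHom Z ≫ monStr T Y Z := by
  induction Y using Obj.ind with | _ A
  induction Z using Obj.ind with | _ B
  have hv : P.HasType [prod A (mon S B)] (var 0) (prod A (mon S B)) := .var rfl
  have hv1 : P.HasType [B, prod A (mon S B)] (var 1) (prod A (mon S B)) := .var rfl
  have hi : P.HasType [mon S B] (iota B (var 0)) (mon T B) := .iota (.var rfl)
  refine ((congrArg₂ (· ≫ ·) (monStr_hom S A B) (iotaHom_hom (prod A B))).trans
    (comp_hom (hasType_str S A B) (.iota (.var rfl)))).trans (.trans ?_
      ((congrArg (· ≫ _) ((congrArg _ (iotaHom_hom B)).trans (whiskerLeft_hom A hi))).trans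
        (pair_str T (.fst hv) (.iota (.snd hv)))).symm)
  exact hom_eq (.iota_bindRet (.snd hv) (.pair (.fst hv1) (.var rfl)))

theorem iotaHom_mono (Y : Obj P) : Mono (iotaHom Y) where
  right_cancellation {Z} f f' h := by
    induction Y using Obj.ind with | _ A
    induction Z using Obj.ind with | _ B
    obtain ⟨f, hf, rfl⟩ := exists_hom (B := mon S A) f
    obtain ⟨f', hf', rfl⟩ := exists_hom (B := mon S A) f'
    rw [iotaHom_hom] at h
    have hi : P.HasType [mon S A] (iota A (var 0)) (mon T A) := .iota (.var rfl)
    exact hom_eq (.iota_mono hf hf' (hom_exact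
      (((comp_hom hf hi).symm.trans h).trans (comp_hom hf' hi))))

theorem swap_hom (A B : Ty P.G) : StrongMonad.swap (Obj.cls A : Obj P) (Obj.cls B) =
    hom (A := prod A B) (B := prod B A) (pair (snd A B (var 0)) (fst A B (var 0)))
      (.pair (.snd (.var rfl)) (.fst (.var rfl))) :=
  (lift_def _ _).trans (congrArg₂ pairHom (sndHom_hom A B) (fstHom_hom A B))

theorem hasType_rstr (X : Eff) (A B : Ty P.G) : P.HasType [prod (mon X A) B]
    (bind X A (prod A B) (fst (mon X A) B (var 0)) (ret X (pair (var 0) (snd (mon X A) B (var 1)))))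
    (mon X (prod A B)) :=
  .bind (.fst (.var rfl)) (.ret X (.pair (.var rfl) (.snd (.var rfl))))

theorem rstr_hom (X : Eff) (A B : Ty P.G) :
    (synMonad P X).rstr (Obj.cls A) (Obj.cls B) =
      hom (A := prod (mon X A) B) (B := mon X (prod A B)) (bind X A (prod A B)
        (fst (mon X A) B (var 0)) (ret X (pair (var 0) (snd (mon X A) B (var 1)))))
        (hasType_rstr X A B) := by
  have hv : P.HasType [prod (mon X A) B] (var 0) (prod (mon X A) B) := .var rfl
  have hv1 : P.HasType [A, prod (mon X A) B] (var 1) (prod (mon X A) B) := .var rfl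
  have hq : P.HasType [A, prod (mon X A) B] (pair (snd (mon X A) B (var 1)) (var 0)) (prod B A) :=
    .pair (.snd hv1) (.var rfl)
  have hs : P.HasType [prod B A] (pair (snd B A (var 0)) (fst B A (var 0))) (prod A B) :=
    .pair (.snd (.var rfl)) (.fst (.var rfl))
  refine (Category.assoc _ _ _).symm.trans ((congrArg₂ (· ≫ ·)
    ((congrArg (· ≫ _) (swap_hom (mon X A) B)).trans (pair_str X (.snd hv) (.fst hv)))
    (congrArg (monMap X) (swap_hom B A))).trans ((bindRet_map X (.fst hv) hq hs).trans ?_))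
  exact hom_eq (.bind_eq X (.refl _) (.refl _) (.refl (.fst hv)) (.ret_eq X (.pair_eq
    (.snd_beta (.snd hv1) (.var rfl)) (.fst_beta (.snd hv1) (.var rfl)))))

theorem pair_rstr (X : Eff) {A B D : Ty P.G} {M N} (hM : P.HasType [D] M (mon X A))
    (hN : P.HasType [D] N B) :
    hom (B := prod (mon X A) B) (pair M N) (.pair hM hN) ≫
      (synMonad P X).rstr (Obj.cls A) (Obj.cls B) =
      hom (B := mon X (prod A B)) (bind X A (prod A B) M (ret X (pair (var 0) N.wk)))
        (hasType_bindRet X hM (.pair (.var rfl) (hN.wk A))) := by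
  refine (congrArg _ (rstr_hom X A B)).trans ((comp_hom _ (hasType_rstr X A B)).trans ?_)
  exact hom_eq (.bind_eq X (.refl _) (.refl _) (.fst_beta hM hN)
    (.ret_eq X (.pair_eq (.refl (.var rfl)) (.snd_beta (hM.wk A) (hN.wk A)))))

theorem comp_assoc4 {C : Type u} [Category.{v} C] {V W X Y Z : C} (f : V ⟶ W) (g : W ⟶ X)
    (h : X ⟶ Y) (k : Y ⟶ Z) : f ≫ g ≫ h ≫ k = ((f ≫ g) ≫ h) ≫ k := by
  simp only [Category.assoc]

theorem iotaHom_central (Y : Obj P) : (synMonad P T).IsCentralCone (X := Y) (iotaHom Y) := by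
  intro Z
  induction Y using Obj.ind with | _ A
  induction Z using Obj.ind with | _ B
  have hv : P.HasType [prod (mon S A) (mon T B)] (var 0) (prod (mon S A) (mon T B)) := .var rfl
  have hi : P.HasType [mon S A] (iota A (var 0)) (mon T A) := .iota (.var rfl)
  have hM : P.HasType [prod (mon S A) (mon T B)] (fst (mon S A) (mon T B) (var 0)) (mon S A) :=
    .fst hv
  have hN : P.HasType [prod (mon S A) (mon T B)] (snd (mon S A) (mon T B) (var 0)) (mon T B) :=
    .snd hv
  have hp : P.HasType [prod (mon S A) (mon T B)] _ (prod (mon T A) (mon T B)) := .pair (.iota hM) hN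
  have e : iotaHom (Obj.cls A : Obj P) ▷ Obj.mon T (Obj.cls B) =
      hom (A := prod (mon S A) (mon T B)) (B := prod (mon T A) (mon T B)) _ hp :=
    (congrArg (· ▷ _) (iotaHom_hom A)).trans (whiskerRight_hom (mon T B) hi)
  have l₁ := (congrArg (· ≫ monStr T (Obj.mon T (Obj.cls A)) (Obj.cls B)) e).trans
    (pair_str (A := mon T A) T (.iota hM) hN)
  have hq₁ : P.HasType [B, prod (mon S A) (mon T B)]
    (pair (iota A (fst (mon S A) (mon T B) (var 0))).wk (var 0)) (prod (mon T A) B) :=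
    .pair (hM.iota.wk B) (.var rfl)
  have l₂ := (congrArg₂ (· ≫ ·) l₁ (congrArg (monMap T) (rstr_hom T A B))).trans
    (bindRet_map T hN hq₁ (hasType_rstr T A B))
  have l₃ := (congrArg (· ≫ monMult T (Obj.prod (Obj.cls A) (Obj.cls B))) l₂).trans
    (bindRet_mult (B := prod A B) T hN ((hasType_rstr T A B).subst' hq₁))
  have r₁ := (congrArg (· ≫ (synMonad P T).rstr (Obj.cls A) (Obj.mon T (Obj.cls B))) e).trans
    (pair_rstr (B := mon T B) T (.iota hM) hN)
  have hq₂ : P.HasType [A, prod (mon S A) (mon T B)]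
    (pair (var 0) (snd (mon S A) (mon T B) (var 0)).wk) (prod A (mon T B)) :=
    .pair (.var rfl) (hN.wk A)
  have r₂ := (congrArg₂ (· ≫ ·) r₁ (congrArg (monMap T) (monStr_hom T A B))).trans
    (bindRet_map T hM.iota hq₂ (hasType_str T A B))
  have r₃ := (congrArg (· ≫ monMult T (Obj.prod (Obj.cls A) (Obj.cls B))) r₂).trans
    (bindRet_mult (B := prod A B) T hM.iota ((hasType_str T A B).subst' hq₂))
  have hL : P.HasType [B, A, prod (mon S A) (mon T B)] (ret T (pair (var 1) (var 0)))
    (mon T (prod A B)) := .ret T (.pair (.var rfl) (.var rfl))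
  have key : P.EqTm [prod (mon S A) (mon T B)] _ _ _ := .central hM hN hL
  refine (comp_assoc4 _ _ _ _).trans (l₃.trans (.trans ?_
    (r₃.symm.trans (comp_assoc4 _ _ _ _).symm)))
  refine hom_eq (.trans ?_ (.trans key.symm ?_))
  · exact .bind_eq T (.refl _) (.refl _) (.refl hN) (.bind_eq T (.refl _) (.refl _)
      (.fst_beta (hM.iota.wk B) (.var rfl)) (.ret_eq T (.pair_eq (.refl (.var rfl))
        (.snd_beta ((hM.iota.wk B).wk A) (.var rfl)))))
  · exact .bind_eq T (.refl _) (.refl _) (.refl hM.iota) (.bind_eq T (.refl _) (.refl _)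
      (.symm (.snd_beta (.var rfl) (hN.wk A))) (.ret_eq T (.pair_eq
        (.symm (.fst_beta (.var rfl) ((hN.wk A).wk B))) (.refl (.var rfl)))))

/-- The syntactic model `S(P)` of a theory `P`. -/
def syntacticModel (P : Theory.{g, k}) : Model.{g, max g k} where
  C := Obj P
  T := synMonad P T
  S := synMonad P S
  ι :=
    { app := iotaHom
      naturality := fun _ _ f => iotaHom_natural f
      app_η := iotaHom_η
      app_μ := iotaHom_μ
      app_str := iotaHom_str }
  mono_ι := iotaHom_mono
  central := iotaHom_central

end Theory

/-! ## The internal language of a model -/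

namespace Model

variable (M : Model.{u, v})

/-- The interpretation of types whose ground types are the objects of the model. -/
def semTy : Ty M.C → M.C
  | .unit => 𝟙_ M.C
  | .ground X => X
  | .arr A B => (ihom (semTy A)).obj (semTy B)
  | .prod A B => semTy A ⊗ semTy B
  | .mon X A => (M.mon X).obj (semTy A)

/-- The interpretation of contexts. -/
def semCtx : List (Ty M.C) → M.C
  | [] => 𝟙_ M.C
  | A :: Γ => semCtx Γ ⊗ M.semTy A

/-- Ground types, constants and type equalities of the internal language: a ground type for each
object, a constant `c_f : X → Y` for each morphism `f : X ⟶ Y` (for ground types `X`, `Y`), and an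
equality `A = B` whenever the interpretations of `A` and `B` are equal. -/
def langSig : Sig.{u, max u v} where
  G := M.C
  K := Σ X Y : M.C, (X ⟶ Y)
  tyOf c := .arr (.ground c.1) (.ground c.2.1)
  tyAx A B := M.semTy A = M.semTy B

/-- A morphism out of `X` together with its codomain, if any, seen as a morphism to `Y`; undefined
if the codomain is not `Y`. -/
def toCod {X : M.C} (p : Option (Σ Y : M.C, X ⟶ Y)) (Y : M.C) : Option (X ⟶ Y) :=
  open scoped Classical in
  p.bind fun q => if h : q.1 = Y then some (q.2 ≫ eqToHom h) else none

/-- The interpretation of variables: projections. -/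
def semVar : (Γ : List (Ty M.C)) → ℕ → Option (Σ Y : M.C, M.semCtx Γ ⟶ Y)
  | [], _ => none
  | A :: Γ, 0 => some ⟨M.semTy A, CartesianMonoidalCategory.snd (M.semCtx Γ) (M.semTy A)⟩
  | A :: Γ, n + 1 => (semVar Γ n).map fun p =>
      ⟨p.1, CartesianMonoidalCategory.fst (M.semCtx Γ) (M.semTy A) ≫ p.2⟩

/-- The interpretation of terms in context, together with its codomain; it is defined on all
well-formed terms (`Model.semTm_of_hasType`), where the codomain is the interpretation of the
type. -/
def semTm : (Γ : List (Ty M.C)) → Tm M.C (Σ X Y : M.C, (X ⟶ Y)) →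
    Option (Σ Y : M.C, M.semCtx Γ ⟶ Y)
  | Γ, .var n => M.semVar Γ n
  | Γ, .const ⟨X, Y, f⟩ => some ⟨(ihom X).obj Y,
      CartesianMonoidalCategory.toUnit (M.semCtx Γ) ≫ MonoidalClosed.curry ((ρ_ X).hom ≫ f)⟩
  | Γ, .star => some ⟨𝟙_ M.C, CartesianMonoidalCategory.toUnit (M.semCtx Γ)⟩
  | Γ, .lam A L =>
      (semTm (A :: Γ) L).map fun p => ⟨(ihom (M.semTy A)).obj p.1,
        MonoidalClosed.curry (StrongMonad.swap (M.semTy A) (M.semCtx Γ) ≫ p.2)⟩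
  | Γ, .app A B L N =>
      Option.map₂ (fun l n => ⟨M.semTy B,
          CartesianMonoidalCategory.lift n l ≫ (ihom.ev (M.semTy A)).app (M.semTy B)⟩)
        (M.toCod (semTm Γ L) ((ihom (M.semTy A)).obj (M.semTy B)))
        (M.toCod (semTm Γ N) (M.semTy A))
  | Γ, .pair L N =>
      Option.map₂ (fun p q => ⟨p.1 ⊗ q.1, CartesianMonoidalCategory.lift p.2 q.2⟩)
        (semTm Γ L) (semTm Γ N)
  | Γ, .fst A B L =>
      (M.toCod (semTm Γ L) (M.semTy A ⊗ M.semTy B)).map fun l =>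
        ⟨M.semTy A, l ≫ CartesianMonoidalCategory.fst (M.semTy A) (M.semTy B)⟩
  | Γ, .snd A B L =>
      (M.toCod (semTm Γ L) (M.semTy A ⊗ M.semTy B)).map fun l =>
        ⟨M.semTy B, l ≫ CartesianMonoidalCategory.snd (M.semTy A) (M.semTy B)⟩
  | Γ, .ret X L =>
      (semTm Γ L).map fun p => ⟨(M.mon X).obj p.1, p.2 ≫ (M.mon X).η.app p.1⟩
  | Γ, .iota A L =>
      (M.toCod (semTm Γ L) (M.S.obj (M.semTy A))).map fun l =>
        ⟨M.T.obj (M.semTy A), l ≫ M.ι.app (M.semTy A)⟩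
  | Γ, .bind X A B L N =>
      Option.map₂ (fun l n => ⟨(M.mon X).obj (M.semTy B),
          CartesianMonoidalCategory.lift (𝟙 (M.semCtx Γ)) l ≫
            (M.mon X).str (M.semCtx Γ) (M.semTy A) ≫ (M.mon X).map n ≫
              (M.mon X).μ.app (M.semTy B)⟩)
        (M.toCod (semTm Γ L) ((M.mon X).obj (M.semTy A)))
        (M.toCod (semTm (A :: Γ) N) ((M.mon X).obj (M.semTy B)))

variable {M}

theorem semTy_eq {A B : Ty M.langSig.G} (h : M.langSig.TyEq A B) : M.semTy A = M.semTy B := by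
  induction h with
  | ax h => exact h
  | refl => rfl
  | symm _ ih => exact ih.symm
  | trans _ _ ih₁ ih₂ => exact ih₁.trans ih₂
  | prod _ _ ih₁ ih₂ => simp only [semTy, ih₁, ih₂]
  | arr _ _ ih₁ ih₂ => exact congrArg₂ (fun X Y => (ihom X).obj Y) ih₁ ih₂
  | mon X _ ih => simp only [semTy, ih]

theorem toCod_eq {X Y : M.C} {p : Option (Σ Y : M.C, X ⟶ Y)} {f : X ⟶ Y} (h : p = some ⟨Y, f⟩) :
    M.toCod p Y = some f := by
  simp [h, toCod]

theorem semVar_of_mem : ∀ {Γ : List (Ty M.C)} {n A}, Γ[n]? = some A →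
    ∃ f, M.semVar Γ n = some ⟨M.semTy A, f⟩
  | [], n, A, h => by simp at h
  | B :: Γ, 0, A, h => by
    obtain rfl : B = A := by simpa using h
    exact ⟨_, rfl⟩
  | B :: Γ, n + 1, A, h => by
    obtain ⟨f, hf⟩ := semVar_of_mem (Γ := Γ) (n := n) (A := A) (by simpa using h)
    exact ⟨CartesianMonoidalCategory.fst _ _ ≫ f, by simp [semVar, hf]⟩

/-- Well-formed terms have an interpretation. -/
theorem semTm_of_hasType {Γ : List (Ty M.langSig.G)} {L A} (h : M.langSig.HasType Γ L A) :
    ∃ f, M.semTm Γ L = some ⟨M.semTy A, f⟩ := by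
  induction h with
  | var h => exact semVar_of_mem h
  | const c => exact ⟨_, rfl⟩
  | star => exact ⟨_, rfl⟩
  | lam _ ih =>
    obtain ⟨f, hf⟩ := ih
    exact ⟨_, congrArg (Option.map _) hf⟩
  | app _ _ ih₁ ih₂ =>
    obtain ⟨f, hf⟩ := ih₁
    obtain ⟨f', hf'⟩ := ih₂
    exact ⟨_, congrArg₂ (Option.map₂ _) (toCod_eq hf) (toCod_eq hf')⟩
  | pair _ _ ih₁ ih₂ =>
    obtain ⟨f, hf⟩ := ih₁
    obtain ⟨f', hf'⟩ := ih₂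
    exact ⟨_, congrArg₂ (Option.map₂ _) hf hf'⟩
  | fst _ ih =>
    obtain ⟨f, hf⟩ := ih
    exact ⟨_, congrArg (Option.map _) (toCod_eq hf)⟩
  | snd _ ih =>
    obtain ⟨f, hf⟩ := ih
    exact ⟨_, congrArg (Option.map _) (toCod_eq hf)⟩
  | ret X _ ih =>
    obtain ⟨f, hf⟩ := ih
    exact ⟨_, congrArg (Option.map _) hf⟩
  | iota _ ih =>
    obtain ⟨f, hf⟩ := ih
    exact ⟨_, congrArg (Option.map _) (toCod_eq hf)⟩
  | bind _ _ ih₁ ih₂ =>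
    obtain ⟨f, hf⟩ := ih₁
    obtain ⟨f', hf'⟩ := ih₂
    exact ⟨_, congrArg₂ (Option.map₂ _) (toCod_eq hf) (toCod_eq hf')⟩
  | conv e _ ih =>
    rw [← semTy_eq e]
    exact ih

theorem isSome_toCod {Γ L A} (h : M.langSig.HasType Γ L A) :
    (M.toCod (M.semTm Γ L) (M.semTy A)).isSome := by
  obtain ⟨f, hf⟩ := semTm_of_hasType h
  rw [toCod_eq hf]
  rfl

/-- The interpretation `⟦Γ⟧ ⟶ ⟦A⟧` of a well-formed term `Γ ⊢ L : A`. -/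
def sem {Γ L A} (h : M.langSig.HasType Γ L A) : M.semCtx Γ ⟶ M.semTy A :=
  (M.toCod (M.semTm Γ L) (M.semTy A)).get (isSome_toCod h)

theorem semTm_eq {Γ L A} (h : M.langSig.HasType Γ L A) :
    M.semTm Γ L = some ⟨M.semTy A, sem h⟩ := by
  obtain ⟨f, hf⟩ := semTm_of_hasType h
  have e : sem h = f := Option.get_of_eq_some _ (toCod_eq hf)
  rw [e, hf]

variable (M)

/-- The internal language `L(M)` of a model `M`: term equalities are those that hold in `M`. -/
def internalLanguage : Theory.{u, max u v} where
  toSig := M.langSig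
  tmAx Γ L N A := ∃ (hL : M.langSig.HasType Γ L A) (hN : M.langSig.HasType Γ N A), sem hL = sem hN
  tmAx_typed := fun ⟨hL, hN, _⟩ => ⟨hL, hN⟩

end Model

/-! ## Morphisms and equivalences of models -/

/-- A morphism of `CSC`-models: a functor that strictly preserves the chosen finite products and
exponentials (with projections and evaluation), both monads (with functor, unit, multiplication and
strength) and the inclusion. As `F` preserves objects on the nose, morphisms are compared along the
identities `eqToHom` between equal objects. -/
structure ModelHom (M : Model.{u, v}) (N : Model.{u', v'}) where
  /-- the underlying functor -/
  F : M.C ⥤ N.C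
  obj_unit : F.obj (𝟙_ M.C) = 𝟙_ N.C
  obj_prod : ∀ X Y : M.C, F.obj (X ⊗ Y) = F.obj X ⊗ F.obj Y
  map_fst : ∀ X Y : M.C, F.map (CartesianMonoidalCategory.fst X Y) =
    eqToHom (obj_prod X Y) ≫ CartesianMonoidalCategory.fst (F.obj X) (F.obj Y)
  map_snd : ∀ X Y : M.C, F.map (CartesianMonoidalCategory.snd X Y) =
    eqToHom (obj_prod X Y) ≫ CartesianMonoidalCategory.snd (F.obj X) (F.obj Y)
  obj_exp : ∀ X Y : M.C, F.obj ((ihom X).obj Y) = (ihom (F.obj X)).obj (F.obj Y)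
  map_ev : ∀ X Y : M.C, F.map ((ihom.ev X).app Y) =
    eqToHom ((obj_prod X ((ihom X).obj Y)).trans (congrArg (F.obj X ⊗ ·) (obj_exp X Y))) ≫
      (ihom.ev (F.obj X)).app (F.obj Y)
  obj_mon : ∀ (e : Eff) (X : M.C), F.obj ((M.mon e).obj X) = (N.mon e).obj (F.obj X)
  map_map : ∀ (e : Eff) {X Y : M.C} (f : X ⟶ Y), F.map ((M.mon e).map f) =
    eqToHom (obj_mon e X) ≫ (N.mon e).map (F.map f) ≫ eqToHom (obj_mon e Y).symm
  map_η : ∀ (e : Eff) (X : M.C), F.map ((M.mon e).η.app X) =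
    (N.mon e).η.app (F.obj X) ≫ eqToHom (obj_mon e X).symm
  map_μ : ∀ (e : Eff) (X : M.C), F.map ((M.mon e).μ.app X) =
    eqToHom ((obj_mon e ((M.mon e).obj X)).trans (congrArg (N.mon e).obj (obj_mon e X))) ≫
      (N.mon e).μ.app (F.obj X) ≫ eqToHom (obj_mon e X).symm
  map_str : ∀ (e : Eff) (X Y : M.C), F.map ((M.mon e).str X Y) =
    eqToHom ((obj_prod X ((M.mon e).obj Y)).trans (congrArg (F.obj X ⊗ ·) (obj_mon e Y))) ≫
      (N.mon e).str (F.obj X) (F.obj Y) ≫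
      eqToHom ((obj_mon e (X ⊗ Y)).trans (congrArg (N.mon e).obj (obj_prod X Y))).symm
  map_ι : ∀ X : M.C, F.map (M.ι.app X) =
    eqToHom (show F.obj (M.S.obj X) = N.S.obj (F.obj X) from obj_mon .S X) ≫ N.ι.app (F.obj X) ≫
      eqToHom (show N.T.obj (F.obj X) = F.obj (M.T.obj X) from (obj_mon .T X).symm)

namespace ModelHom

/-- The identity morphism of a model. -/
def id (M : Model.{u, v}) : ModelHom M M where
  F := 𝟭 M.C
  obj_unit := rfl
  obj_prod _ _ := rfl
  map_fst _ _ := by simp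
  map_snd _ _ := by simp
  obj_exp _ _ := rfl
  map_ev _ _ := by simp
  obj_mon _ _ := rfl
  map_map _ _ _ _ := by simp
  map_η _ _ := by simp
  map_μ _ _ := by simp
  map_str _ _ _ := by simp
  map_ι _ := by simp

/-- The composite `G ∘ F` of morphisms of models. -/
def comp {M : Model.{u, v}} {N : Model.{u', v'}} {L : Model.{u'', v''}} (G : ModelHom N L)
    (F : ModelHom M N) : ModelHom M L where
  F := F.F ⋙ G.F
  obj_unit := (congrArg G.F.obj F.obj_unit).trans G.obj_unit
  obj_prod X Y := (congrArg G.F.obj (F.obj_prod X Y)).trans (G.obj_prod _ _)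
  map_fst X Y := by simp [F.map_fst, G.map_fst, eqToHom_map]
  map_snd X Y := by simp [F.map_snd, G.map_snd, eqToHom_map]
  obj_exp X Y := (congrArg G.F.obj (F.obj_exp X Y)).trans (G.obj_exp _ _)
  map_ev X Y := by simp [F.map_ev, G.map_ev, eqToHom_map]
  obj_mon e X := (congrArg G.F.obj (F.obj_mon e X)).trans (G.obj_mon e _)
  map_map e X Y f := by simp [F.map_map, G.map_map, eqToHom_map]
  map_η e X := by simp [F.map_η, G.map_η, eqToHom_map]
  map_μ e X := by simp [F.map_μ, G.map_μ, eqToHom_map]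
  map_str e X Y := by simp [F.map_str, G.map_str, eqToHom_map]
  map_ι X := by simp [F.map_ι, G.map_ι, eqToHom_map]

end ModelHom

/-- Equivalence of models in the 2-category of models, their morphisms and natural
transformations. -/
def Model.Equivalent (M : Model.{u, v}) (N : Model.{u', v'}) : Prop :=
  ∃ (F : ModelHom M N) (G : ModelHom N M),
    Nonempty ((F.comp G).F ≅ (ModelHom.id N).F) ∧ Nonempty ((ModelHom.id M).F ≅ (G.comp F).F)

/-! ## Translations and equivalences of theories -/

/-- A translation of theories: a function on types and terms that preserves all structure and all
judgements. -/
structure Translation (P : Theory.{g, k}) (Q : Theory.{g', k'}) where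
  /-- the action on types -/
  ty : Ty P.G → Ty Q.G
  /-- the action on terms -/
  tm : Tm P.G P.K → Tm Q.G Q.K
  ty_unit : ty .unit = .unit
  ty_arr : ∀ A B, ty (.arr A B) = .arr (ty A) (ty B)
  ty_prod : ∀ A B, ty (.prod A B) = .prod (ty A) (ty B)
  ty_mon : ∀ X A, ty (.mon X A) = .mon X (ty A)
  tm_var : ∀ n, tm (.var n) = .var n
  tm_star : tm .star = .star
  tm_lam : ∀ A M, tm (.lam A M) = .lam (ty A) (tm M)
  tm_app : ∀ A B M N, tm (.app A B M N) = .app (ty A) (ty B) (tm M) (tm N)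
  tm_pair : ∀ M N, tm (.pair M N) = .pair (tm M) (tm N)
  tm_fst : ∀ A B M, tm (.fst A B M) = .fst (ty A) (ty B) (tm M)
  tm_snd : ∀ A B M, tm (.snd A B M) = .snd (ty A) (ty B) (tm M)
  tm_ret : ∀ X M, tm (.ret X M) = .ret X (tm M)
  tm_iota : ∀ A M, tm (.iota A M) = .iota (ty A) (tm M)
  tm_bind : ∀ X A B M N, tm (.bind X A B M N) = .bind X (ty A) (ty B) (tm M) (tm N)
  tyEq : ∀ {A B}, P.TyEq A B → Q.TyEq (ty A) (ty B)
  hasType : ∀ {Γ M A}, P.HasType Γ M A → Q.HasType (Γ.map ty) (tm M) (ty A)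
  eqTm : ∀ {Γ M N A}, P.EqTm Γ M N A → Q.EqTm (Γ.map ty) (tm M) (tm N) (ty A)

namespace Translation

/-- The identity translation. -/
def id (P : Theory.{g, k}) : Translation P P where
  ty A := A
  tm M := M
  ty_unit := rfl
  ty_arr _ _ := rfl
  ty_prod _ _ := rfl
  ty_mon _ _ := rfl
  tm_var _ := rfl
  tm_star := rfl
  tm_lam _ _ := rfl
  tm_app _ _ _ _ := rfl
  tm_pair _ _ := rfl
  tm_fst _ _ _ := rfl
  tm_snd _ _ _ := rfl
  tm_ret _ _ := rfl
  tm_iota _ _ := rfl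
  tm_bind _ _ _ _ _ := rfl
  tyEq h := h
  hasType h := by simpa using h
  eqTm h := by simpa using h

/-- The composite `W ∘ V` of translations. -/
def comp {P : Theory.{g, k}} {Q : Theory.{g', k'}} {R : Theory.{g'', k''}} (W : Translation Q R)
    (V : Translation P Q) : Translation P R where
  ty A := W.ty (V.ty A)
  tm M := W.tm (V.tm M)
  ty_unit := by simp only [V.ty_unit, W.ty_unit]
  ty_arr _ _ := by simp only [V.ty_arr, W.ty_arr]
  ty_prod _ _ := by simp only [V.ty_prod, W.ty_prod]
  ty_mon _ _ := by simp only [V.ty_mon, W.ty_mon]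
  tm_var _ := by simp only [V.tm_var, W.tm_var]
  tm_star := by simp only [V.tm_star, W.tm_star]
  tm_lam _ _ := by simp only [V.tm_lam, W.tm_lam]
  tm_app _ _ _ _ := by simp only [V.tm_app, W.tm_app]
  tm_pair _ _ := by simp only [V.tm_pair, W.tm_pair]
  tm_fst _ _ _ := by simp only [V.tm_fst, W.tm_fst]
  tm_snd _ _ _ := by simp only [V.tm_snd, W.tm_snd]
  tm_ret _ _ := by simp only [V.tm_ret, W.tm_ret]
  tm_iota _ _ := by simp only [V.tm_iota, W.tm_iota]
  tm_bind _ _ _ _ _ := by simp only [V.tm_bind, W.tm_bind]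
  tyEq h := W.tyEq (V.tyEq h)
  hasType h := by simpa [Function.comp_def] using W.hasType (V.hasType h)
  eqTm h := by simpa [Function.comp_def] using W.eqTm (V.eqTm h)

end Translation

/-- A transformation `V ⇒ W` of translations: terms `x : V(A) ⊢ α_A : W(A)` with
`x : V(A) ⊢ α_B[V(f)/x] = W(f)[α_A/x] : W(B)` for all `x : A ⊢ f : B`. -/
structure Transformation {P : Theory.{g, k}} {Q : Theory.{g', k'}} (V W : Translation P Q) where
  /-- the components -/
  app : Ty P.G → Tm Q.G Q.K
  typed : ∀ A, Q.HasType [V.ty A] (app A) (W.ty A)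
  natural : ∀ {A B f}, P.HasType [A] f B →
    Q.EqTm [V.ty A] ((app B).subst fun _ => V.tm f) ((W.tm f).subst fun _ => app A) (W.ty B)

/-- Isomorphism of translations: transformations in both directions that are mutually inverse, up to
provable equality of terms. -/
def Translation.Isomorphic {P : Theory.{g, k}} {Q : Theory.{g', k'}} (V W : Translation P Q) :
    Prop :=
  ∃ (α : Transformation V W) (β : Transformation W V),
    (∀ A, Q.EqTm [V.ty A] ((β.app A).subst fun _ => α.app A) (.var 0) (V.ty A)) ∧
    (∀ A, Q.EqTm [W.ty A] ((α.app A).subst fun _ => β.app A) (.var 0) (W.ty A))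

/-- Equivalence of theories in the 2-category of theories, translations and transformations. -/
def Theory.Equivalent (P : Theory.{g, k}) (Q : Theory.{g', k'}) : Prop :=
  ∃ (V : Translation P Q) (W : Translation Q P),
    (V.comp W).Isomorphic (Translation.id Q) ∧ (Translation.id P).Isomorphic (W.comp V)

end

end CSC

/-! Both equivalences rest on soundness and completeness of the interpretation of terms.
Completeness is built into the internal language, since every equality valid in the model is an
axiom of `internalLanguage`. Soundness is `Model.denotes_of_eqTm`: provably equal terms have a
common denotation. It follows from a substitution lemma (`Model.Denotes.subst`: substitution is
composition) and from the laws of sequencing in a strong monad, which are proved for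
`StrongMonad.bind`. The commutation rule for `ι M` comes from centrality of `ι`
(`StrongMonad.bind_comm`), and cancellation of `ι` from its components being monic.

For a model `M`, interpretation gives a functor `Model.interp` from the syntactic category of the
internal language to `M`. It preserves all structure strictly, because each structure map of the
syntactic model is a term whose interpretation is the corresponding structure map of `M`, and it is
faithful by completeness. In the other direction, `Model.name` sends an object to its ground type
and a morphism `f` to the constant `c_f` applied to a variable. Since `interp` is faithful and
undoes `name`, all equations about `name` can be checked in `M`. One composite is the identity of
`M`. The other is isomorphic to the identity because a type and the ground type of its
interpretation are identified by a type axiom.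

For a theory `P`, the translation `Theory.quote` sends a ground type to its class and a constant to
the global element that it names. The translation `Theory.reify` chooses a type in each class and a
term for each morphism. The main point is `Theory.exists_denotes`: the interpretation in the
syntactic model of a term `L` of its internal language is the class of `reify L`, once the context
is packed into a product type. So equality in the internal language amounts to provable equality of
the reified terms. As `reify` after `quote` returns each term of `P` up to provable equality
(`Theory.eqTm_reifyTm_quoteTm`), both translations are well defined and mutually inverse up to
isomorphism. -/

namespace CSC

/-! ### Sequencing in context for a strong monad -/

namespace StrongMonad

open CartesianMonoidalCategory

variable {C : Type u} [Category.{v} C] [CartesianMonoidalCategory C] (T : StrongMonad C)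

theorem map_comp' {X Y Z : C} (f : X ⟶ Y) (g : Y ⟶ Z) : T.map f ≫ T.map g = T.map (f ≫ g) :=
  (T.toFunctor.map_comp f g).symm

theorem map_comp_assoc' {X Y Z W : C} (f : X ⟶ Y) (g : Y ⟶ Z) (h : T.obj Z ⟶ W) :
    T.map f ≫ T.map g ≫ h = T.map (f ≫ g) ≫ h := by
  rw [← Category.assoc, T.map_comp']

theorem η_natural {X Y : C} (f : X ⟶ Y) : T.η.app X ≫ T.map f = f ≫ T.η.app Y :=
  (T.η.naturality f).symm

theorem μ_natural {X Y : C} (f : X ⟶ Y) :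
    T.μ.app X ≫ T.map f = T.map (T.map f) ≫ T.μ.app Y :=
  (T.μ.naturality f).symm

theorem map_η_μ (X : C) : T.map (T.η.app X) ≫ T.μ.app X = 𝟙 (T.obj X) := T.right_unit X

theorem η_μ (X : C) : T.η.app (T.obj X) ≫ T.μ.app X = 𝟙 (T.obj X) := T.left_unit X

theorem map_μ_μ (X : C) : T.map (T.μ.app X) ≫ T.μ.app X = T.μ.app (T.obj X) ≫ T.μ.app X :=
  T.assoc X

theorem whiskerRight_str {X X' : C} (f : X ⟶ X') (Y : C) :
    f ▷ T.obj Y ≫ T.str X' Y = T.str X Y ≫ T.map (f ▷ Y) := by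
  have := T.str_natural f (𝟙 Y)
  rwa [T.map_id, tensorHom_id, tensorHom_id] at this

theorem whiskerLeft_str (X : C) {Y Y' : C} (g : Y ⟶ Y') :
    X ◁ T.map g ≫ T.str X Y' = T.str X Y ≫ T.map (X ◁ g) := by
  have := T.str_natural (𝟙 X) g
  rwa [id_tensorHom, id_tensorHom] at this

/-- Collapsing the left factor to the terminal object writes `snd` as a whiskering followed by the
left unitor. Naturality of the strength in its left argument then reduces the claim to `str_unit`.
-/
theorem str_snd (X Y : C) : T.str X Y ≫ T.map (snd X Y) = snd X (T.obj Y) := by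
  have e : ∀ Z : C, snd X Z = toUnit X ▷ Z ≫ (λ_ Z).hom := fun Z => by
    rw [leftUnitor_hom, whiskerRight_snd]
  rw [e Y, e (T.obj Y), ← T.map_comp', ← Category.assoc, ← T.whiskerRight_str, Category.assoc,
    T.str_unit]

/-- Associativity of the strength, restricted along the diagonal of `X`. It serves nested
sequencing, where the same context is used twice. -/
theorem lift_fst_str (X Y : C) : lift (fst X (T.obj Y)) (T.str X Y) ≫ T.str X (X ⊗ Y) =
    T.str X Y ≫ T.map (lift (fst X Y) (𝟙 (X ⊗ Y))) := by
  have e : lift (fst X (T.obj Y)) (T.str X Y) =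
      lift (𝟙 X) (𝟙 X) ▷ T.obj Y ≫ (α_ X X (T.obj Y)).hom ≫ X ◁ T.str X Y := by
    have h : (lift (𝟙 X) (𝟙 X) ▷ T.obj Y ≫ (α_ X X (T.obj Y)).hom) ≫ snd X (X ⊗ T.obj Y) = 𝟙 _ := by
      ext <;> simp
    refine hom_ext _ _ (by simp) ?_
    rw [lift_snd, Category.assoc, Category.assoc, whiskerLeft_snd, ← Category.assoc,
      ← Category.assoc, h, Category.id_comp]
  have e' : lift (fst X Y) (𝟙 (X ⊗ Y)) = lift (𝟙 X) (𝟙 X) ▷ Y ≫ (α_ X X Y).hom := by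
    ext <;> simp
  rw [e, e', Category.assoc, Category.assoc, ← T.str_assoc, ← T.map_comp', ← Category.assoc,
    T.whiskerRight_str, Category.assoc]

/-- The interpretation of sequencing in a context `X`. -/
def bind {X A B : C} (f : X ⟶ T.obj A) (g : X ⊗ A ⟶ T.obj B) : X ⟶ T.obj B :=
  lift (𝟙 X) f ≫ T.str X A ≫ T.map g ≫ T.μ.app B

/-- Naturality of the strength in the context; this is the sequencing case of the substitution
lemma. -/
theorem comp_bind {Y X A B : C} (s : Y ⟶ X) (f : X ⟶ T.obj A) (g : X ⊗ A ⟶ T.obj B) :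
    s ≫ T.bind f g = T.bind (s ≫ f) (s ▷ A ≫ g) := by
  have e : s ≫ lift (𝟙 X) f = lift (𝟙 Y) (s ≫ f) ≫ s ▷ T.obj A := by ext <;> simp
  unfold bind
  rw [← T.map_comp_assoc', ← Category.assoc (T.str Y A), ← T.whiskerRight_str,
    Category.assoc, ← Category.assoc s, e, Category.assoc]

theorem bind_comp_η {X A B : C} (f : X ⟶ T.obj A) (g : X ⊗ A ⟶ B) :
    T.bind f (g ≫ T.η.app B) = lift (𝟙 X) f ≫ T.str X A ≫ T.map g := by
  unfold bind
  rw [← T.map_comp_assoc', T.map_η_μ, Category.comp_id]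

theorem bind_η {X A B : C} (f : X ⟶ A) (g : X ⊗ A ⟶ T.obj B) :
    T.bind (f ≫ T.η.app A) g = lift (𝟙 X) f ≫ g := by
  have e : lift (𝟙 X) (f ≫ T.η.app A) = lift (𝟙 X) f ≫ X ◁ T.η.app A := by ext <;> simp
  unfold bind
  rw [e, Category.assoc, ← Category.assoc (X ◁ _), T.str_η, ← Category.assoc (T.η.app _),
    T.η_natural, Category.assoc, T.η_μ, Category.comp_id]

theorem bind_snd_η {X A : C} (f : X ⟶ T.obj A) : T.bind f (snd X A ≫ T.η.app A) = f := by
  rw [bind_comp_η, str_snd, lift_snd]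

/-- The semantic form of associativity. The continuation `h` does not use the first result, hence
the weakening `fst X A ▷ B`. -/
theorem bind_bind {X A B D : C} (f : X ⟶ T.obj A) (g : X ⊗ A ⟶ T.obj B) (h : X ⊗ B ⟶ T.obj D) :
    T.bind (T.bind f g) h = T.bind f (T.bind g (fst X A ▷ B ≫ h)) := by
  -- The outer strength is moved through the inner sequencing: past `μ` by `str_μ`, past `T.map g`
  -- by naturality, and past the inner strength by `lift_fst_str`.
  have e₁ : lift (𝟙 X) (T.bind f g) ≫ T.str X B =
      lift (𝟙 X) f ≫ T.str X A ≫ T.map (lift (fst X A) g ≫ T.str X B) ≫ T.μ.app (X ⊗ B) := by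
    have : lift (𝟙 X) (T.bind f g) = lift (𝟙 X) f ≫ lift (fst X (T.obj A)) (T.str X A) ≫
        X ◁ T.map g ≫ X ◁ T.μ.app B := by
      unfold bind
      ext <;> simp
    rw [this]
    simp only [Category.assoc]
    rw [T.str_μ, ← Category.assoc (X ◁ T.map g), T.whiskerLeft_str, Category.assoc,
      ← Category.assoc (lift (fst _ _) _), T.lift_fst_str, Category.assoc,
      T.map_comp_assoc', T.map_comp_assoc']
    congr 5
    ext <;> simp
  have e₂ : T.bind g (fst X A ▷ B ≫ h) =
      (lift (fst X A) g ≫ T.str X B) ≫ T.map h ≫ T.μ.app D := by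
    unfold bind
    rw [← T.map_comp_assoc', ← Category.assoc (T.str _ _), ← T.whiskerRight_str]
    simp only [← Category.assoc]
    congr 3
    ext <;> simp
  rw [e₂]
  rw [bind, ← Category.assoc, e₁]
  unfold bind
  simp only [Category.assoc]
  rw [← Category.assoc (T.μ.app _), T.μ_natural, Category.assoc, ← T.map_μ_μ]
  simp only [T.map_comp_assoc', Category.assoc]

theorem bind_η_map {X A B D : C} (f : X ⟶ T.obj A) (g : X ⊗ A ⟶ B) (h : B ⟶ D) :
    T.bind f (g ≫ T.η.app B) ≫ T.map h = T.bind f ((g ≫ h) ≫ T.η.app D) := by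
  rw [bind_comp_η, bind_comp_η, ← T.map_comp']
  simp only [Category.assoc]

/-- Together with `lift_str` and `lift_rstr` this turns composites of strengths and multiplications
into nested sequencing, where the monad laws above apply. -/
theorem bind_map_μ {X A B D : C} (f : X ⟶ T.obj A) (g : X ⊗ A ⟶ B) (h : B ⟶ T.obj D) :
    T.bind f (g ≫ T.η.app B) ≫ T.map h ≫ T.μ.app D = T.bind f (g ≫ h) := by
  rw [bind_comp_η]
  unfold bind
  rw [← T.map_comp_assoc']
  simp only [Category.assoc]

theorem lift_str {X A B : C} (f : X ⟶ A) (g : X ⟶ T.obj B) :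
    lift f g ≫ T.str A B = T.bind g (f ▷ B ≫ T.η.app _) := by
  rw [bind_comp_η, ← T.whiskerRight_str, ← Category.assoc]
  congr 1
  ext <;> simp

theorem lift_rstr {X A B : C} (f : X ⟶ T.obj A) (g : X ⟶ B) :
    lift f g ≫ T.rstr A B = T.bind f (lift (snd X A) (fst X A ≫ g) ≫ T.η.app _) := by
  have e : lift f g ≫ swap (T.obj A) B = lift g f := by unfold swap; ext <;> simp
  unfold rstr
  rw [← Category.assoc, e, ← Category.assoc, lift_str, bind_η_map]
  congr 2
  unfold swap
  ext <;> simp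

/-- Running `f` before `g` factors through one of the two canonical maps `T A × T B ⟶ T (A × B)`,
whatever the continuation `h`. So commutation of `f` and `g` needs to be known only for these maps.
-/
theorem bind_eq_rstr {X A B D : C} (f : X ⟶ T.obj A) (g : X ⟶ T.obj B)
    (h : (X ⊗ A) ⊗ B ⟶ T.obj D) : T.bind f (T.bind (fst X A ≫ g) h) =
      T.bind (lift f g ≫ T.rstr A (T.obj B) ≫ T.map (T.str A B) ≫ T.μ.app _)
        ((α_ X A B).inv ≫ h) := by
  rw [← Category.assoc (lift f g), lift_rstr, bind_map_μ, lift_str, bind_bind, bind_bind]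
  congr 2
  -- Both weakenings produced by `bind_bind` act on the context only. Inserting the pair of the two
  -- results and reassociating therefore gives back `(X ⊗ A) ⊗ B`.
  have e : lift (𝟙 _) (snd X A ▷ B) ≫ fst (X ⊗ A) B ▷ (A ⊗ B) ≫ fst X A ▷ (A ⊗ B) ≫
      (α_ X A B).inv = 𝟙 _ := by
    ext <;> simp
  rw [bind_η]
  simp only [← Category.assoc] at e ⊢
  rw [e, Category.id_comp]

/-- The counterpart of `bind_eq_rstr` with `g` run first. The results then arrive in the order `B`,
`A`, and the `lift` before `h` exchanges them. -/
theorem bind_eq_str {X A B D : C} (f : X ⟶ T.obj A) (g : X ⟶ T.obj B)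
    (h : (X ⊗ A) ⊗ B ⟶ T.obj D) :
    T.bind g (T.bind (fst X B ≫ f) (lift (lift (fst _ _ ≫ fst _ _) (snd _ _))
      (fst _ _ ≫ snd _ _) ≫ h)) =
      T.bind (lift f g ≫ T.str (T.obj A) B ≫ T.map (T.rstr A B) ≫ T.μ.app _)
        ((α_ X A B).inv ≫ h) := by
  have e : f ▷ B = lift (fst X B ≫ f) (snd X B) := by ext <;> simp
  rw [← Category.assoc (lift f g), lift_str, bind_map_μ, e, lift_rstr, bind_bind, bind_bind]
  congr 2
  have e : lift (𝟙 _) (lift (snd (X ⊗ B) A) (fst (X ⊗ B) A ≫ snd X B)) ≫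
      fst (X ⊗ B) A ▷ (A ⊗ B) ≫ fst X B ▷ (A ⊗ B) ≫ (α_ X A B).inv =
      lift (lift (fst _ _ ≫ fst _ _) (snd _ _)) (fst _ _ ≫ snd _ _) := by
    ext <;> simp
  rw [bind_η, ← e]
  simp only [Category.assoc]

/-- By `bind_eq_rstr` and `bind_eq_str` the two orders differ only in the canonical map `T A × T B ⟶
T (A × B)`, and these maps agree on the cone `i`. -/
theorem bind_comm {X A B D Z : C} {i : Z ⟶ T.obj A} (hi : T.IsCentralCone i) (f : X ⟶ Z)
    (g : X ⟶ T.obj B) (h : (X ⊗ A) ⊗ B ⟶ T.obj D) :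
    T.bind (f ≫ i) (T.bind (fst X A ≫ g) h) =
      T.bind g (T.bind (fst X B ≫ f ≫ i) (lift (lift (fst _ _ ≫ fst _ _) (snd _ _))
        (fst _ _ ≫ snd _ _) ≫ h)) := by
  have e : lift (f ≫ i) g = lift f g ≫ i ▷ T.obj B := by ext <;> simp
  rw [bind_eq_rstr, bind_eq_str, e, Category.assoc, Category.assoc, hi B]

/-- A morphism of strong monads preserves sequencing, because it is compatible with strength,
functor and multiplication in turn. -/
theorem Hom.bind_app {S T : StrongMonad C} (i : Hom S T) {X A B : C} (f : X ⟶ S.obj A)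
    (g : X ⊗ A ⟶ S.obj B) : T.bind (f ≫ i.app A) (g ≫ i.app B) = S.bind f g ≫ i.app B := by
  have e : lift (𝟙 X) (f ≫ i.app A) = lift (𝟙 X) f ≫ X ◁ i.app A := by ext <;> simp
  have nat : ∀ {Y Z : C} (l : Y ⟶ Z), i.app Y ≫ T.map l = S.map l ≫ i.app Z := fun l =>
    (i.toNatTrans.naturality l).symm
  have hμ : S.μ.app B ≫ i.app B = (S.map (i.app B) ≫ i.app (T.obj B)) ≫ T.μ.app B := i.app_μ B
  unfold bind
  rw [e, Category.assoc, ← Category.assoc (X ◁ _), ← i.app_str]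
  simp only [Category.assoc]
  rw [hμ, ← Category.assoc (i.app _), nat, Category.assoc, Category.assoc,
    S.map_comp_assoc']

theorem swap_whiskerRight {X Y : C} (Z : C) (f : X ⟶ Y) :
    StrongMonad.swap Z X ≫ f ▷ Z = Z ◁ f ≫ StrongMonad.swap Z Y := by
  unfold StrongMonad.swap
  ext <;> simp

/-- Contexts grow on the right while `curry` abstracts the left factor, hence the `swap`. This is
naturality of abstraction in the context, the `lam` case of the substitution lemma. -/
theorem curry_swap_whiskerRight [MonoidalClosed C] {X Y Z W : C} (f : X ⟶ Y) (g : Y ⊗ Z ⟶ W) :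
    MonoidalClosed.curry (StrongMonad.swap Z X ≫ f ▷ Z ≫ g) =
      f ≫ MonoidalClosed.curry (StrongMonad.swap Z Y ≫ g) := by
  rw [← MonoidalClosed.curry_natural_left, ← Category.assoc, ← Category.assoc,
    swap_whiskerRight]

end StrongMonad

/-! ### Denotations of terms, one clause for each term former -/

namespace Model

variable {M : Model.{u, v}}

open CartesianMonoidalCategory

/-- The term `L` in the context `Γ` has the interpretation `f`. -/
def Denotes (Γ : List (Ty M.langSig.G)) (L : Tm M.langSig.G M.langSig.K) {Y : M.C}
    (f : M.semCtx Γ ⟶ Y) : Prop :=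
  M.semTm Γ L = some ⟨Y, f⟩

namespace Denotes

variable {Γ : List (Ty M.langSig.G)} {L N : Tm M.langSig.G M.langSig.K}
  {A B : Ty M.langSig.G} {X Y Z : M.C}

/-- A term has at most one denotation with a given codomain. Interpretations can thus be computed
clause by clause, without reference to a typing derivation. -/
theorem unique {f f' : M.semCtx Γ ⟶ Y} (h : Denotes Γ L f) (h' : Denotes Γ L f') : f = f' := by
  have := Option.some.inj (h.symm.trans h')
  simpa using this

theorem congr_hom {f f' : M.semCtx Γ ⟶ Y} (h : Denotes Γ L f) (e : f = f') : Denotes Γ L f' :=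
  e ▸ h

theorem sem_eq (h : M.langSig.HasType Γ L A) {f : M.semCtx Γ ⟶ M.semTy A} (hf : Denotes Γ L f) :
    sem h = f :=
  unique (semTm_eq h) hf

theorem var_zero : Denotes (A :: Γ) (.var 0) (snd (M.semCtx Γ) (M.semTy A)) := rfl

theorem var_succ {n} {f : M.semCtx Γ ⟶ Y} (h : Denotes Γ (.var n) f) :
    Denotes (A :: Γ) (.var (n + 1)) (fst (M.semCtx Γ) (M.semTy A) ≫ f) :=
  congrArg (Option.map _) h

theorem const (f : X ⟶ Y) : Denotes Γ (.const ⟨X, Y, f⟩)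
    (toUnit (M.semCtx Γ) ≫ MonoidalClosed.curry ((ρ_ X).hom ≫ f)) := rfl

theorem star : Denotes Γ .star (toUnit (M.semCtx Γ)) := rfl

theorem lam {f : M.semCtx (A :: Γ) ⟶ Y} (h : Denotes (A :: Γ) L f) : Denotes Γ (.lam A L)
    (MonoidalClosed.curry (StrongMonad.swap (M.semTy A) (M.semCtx Γ) ≫ f)) :=
  congrArg (Option.map _) h

theorem app {f : M.semCtx Γ ⟶ (ihom (M.semTy A)).obj (M.semTy B)} {f' : M.semCtx Γ ⟶ M.semTy A}
    (h : Denotes Γ L f) (h' : Denotes Γ N f') :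
    Denotes Γ (.app A B L N) (lift f' f ≫ (ihom.ev (M.semTy A)).app (M.semTy B)) :=
  congrArg₂ (Option.map₂ _) (toCod_eq h) (toCod_eq h')

theorem pair {f : M.semCtx Γ ⟶ X} {f' : M.semCtx Γ ⟶ Y} (h : Denotes Γ L f)
    (h' : Denotes Γ N f') : Denotes Γ (.pair L N) (lift f f') :=
  congrArg₂ (Option.map₂ _) h h'

theorem fst {f : M.semCtx Γ ⟶ M.semTy A ⊗ M.semTy B} (h : Denotes Γ L f) :
    Denotes Γ (.fst A B L) (f ≫ CartesianMonoidalCategory.fst _ _) :=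
  congrArg (Option.map _) (toCod_eq h)

theorem snd {f : M.semCtx Γ ⟶ M.semTy A ⊗ M.semTy B} (h : Denotes Γ L f) :
    Denotes Γ (.snd A B L) (f ≫ CartesianMonoidalCategory.snd _ _) :=
  congrArg (Option.map _) (toCod_eq h)

theorem ret (e : Eff) {f : M.semCtx Γ ⟶ Y} (h : Denotes Γ L f) :
    Denotes Γ (.ret e L) (f ≫ (M.mon e).η.app Y) :=
  congrArg (Option.map _) h

theorem iota {f : M.semCtx Γ ⟶ M.S.obj (M.semTy A)} (h : Denotes Γ L f) :
    Denotes Γ (.iota A L) (f ≫ M.ι.app (M.semTy A)) :=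
  congrArg (Option.map _) (toCod_eq h)

theorem bind (e : Eff) {f : M.semCtx Γ ⟶ (M.mon e).obj (M.semTy A)}
    {f' : M.semCtx (A :: Γ) ⟶ (M.mon e).obj (M.semTy B)}
    (h : Denotes Γ L f) (h' : Denotes (A :: Γ) N f') :
    Denotes Γ (.bind e A B L N) ((M.mon e).bind f f') :=
  congrArg₂ (Option.map₂ _) (toCod_eq h) (toCod_eq h')

theorem exists_of_hasType (h : M.langSig.HasType Γ L A) :
    ∃ f : M.semCtx Γ ⟶ M.semTy A, Denotes Γ L f :=
  semTm_of_hasType h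

end Denotes

/-! open Theory
# Substitution -/

/-- `σ` is the interpretation of the substitution `s` from `Γ` to `Δ`. -/
structure DenotesSubst (Δ : List (Ty M.langSig.G)) (s : ℕ → Tm M.langSig.G M.langSig.K)
    (Γ : List (Ty M.langSig.G)) (σ : M.semCtx Δ ⟶ M.semCtx Γ) : Prop where
  hasSubst : M.langSig.HasSubst Δ s Γ
  denotes : ∀ n A, Γ[n]? = some A → ∃ v : M.semCtx Γ ⟶ M.semTy A,
    Denotes Γ (.var n) v ∧ Denotes Δ (s n) (σ ≫ v)

/-- The interpretation of substitution, for a class of substitutions closed under binders. -/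
theorem denotes_subst_of_class
    (R : ∀ (Δ : List (Ty M.langSig.G)) (_ : ℕ → Tm M.langSig.G M.langSig.K)
        (Γ : List (Ty M.langSig.G)),
      (M.semCtx Δ ⟶ M.semCtx Γ) → Prop)
    (hR : ∀ {Δ s Γ σ}, R Δ s Γ σ → DenotesSubst Δ s Γ σ)
    (hup : ∀ {Δ s Γ σ} (A : Ty M.langSig.G), R Δ s Γ σ →
      R (A :: Δ) (Tm.up s) (A :: Γ) (σ ▷ M.semTy A))
    {Γ L A} (h : M.langSig.HasType Γ L A) : ∀ {Δ s σ}, R Δ s Γ σ →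
      ∃ f : M.semCtx Γ ⟶ M.semTy A, Denotes Γ L f ∧ Denotes Δ (L.subst s) (σ ≫ f) := by
  -- Going under a binder weakens the substituted terms, so the substitution lemma presupposes
  -- weakening, which is itself an instance for renamings. One induction over an abstract class `R`
  -- serves both: first for renamings, then for all substitutions.
  induction h with
  | var h => intro Δ s σ hs; exact (hR hs).denotes _ _ h
  | const c => intro Δ s σ hs; exact ⟨_, .const c.2.2, (Denotes.const c.2.2).congr_hom
      ((congrArg (· ≫ _) (toUnit_unique _ _)).trans (Category.assoc _ _ _))⟩
  | star => intro Δ s σ hs; exact ⟨_, .star, Denotes.star.congr_hom (toUnit_unique _ _)⟩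
  | @lam _ A _ _ _ ih =>
    intro Δ s σ hs
    obtain ⟨f, hf, hf'⟩ := ih (hup A hs)
    refine ⟨_, .lam hf, hf'.lam.congr_hom ?_⟩
    exact StrongMonad.curry_swap_whiskerRight _ _
  | app _ _ ih₁ ih₂ =>
    intro Δ s σ hs
    obtain ⟨f₁, hf₁, hf₁'⟩ := ih₁ hs
    obtain ⟨f₂, hf₂, hf₂'⟩ := ih₂ hs
    refine ⟨_, .app hf₁ hf₂, (Denotes.app hf₁' hf₂').congr_hom ?_⟩
    exact (comp_lift_assoc _ _ _ _).symm
  | pair _ _ ih₁ ih₂ =>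
    intro Δ s σ hs
    obtain ⟨f₁, hf₁, hf₁'⟩ := ih₁ hs
    obtain ⟨f₂, hf₂, hf₂'⟩ := ih₂ hs
    exact ⟨_, .pair hf₁ hf₂, (Denotes.pair hf₁' hf₂').congr_hom (comp_lift _ _ _).symm⟩
  | fst _ ih =>
    intro Δ s σ hs
    obtain ⟨f, hf, hf'⟩ := ih hs
    exact ⟨_, .fst hf, (Denotes.fst hf').congr_hom (Category.assoc _ _ _)⟩
  | snd _ ih =>
    intro Δ s σ hs
    obtain ⟨f, hf, hf'⟩ := ih hs
    exact ⟨_, .snd hf, (Denotes.snd hf').congr_hom (Category.assoc _ _ _)⟩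
  | ret e _ ih =>
    intro Δ s σ hs
    obtain ⟨f, hf, hf'⟩ := ih hs
    exact ⟨_, .ret e hf, (hf'.ret e).congr_hom (Category.assoc _ _ _)⟩
  | iota _ ih =>
    intro Δ s σ hs
    obtain ⟨f, hf, hf'⟩ := ih hs
    exact ⟨_, .iota hf, (Denotes.iota hf').congr_hom (Category.assoc _ _ _)⟩
  | @bind _ e A _ _ _ _ _ ih₁ ih₂ =>
    intro Δ s σ hs
    obtain ⟨f₁, hf₁, hf₁'⟩ := ih₁ hs
    obtain ⟨f₂, hf₂, hf₂'⟩ := ih₂ (hup A hs)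
    exact ⟨_, .bind e hf₁ hf₂,
      (Denotes.bind e hf₁' hf₂').congr_hom ((M.mon e).comp_bind _ _ _).symm⟩
  | conv e _ ih =>
    intro Δ s σ hs
    obtain ⟨f, hf, hf'⟩ := ih hs
    rw [← semTy_eq e]
    exact ⟨f, hf, hf'⟩

/-- Isolates what a class must provide to be closed under binders. For renamings the weakened terms
are variables and `h` is immediate; in general `h` is `Denotes.wk`. -/
theorem DenotesSubst.up_of_wk {Δ s Γ} {σ : M.semCtx Δ ⟶ M.semCtx Γ} (hs : DenotesSubst Δ s Γ σ)
    (A : Ty M.langSig.G)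
    (h : ∀ n B (f : M.semCtx Δ ⟶ M.semTy B), Γ[n]? = some B → Denotes Δ (s n) f →
      Denotes (A :: Δ) (s n).wk (CartesianMonoidalCategory.fst _ (M.semTy A) ≫ f)) :
    DenotesSubst (A :: Δ) (Tm.up s) (A :: Γ) (σ ▷ M.semTy A) where
  hasSubst := hs.hasSubst.up A
  denotes n B hn := by
    cases n with
    | zero =>
      obtain rfl : A = B := Option.some.inj hn
      exact ⟨_, .var_zero, Denotes.var_zero.congr_hom (whiskerRight_snd _ _).symm⟩
    | succ n =>
      obtain ⟨v, hv, hv'⟩ := hs.denotes n B hn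
      exact ⟨_, .var_succ hv, (h n B _ hn hv').congr_hom (whiskerRight_fst_assoc _ _ _).symm⟩

/-- The interpretation of renaming. -/
theorem denotes_rename {Γ L A} (h : M.langSig.HasType Γ L A) {Δ} {r : ℕ → ℕ}
    {σ : M.semCtx Δ ⟶ M.semCtx Γ} (hr : DenotesSubst Δ (fun n => .var (r n)) Γ σ)
    {f : M.semCtx Γ ⟶ M.semTy A} (hf : Denotes Γ L f) : Denotes Δ (L.rename r) (σ ≫ f) := by
  obtain ⟨f', hf', hL⟩ := denotes_subst_of_class
    (fun Δ s Γ σ => DenotesSubst Δ s Γ σ ∧ ∃ r : ℕ → ℕ, s = fun n => .var (r n))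
    (fun h => h.1) (fun {Δ s Γ σ} A hs => by
      obtain ⟨hs, r, rfl⟩ := hs
      refine ⟨hs.up_of_wk A fun n B f _ hf => ?_, Tm.upr r, ?_⟩
      · exact hf.var_succ
      · funext n; cases n <;> rfl) h ⟨hr, r, rfl⟩
  have e : L.rename r = L.subst (fun n => .var (r n)) :=
    (Tm.subst_var _).symm.trans (Tm.subst_rename _ _ _)
  rw [e, hf.unique hf']
  exact hL

theorem denotesSubst_succ (Γ : List (Ty M.langSig.G)) (A : Ty M.langSig.G) :
    DenotesSubst (A :: Γ) (fun n => .var n.succ) Γ (CartesianMonoidalCategory.fst _ _) where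
  hasSubst n B hn := .var hn
  denotes n B hn := by
    obtain ⟨v, hv⟩ := semVar_of_mem hn
    exact ⟨v, hv, .var_succ hv⟩

theorem Denotes.wk {Γ L A} (h : M.langSig.HasType Γ L A) {f : M.semCtx Γ ⟶ M.semTy A}
    (hf : Denotes Γ L f) (B : Ty M.langSig.G) :
    Denotes (B :: Γ) L.wk (CartesianMonoidalCategory.fst _ (M.semTy B) ≫ f) :=
  denotes_rename h (denotesSubst_succ Γ B) hf

theorem DenotesSubst.up {Δ s Γ} {σ : M.semCtx Δ ⟶ M.semCtx Γ} (hs : DenotesSubst Δ s Γ σ)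
    (A : Ty M.langSig.G) : DenotesSubst (A :: Δ) (Tm.up s) (A :: Γ) (σ ▷ M.semTy A) :=
  hs.up_of_wk A fun n B _ hn hf => hf.wk (hs.hasSubst n B hn) A

/-- The interpretation of substitution is composition. -/
theorem Denotes.subst {Γ L A} (h : M.langSig.HasType Γ L A) {f : M.semCtx Γ ⟶ M.semTy A}
    (hf : Denotes Γ L f) {Δ s} {σ : M.semCtx Δ ⟶ M.semCtx Γ} (hs : DenotesSubst Δ s Γ σ) :
    Denotes Δ (L.subst s) (σ ≫ f) := by
  obtain ⟨f', hf', hL⟩ := denotes_subst_of_class DenotesSubst (fun h => h) (fun A h => h.up A) h hs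
  rwa [hf.unique hf']

theorem DenotesSubst.cons {Δ s Γ A} {σ : M.semCtx Δ ⟶ M.semCtx Γ} {f : M.semCtx Δ ⟶ M.semTy A}
    (hs : DenotesSubst Δ (fun n => s (n + 1)) Γ σ) (h : M.langSig.HasType Δ (s 0) A)
    (hf : Denotes Δ (s 0) f) : DenotesSubst Δ s (A :: Γ) (lift σ f) where
  hasSubst n B hn := by
    cases n with
    | zero =>
      obtain rfl : A = B := Option.some.inj hn
      exact h
    | succ n => exact hs.hasSubst n B hn
  denotes n B hn := by
    cases n with
    | zero =>
      obtain rfl : A = B := Option.some.inj hn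
      exact ⟨_, .var_zero, hf.congr_hom (lift_snd _ _).symm⟩
    | succ n =>
      obtain ⟨v, hv, hv'⟩ := hs.denotes n B hn
      exact ⟨_, .var_succ hv, hv'.congr_hom (lift_fst_assoc _ _ _).symm⟩

theorem denotesSubst_nil (Δ : List (Ty M.langSig.G)) (s) :
    DenotesSubst Δ s [] (toUnit (M.semCtx Δ)) where
  hasSubst _ _ hn := nomatch hn
  denotes _ _ hn := nomatch hn

theorem denotesSubst_var (Γ : List (Ty M.langSig.G)) : DenotesSubst Γ .var Γ (𝟙 _) where
  hasSubst n B hn := .var hn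
  denotes n B hn := by
    obtain ⟨v, hv⟩ := semVar_of_mem hn
    exact ⟨v, hv, Denotes.congr_hom hv (Category.id_comp v).symm⟩

/-- The interpretation is the tuple of the interpretations of the substituted terms, built up along
`Γ`. -/
theorem exists_denotesSubst : ∀ {Γ Δ s}, M.langSig.HasSubst Δ s Γ → ∃ σ, DenotesSubst Δ s Γ σ
  | [], Δ, s, _ => ⟨_, denotesSubst_nil Δ s⟩
  | A :: Γ, Δ, s, h => by
    obtain ⟨σ, hσ⟩ := exists_denotesSubst (Γ := Γ) (s := fun n => s (n + 1))
      (fun n B hn => h (n + 1) B hn)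
    obtain ⟨f, hf⟩ := semTm_of_hasType (h 0 A rfl)
    exact ⟨_, hσ.cons (h 0 A rfl) hf⟩

theorem Denotes.inst {Γ L N A B} (hL : M.langSig.HasType (A :: Γ) L B)
    (hN : M.langSig.HasType Γ N A) {f : M.semCtx (A :: Γ) ⟶ M.semTy B}
    {f' : M.semCtx Γ ⟶ M.semTy A} (hf : Denotes (A :: Γ) L f) (hf' : Denotes Γ N f') :
    Denotes Γ (L.inst N) (lift (𝟙 _) f' ≫ f) :=
  hf.subst hL ((denotesSubst_var Γ).cons (s := Tm.single N) hN hf')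

/-! open Theory
# Independence of the choice of types -/

/-- Recorded types enter `semTm` only through their interpretations. For formers that bind no
variable the contexts stay the same, so rewriting is enough and no typing is needed. -/
theorem fst_congr {A A' B B' : Ty M.langSig.G} (h : M.semTy A = M.semTy A')
    (h' : M.semTy B = M.semTy B')
    (Γ L) : M.semTm Γ (.fst A B L) = M.semTm Γ (.fst A' B' L) := by
  simp only [semTm]
  rw [h, h']

theorem snd_congr {A A' B B' : Ty M.langSig.G} (h : M.semTy A = M.semTy A')
    (h' : M.semTy B = M.semTy B')
    (Γ L) : M.semTm Γ (.snd A B L) = M.semTm Γ (.snd A' B' L) := by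
  simp only [semTm]
  rw [h, h']

theorem app_congr {A A' B B' : Ty M.langSig.G} (h : M.semTy A = M.semTy A')
    (h' : M.semTy B = M.semTy B')
    (Γ L N) : M.semTm Γ (.app A B L N) = M.semTm Γ (.app A' B' L N) := by
  simp only [semTm]
  rw [h, h']

theorem iota_congr {A A' : Ty M.langSig.G} (h : M.semTy A = M.semTy A') (Γ L) :
    M.semTm Γ (.iota A L) = M.semTm Γ (.iota A' L) := by
  simp only [semTm]
  rw [h]

/-- Changing the type of the last variable is treated as the identity substitution between two
contexts, so the substitution lemma covers it. -/
theorem denotesSubst_conv {A A' : Ty M.langSig.G} (h : M.semTy A = M.semTy A')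
    (Γ : List (Ty M.langSig.G)) :
    DenotesSubst (A' :: Γ) .var (A :: Γ) (eqToHom (congrArg (M.semCtx Γ ⊗ ·) h.symm)) where
  hasSubst n B hn := by
    cases n with
    | zero =>
      obtain rfl : A = B := Option.some.inj hn
      exact .conv (.ax h.symm) (.var rfl)
    | succ n => exact .var hn
  denotes n B hn := by
    cases n with
    | zero =>
      obtain rfl : A = B := Option.some.inj hn
      refine ⟨_, .var_zero, ?_⟩
      -- Stated for arbitrary objects because `subst` cannot eliminate an equation between two
      -- interpretations `M.semTy _`.
      have key : ∀ {Z X X' : M.C} (h : X = X'),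
          (⟨X', snd Z X'⟩ : Σ Y : M.C, (Z ⊗ X' ⟶ Y)) =
            ⟨X, eqToHom (congrArg (Z ⊗ ·) h.symm) ≫ snd Z X⟩ := by
        intro Z X X' h
        subst h
        simp
      exact congrArg some (key h)
    | succ n =>
      obtain ⟨v, hv⟩ := semVar_of_mem (Γ := Γ) (n := n) (A := B) hn
      refine ⟨_, .var_succ hv, ?_⟩
      have key : ∀ {Z X X' : M.C} (h : X = X'),
          fst Z X' = eqToHom (congrArg (Z ⊗ ·) h.symm) ≫ fst Z X := by
        intro Z X X' h
        subst h
        simp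
      exact (Denotes.var_succ (A := A') hv).congr_hom
        ((congrArg (· ≫ v) (key h)).trans (Category.assoc _ _ _))

theorem Denotes.conv_ctx {A A' B : Ty M.langSig.G} (h : M.semTy A = M.semTy A') {Γ L}
    (hL : M.langSig.HasType (A :: Γ) L B) {f : M.semCtx (A :: Γ) ⟶ M.semTy B}
    (hf : Denotes (A :: Γ) L f) :
    Denotes (A' :: Γ) L (eqToHom (congrArg (M.semCtx Γ ⊗ ·) h.symm) ≫ f) := by
  have := hf.subst hL (denotesSubst_conv h Γ)
  rwa [Tm.subst_var] at this

/-- The recorded type also changes the context of the body. A typing of the body is therefore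
needed, to compare its two interpretations by `Denotes.conv_ctx`. -/
theorem lam_congr {A A' B : Ty M.langSig.G} (h : M.semTy A = M.semTy A') {Γ L}
    (hL : M.langSig.HasType (A :: Γ) L B) :
    M.semTm Γ (.lam A L) = M.semTm Γ (.lam A' L) := by
  obtain ⟨f, hf⟩ := semTm_of_hasType hL
  refine (Denotes.lam hf).trans (.trans ?_ (Denotes.lam (Denotes.conv_ctx h hL hf)).symm)
  have key : ∀ {Z Y X X' : M.C} (h : X = X') (f : Z ⊗ X ⟶ Y),
      (⟨(ihom X).obj Y, MonoidalClosed.curry (StrongMonad.swap X Z ≫ f)⟩ : Σ Y : M.C, (Z ⟶ Y)) =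
        ⟨(ihom X').obj Y, MonoidalClosed.curry
          (StrongMonad.swap X' Z ≫ eqToHom (congrArg (Z ⊗ ·) h.symm) ≫ f)⟩ := by
    intro Z Y X X' h f
    subst h
    simp
  exact congrArg some (key h f)

theorem bind_congr (e : Eff) {A A' B B' : Ty M.langSig.G} (h : M.semTy A = M.semTy A')
    (h' : M.semTy B = M.semTy B') {Γ L N} (hL : M.langSig.HasType Γ L (.mon e A))
    (hN : M.langSig.HasType (A :: Γ) N (.mon e B)) :
    M.semTm Γ (.bind e A B L N) = M.semTm Γ (.bind e A' B' L N) := by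
  -- The type `B` does not occur in the context of `N`, so it can be rewritten directly. Only the
  -- change of `A` needs a conversion of the context.
  have h₁ : M.semTm Γ (.bind e A B L N) = M.semTm Γ (.bind e A B' L N) := by
    simp only [semTm]
    rw [h']
  have hN' : M.langSig.HasType (A :: Γ) N (.mon e B') := .conv (.mon e (.ax h')) hN
  obtain ⟨l, hl⟩ := Denotes.exists_of_hasType hL
  obtain ⟨n, hn⟩ := Denotes.exists_of_hasType hN'
  refine h₁.trans ((Denotes.bind e hl hn).trans ?_)
  have hn' := Denotes.conv_ctx h hN' hn
  have key : ∀ {Z X X' Y : M.C} (h : X = X') (l : Z ⟶ (M.mon e).obj X)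
      (n : Z ⊗ X ⟶ (M.mon e).obj Y),
      (M.mon e).bind l n = (M.mon e).bind (l ≫ eqToHom (congrArg (M.mon e).obj h))
        (eqToHom (congrArg (Z ⊗ ·) h.symm) ≫ n) := by
    intro Z X X' Y h l n
    subst h
    simp
  have hl' : Denotes Γ L (l ≫ eqToHom (congrArg (M.mon e).obj h)) := by
    have : ∀ {Z X X' : M.C} (h : X = X') (l : Z ⟶ X), (⟨X, l⟩ : Σ Y : M.C, (Z ⟶ Y)) =
        ⟨X', l ≫ eqToHom h⟩ := by
      intro Z X X' h l
      subst h
      simp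
    exact Eq.trans hl (congrArg some (this (congrArg (M.mon e).obj h) l))
  rw [key h l n]
  exact (Denotes.bind e hl' hn').symm

/-! ### Soundness of provable equality -/

theorem denotesSubst_upr_succ (Γ : List (Ty M.langSig.G)) (A B : Ty M.langSig.G) :
    DenotesSubst (B :: A :: Γ) (fun n => .var (Tm.upr Nat.succ n)) (B :: Γ)
      (fst (M.semCtx Γ) (M.semTy A) ▷ M.semTy B) := by
  have h := (denotesSubst_succ Γ A).up B
  have e : Tm.up (fun n => (.var n.succ : Tm M.langSig.G M.langSig.K)) =
      fun n => .var (Tm.upr Nat.succ n) := by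
    funext n; cases n <;> rfl
  rwa [e] at h

theorem denotesSubst_succ_succ (Γ : List (Ty M.langSig.G)) (A B : Ty M.langSig.G) :
    DenotesSubst (A :: B :: Γ) (fun n => .var (n + 2)) Γ
      (fst _ (M.semTy A) ≫ fst (M.semCtx Γ) (M.semTy B)) where
  hasSubst n C hn := .var hn
  denotes n C hn := by
    obtain ⟨v, hv⟩ := semVar_of_mem hn
    exact ⟨v, hv, (Denotes.var_succ (.var_succ hv)).congr_hom (Category.assoc _ _ _).symm⟩

/-- The morphism is written exactly as the exchange in `StrongMonad.bind_comm`, so that the two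
match in the case `central` of soundness. -/
theorem denotesSubst_exch (Γ : List (Ty M.langSig.G)) (A B : Ty M.langSig.G) :
    DenotesSubst (A :: B :: Γ) (fun n => .var (Tm.exch n)) (B :: A :: Γ)
      (lift (lift (fst _ _ ≫ fst (M.semCtx Γ) (M.semTy B)) (snd _ (M.semTy A)))
        (fst _ _ ≫ snd _ _)) :=
  ((denotesSubst_succ_succ Γ A B).cons (s := fun n => .var (Tm.exch (n + 1)))
    (.var rfl) .var_zero).cons (s := fun n => .var (Tm.exch n)) (.var rfl) (.var_succ .var_zero)

/-- The `β` law for abstraction over the right factor of the context. -/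
theorem curry_swap_ev {C : Type u} [Category.{v} C] [CartesianMonoidalCategory C]
    [MonoidalClosed C] {X Y Z : C} (f : Z ⊗ X ⟶ Y) (a : Z ⟶ X) :
    lift a (MonoidalClosed.curry (StrongMonad.swap X Z ≫ f)) ≫ (ihom.ev X).app Y =
      lift (𝟙 Z) a ≫ f := by
  have e : lift a (MonoidalClosed.curry (StrongMonad.swap X Z ≫ f)) =
      lift a (𝟙 Z) ≫ X ◁ MonoidalClosed.curry (StrongMonad.swap X Z ≫ f) := by
    ext <;> simp
  have e' : lift a (𝟙 Z) ≫ StrongMonad.swap X Z = lift (𝟙 Z) a := by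
    unfold StrongMonad.swap
    ext <;> simp
  rw [e, Category.assoc, ← MonoidalClosed.uncurry_eq, MonoidalClosed.uncurry_curry,
    ← Category.assoc, e']

/-- The corresponding `η` law: after the `swap` the body is the transpose `uncurry f`. -/
theorem curry_ev {C : Type u} [Category.{v} C] [CartesianMonoidalCategory C]
    [MonoidalClosed C] {X Y Z : C} (f : Z ⟶ (ihom X).obj Y) :
    MonoidalClosed.curry (StrongMonad.swap X Z ≫ lift (snd Z X) (fst Z X ≫ f) ≫
      (ihom.ev X).app Y) = f := by
  have e : StrongMonad.swap X Z ≫ lift (snd Z X) (fst Z X ≫ f) = X ◁ f := by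
    unfold StrongMonad.swap
    ext <;> simp
  rw [← Category.assoc, e, ← MonoidalClosed.uncurry_eq, MonoidalClosed.curry_uncurry]

/-- Soundness: provably equal terms of the internal language have equal interpretations. -/
theorem denotes_of_eqTm {Γ L N A} (h : M.internalLanguage.EqTm Γ L N A) :
    ∃ f : M.semCtx Γ ⟶ M.semTy A, Denotes Γ L f ∧ Denotes Γ N f := by
  -- Asserting a common denotation, rather than an equation between two values of `sem`, lets the
  -- induction proceed without typing derivations in its statement.
  induction h with
  | ax h =>
    obtain ⟨hL, hN, e⟩ := h
    exact ⟨sem hL, semTm_eq hL, e ▸ semTm_eq hN⟩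
  | refl h =>
    obtain ⟨f, hf⟩ := Denotes.exists_of_hasType h
    exact ⟨f, hf, hf⟩
  | symm _ ih =>
    obtain ⟨f, hf, hf'⟩ := ih
    exact ⟨f, hf', hf⟩
  | trans _ _ ih₁ ih₂ =>
    obtain ⟨f, hf, hf'⟩ := ih₁
    obtain ⟨f', hf₁, hf₁'⟩ := ih₂
    obtain rfl := hf'.unique hf₁
    exact ⟨f, hf, hf₁'⟩
  | conv e _ ih =>
    rw [← semTy_eq e]
    exact ih
  | subst hs h ih =>
    obtain ⟨σ, hσ⟩ := exists_denotesSubst hs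
    obtain ⟨f, hf, hf'⟩ := ih
    exact ⟨σ ≫ f, hf.subst h.typed.1 hσ, hf'.subst h.typed.2 hσ⟩
  | unit_eta => exact ⟨_, .star, Denotes.var_zero.congr_hom (toUnit_unique _ _)⟩
  | pair_eq _ _ ih₁ ih₂ =>
    obtain ⟨f, hf, hf'⟩ := ih₁
    obtain ⟨g, hg, hg'⟩ := ih₂
    exact ⟨_, hf.pair hg, hf'.pair hg'⟩
  | fst_eq e e' _ ih =>
    obtain ⟨f, hf, hf'⟩ := ih
    exact ⟨_, hf.fst, (fst_congr (semTy_eq e) (semTy_eq e') _ _).symm.trans hf'.fst⟩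
  | snd_eq e e' _ ih =>
    obtain ⟨f, hf, hf'⟩ := ih
    exact ⟨_, hf.snd, (snd_congr (semTy_eq e) (semTy_eq e') _ _).symm.trans hf'.snd⟩
  | fst_beta h h' =>
    obtain ⟨f, hf⟩ := Denotes.exists_of_hasType h
    obtain ⟨g, hg⟩ := Denotes.exists_of_hasType h'
    exact ⟨_, (hf.pair hg).fst, hf.congr_hom (lift_fst _ _).symm⟩
  | snd_beta h h' =>
    obtain ⟨f, hf⟩ := Denotes.exists_of_hasType h
    obtain ⟨g, hg⟩ := Denotes.exists_of_hasType h'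
    exact ⟨_, (hf.pair hg).snd, hg.congr_hom (lift_snd _ _).symm⟩
  | pair_eta h =>
    obtain ⟨f, hf⟩ := Denotes.exists_of_hasType h
    exact ⟨_, .pair (.fst hf) (.snd hf), hf.congr_hom (lift_comp_fst_snd f).symm⟩
  | app_eq e e' _ _ ih₁ ih₂ =>
    obtain ⟨f, hf, hf'⟩ := ih₁
    obtain ⟨g, hg, hg'⟩ := ih₂
    exact ⟨_, hf.app hg, (app_congr (semTy_eq e) (semTy_eq e') _ _ _).symm.trans (hf'.app hg')⟩
  | lam_eq e h ih =>
    obtain ⟨f, hf, hf'⟩ := ih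
    exact ⟨_, hf.lam, (lam_congr (semTy_eq e) h.typed.2).symm.trans hf'.lam⟩
  | lam_beta h h' =>
    obtain ⟨f, hf⟩ := Denotes.exists_of_hasType h
    obtain ⟨g, hg⟩ := Denotes.exists_of_hasType h'
    exact ⟨_, hf.lam.app hg, (hf.inst h h' hg).congr_hom (curry_swap_ev f g).symm⟩
  | lam_eta h =>
    obtain ⟨f, hf⟩ := Denotes.exists_of_hasType h
    exact ⟨_, ((hf.wk h _).app .var_zero).lam, hf.congr_hom (curry_ev f).symm⟩
  | ret_eq X _ ih =>
    obtain ⟨f, hf, hf'⟩ := ih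
    exact ⟨_, hf.ret X, hf'.ret X⟩
  | bind_eq X e e' h h' ih₁ ih₂ =>
    obtain ⟨f, hf, hf'⟩ := ih₁
    obtain ⟨g, hg, hg'⟩ := ih₂
    exact ⟨_, hf.bind X hg, (bind_congr X (semTy_eq e) (semTy_eq e') h.typed.2
      h'.typed.2).symm.trans (hf'.bind X hg')⟩
  | bind_beta X h h' =>
    obtain ⟨f, hf⟩ := Denotes.exists_of_hasType h
    obtain ⟨g, hg⟩ := Denotes.exists_of_hasType h'
    exact ⟨_, (hf.ret X).bind X hg, (hg.inst h' h hf).congr_hom ((M.mon X).bind_η f g).symm⟩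
  | bind_eta X h =>
    obtain ⟨f, hf⟩ := Denotes.exists_of_hasType h
    exact ⟨_, hf.bind X (Denotes.var_zero.ret X), hf.congr_hom ((M.mon X).bind_snd_η f).symm⟩
  | @bind_assoc Γ _ _ _ A B _ X h h' h'' =>
    obtain ⟨f, hf⟩ := Denotes.exists_of_hasType h
    obtain ⟨g, hg⟩ := Denotes.exists_of_hasType h'
    obtain ⟨l, hl⟩ := Denotes.exists_of_hasType h''
    have hl' := denotes_rename h'' (denotesSubst_upr_succ Γ A B) hl
    exact ⟨_, (hf.bind X hg).bind X hl, (hf.bind X (hg.bind X hl')).congr_hom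
      ((M.mon X).bind_bind f g l).symm⟩
  | central h h' h'' =>
    obtain ⟨f, hf⟩ := Denotes.exists_of_hasType h
    obtain ⟨g, hg⟩ := Denotes.exists_of_hasType h'
    obtain ⟨l, hl⟩ := Denotes.exists_of_hasType h''
    have hl' := denotes_rename h'' (denotesSubst_exch _ _ _) hl
    refine ⟨_, hf.iota.bind .T ((hg.wk h' _).bind .T hl),
      (hg.bind .T (Denotes.bind .T (hf.wk h _).iota hl')).congr_hom ?_⟩
    -- The only use of centrality. The remaining goal is a reassociation of the weakened denotation
    -- of `ι M`.
    refine Eq.trans ?_ (M.T.bind_comm (M.central _) f g l).symm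
    exact congrArg (fun t => M.T.bind g (M.T.bind t _)) (Category.assoc _ _ _)
  | iota_eq e _ ih =>
    obtain ⟨f, hf, hf'⟩ := ih
    exact ⟨_, hf.iota, (iota_congr (semTy_eq e) _ _).symm.trans hf'.iota⟩
  | iota_mono h h' _ ih =>
    obtain ⟨f, hf⟩ := Denotes.exists_of_hasType h
    obtain ⟨g, hg⟩ := Denotes.exists_of_hasType h'
    obtain ⟨l, hl, hl'⟩ := ih
    have e := (Denotes.iota hf).unique hl
    have e' := (Denotes.iota hg).unique hl'
    have := M.mono_ι
    -- The only use of the components of `ι` being monic.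
    have e'' : f = g := (cancel_mono (M.ι.app _)).mp (e.trans e'.symm)
    exact ⟨f, hf, e'' ▸ hg⟩
  | iota_bind h h' =>
    obtain ⟨f, hf⟩ := Denotes.exists_of_hasType h
    obtain ⟨g, hg⟩ := Denotes.exists_of_hasType h'
    exact ⟨_, hf.iota.bind .T hg.iota, (hf.bind .S hg).iota.congr_hom (M.ι.bind_app f g).symm⟩
  | iota_ret h =>
    obtain ⟨f, hf⟩ := Denotes.exists_of_hasType h
    refine ⟨_, (hf.ret .S).iota, (hf.ret .T).congr_hom ?_⟩
    refine Eq.trans ?_ (Category.assoc _ _ _).symm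
    exact congrArg (f ≫ ·) (M.ι.app_η _).symm

theorem sem_eq_of_eqTm {Γ L N A} (h : M.internalLanguage.EqTm Γ L N A)
    (hL : M.langSig.HasType Γ L A) (hN : M.langSig.HasType Γ N A) : sem hL = sem hN := by
  obtain ⟨f, hf, hf'⟩ := denotes_of_eqTm h
  exact (hf.sem_eq hL).trans (hf'.sem_eq hN).symm

/-! ### Interpretation of terms with one free variable -/

open Theory

/-- The interpretation of a term with one free variable. -/
noncomputable def semHom {A B : Ty M.langSig.G} {L} (h : M.langSig.HasType [A] L B) :
    M.semTy A ⟶ M.semTy B :=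
  lift (toUnit _) (𝟙 _) ≫ sem h

/-- A context with one type is interpreted as `𝟙_ ⊗ ⟦A⟧`. The isomorphism with `⟦A⟧` is `snd`, with
inverse `lift (toUnit _) (𝟙 _)`. -/
theorem denotes_semHom {A B : Ty M.langSig.G} {L} (h : M.langSig.HasType [A] L B) :
    Denotes [A] L (snd (𝟙_ M.C) (M.semTy A) ≫ semHom h) := by
  refine Denotes.congr_hom (semTm_eq h) ?_
  have e : snd (𝟙_ M.C) (M.semTy A) ≫ lift (toUnit _) (𝟙 _) = 𝟙 _ := by
    ext; simp
  exact ((congrArg (· ≫ sem h) e).trans (Category.id_comp _)).symm.trans (Category.assoc _ _ _)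

theorem semHom_eq {A B : Ty M.langSig.G} {L} (h : M.langSig.HasType [A] L B)
    {f : M.semTy A ⟶ M.semTy B} (hf : Denotes [A] L (snd (𝟙_ M.C) (M.semTy A) ≫ f)) :
    semHom h = f :=
  (congrArg (lift (toUnit _) (𝟙 _) ≫ ·) (hf.sem_eq h)).trans
    ((Category.assoc _ _ _).symm.trans ((congrArg (· ≫ f) (lift_snd _ _)).trans
      (Category.id_comp f)))

theorem denotes_weaken {A B : Ty M.langSig.G} {L} (h : M.langSig.HasType [A] L B) (Γ) :
    Denotes (A :: Γ) L (snd (M.semCtx Γ) (M.semTy A) ≫ semHom h) := by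
  have hs : DenotesSubst (A :: Γ) .var [A] (lift (toUnit _) (snd (M.semCtx Γ) (M.semTy A))) :=
    (denotesSubst_nil (A :: Γ) _).cons (.var rfl) .var_zero
  have := (denotes_semHom h).subst h hs
  rw [Tm.subst_var] at this
  exact this.congr_hom (lift_snd_assoc _ _ _)

theorem semHom_eq_of_eqTm {A B : Ty M.langSig.G} {L N}
    (e : M.internalLanguage.EqTm [A] L N B) (h : M.langSig.HasType [A] L B)
    (h' : M.langSig.HasType [A] N B) : semHom h = semHom h' := by
  exact congrArg (lift (toUnit _) (𝟙 _) ≫ ·) (sem_eq_of_eqTm e h h')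

/-- Completeness: valid equalities are axioms of the internal language. -/
theorem eqTm_of_semHom_eq {A B : Ty M.langSig.G} {L N} (h : M.langSig.HasType [A] L B)
    (h' : M.langSig.HasType [A] N B) (e : semHom h = semHom h') :
    M.internalLanguage.EqTm [A] L N B :=
  .ax ⟨h, h', Denotes.sem_eq h ((denotes_semHom h).congr_hom (e ▸ (Denotes.sem_eq h'
    (denotes_semHom h')).symm))⟩

/-- A morphism of the syntactic category is represented by judgements at different, provably equal
types. This comparison makes its interpretation independent of the representative. -/
theorem semHom_conv {A A' B B' : Ty M.langSig.G} {L} (e : M.semTy A = M.semTy A')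
    (e' : M.semTy B = M.semTy B') (h : M.langSig.HasType [A] L B)
    (h' : M.langSig.HasType [A'] L B') :
    semHom h = eqToHom e ≫ semHom h' ≫ eqToHom e'.symm := by
  have hL := (Denotes.conv_ctx e h (denotes_semHom h)).symm.trans (denotes_semHom h')
  have key : ∀ {X X' Y Y' : M.C} (e : X = X') (e' : Y = Y') (f : X ⟶ Y) (f' : X' ⟶ Y'),
      (⟨Y, eqToHom (congrArg (𝟙_ M.C ⊗ ·) e.symm) ≫ snd (𝟙_ M.C) X ≫ f⟩ :
        Σ Y : M.C, (𝟙_ M.C ⊗ X' ⟶ Y)) =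
        ⟨Y', snd (𝟙_ M.C) X' ≫ f'⟩ → f = eqToHom e ≫ f' ≫ eqToHom e'.symm := by
    intro X X' Y Y' e e' f f' h
    subst e e'
    have h' : snd (𝟙_ M.C) X ≫ f = snd (𝟙_ M.C) X ≫ f' := by simpa using h
    simpa using congrArg (lift (toUnit X) (𝟙 X) ≫ ·) h'
  exact key e e' _ _ (Option.some.inj hL)

theorem semHom_var {A : Ty M.langSig.G} (h : M.langSig.HasType [A] (.var 0) A) :
    semHom h = 𝟙 (M.semTy A) :=
  semHom_eq h (Denotes.var_zero.congr_hom (Category.comp_id _).symm)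

theorem semHom_subst {A B D : Ty M.langSig.G} {L N} (hL : M.langSig.HasType [A] L B)
    (hN : M.langSig.HasType [B] N D) (h : M.langSig.HasType [A] (N.subst fun _ => L) D) :
    semHom h = semHom hL ≫ semHom hN := by
  have hs : DenotesSubst [A] (fun _ => L) [B] (lift (toUnit _) (snd (𝟙_ M.C) _ ≫ semHom hL)) :=
    (denotesSubst_nil [A] _).cons hL (denotes_semHom hL)
  exact semHom_eq h (((denotes_semHom hN).subst hN hs).congr_hom
    ((lift_snd_assoc _ _ _).trans (Category.assoc _ _ _)))

/-- This and the lemmas up to `semHom_ι` compute the terms that define the structure of the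
syntactic model. They are the reason why `interp` preserves that structure strictly. -/
theorem semHom_fst {A B : Ty M.langSig.G}
    (h : M.langSig.HasType [.prod A B] (.fst A B (.var 0)) A) :
    semHom h = fst (M.semTy A) (M.semTy B) :=
  semHom_eq h Denotes.var_zero.fst

theorem semHom_snd {A B : Ty M.langSig.G}
    (h : M.langSig.HasType [.prod A B] (.snd A B (.var 0)) B) :
    semHom h = snd (M.semTy A) (M.semTy B) :=
  semHom_eq h Denotes.var_zero.snd

theorem semHom_ev {A B : Ty M.langSig.G}
    (h : M.langSig.HasType [.prod A (.arr A B)] (.app A B (.snd A (.arr A B) (.var 0))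
      (.fst A (.arr A B) (.var 0))) B) :
    semHom h = (ihom.ev (M.semTy A)).app (M.semTy B) := by
  refine semHom_eq h ((Denotes.var_zero.snd.app (B := B) Denotes.var_zero.fst).congr_hom ?_)
  exact congrArg (· ≫ (ihom.ev (M.semTy A)).app (M.semTy B)) (lift_comp_fst_snd _)

theorem semHom_map (e : Eff) {A B : Ty M.langSig.G} {L} (hL : M.langSig.HasType [A] L B)
    (h : M.langSig.HasType [.mon e A] (.bind e A B (.var 0) (.ret e L)) (.mon e B)) :
    semHom h = (M.mon e).map (semHom hL) := by
  refine semHom_eq h ((Denotes.var_zero.bind e ((denotes_weaken hL _).ret e)).congr_hom ?_)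
  refine ((M.mon e).bind_η_map _ (snd _ _) _).symm.trans ?_
  exact congrArg (· ≫ (M.mon e).map (semHom hL)) ((M.mon e).bind_snd_η _)

theorem semHom_η (e : Eff) {A : Ty M.langSig.G}
    (h : M.langSig.HasType [A] (.ret e (.var 0)) (.mon e A)) :
    semHom h = (M.mon e).η.app (M.semTy A) :=
  semHom_eq h (Denotes.var_zero.ret e)

theorem semHom_μ (e : Eff) {A : Ty M.langSig.G}
    (h : M.langSig.HasType [.mon e (.mon e A)] (.bind e (.mon e A) A (.var 0) (.var 0))
      (.mon e A)) :
    semHom h = (M.mon e).μ.app (M.semTy A) := by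
  refine semHom_eq h ((Denotes.var_zero.bind e Denotes.var_zero).congr_hom ?_)
  -- With an identity as continuation, `bind_map_μ` exhibits sequencing of a variable with itself as
  -- `μ`.
  have := (M.mon e).bind_map_μ (snd (𝟙_ M.C) ((M.mon e).obj ((M.mon e).obj (M.semTy A))))
    (snd _ _) (𝟙 _)
  rw [(M.mon e).bind_snd_η, Category.comp_id, (M.mon e).map_id, Category.id_comp] at this
  exact this.symm

theorem semHom_str (e : Eff) {A B : Ty M.langSig.G}
    (h : M.langSig.HasType [.prod A (.mon e B)] (.bind e B (.prod A B)
      (.snd A (.mon e B) (.var 0)) (.ret e (.pair (.fst A (.mon e B) (.var 1)) (.var 0))))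
      (.mon e (.prod A B))) :
    semHom h = (M.mon e).str (M.semTy A) (M.semTy B) := by
  have h₁ : Denotes [B, .prod A (.mon e B)] (.var 1) _ :=
    Denotes.var_succ (Denotes.var_zero (Γ := []) (A := .prod A (.mon e B)))
  refine semHom_eq h ((Denotes.var_zero.snd.bind e ((h₁.fst.pair .var_zero).ret e)).congr_hom ?_)
  have := (M.mon e).lift_str (snd (𝟙_ M.C) (M.semTy A ⊗ (M.mon e).obj (M.semTy B)) ≫ fst _ _)
    (snd (𝟙_ M.C) (M.semTy A ⊗ (M.mon e).obj (M.semTy B)) ≫ snd _ _)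
  rw [lift_comp_fst_snd] at this
  refine Eq.trans ?_ this.symm
  refine congrArg (fun t => (M.mon e).bind _ (t ≫ _)) ?_
  refine CartesianMonoidalCategory.hom_ext _ _ ?_ ?_
  · exact (lift_fst _ _).trans ((Category.assoc _ _ _).trans (whiskerRight_fst _ _).symm)
  · exact (lift_snd _ _).trans (whiskerRight_snd _ _).symm

theorem semHom_ι {A : Ty M.langSig.G}
    (h : M.langSig.HasType [.mon .S A] (.iota A (.var 0)) (.mon .T A)) :
    semHom h = M.ι.app (M.semTy A) :=
  semHom_eq h (Denotes.iota Denotes.var_zero)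

/-! open Theory
# From the syntactic model of the internal language to the model -/

/-- The object interpreting a class of types. -/
def interpObj : Obj M.internalLanguage → M.C :=
  Quotient.lift M.semTy fun _ _ h => semTy_eq h

theorem interpObj_eq {A : Ty M.langSig.G} {X : Obj M.internalLanguage} (h : Obj.cls A = X) :
    M.semTy A = interpObj X :=
  congrArg interpObj h

/-- The interpretation of morphisms of the syntactic category. -/
noncomputable def interpMap {X Y : Obj M.internalLanguage} :
    (X ⟶ Y) → (interpObj X ⟶ interpObj Y) :=
  Quotient.lift
    (fun j : Judgement X Y => eqToHom (interpObj_eq j.dom_eq).symm ≫ semHom j.typed ≫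
      eqToHom (interpObj_eq j.cod_eq))
    (fun j j' h => by
      have e := (interpObj_eq j.dom_eq).trans (interpObj_eq j'.dom_eq).symm
      have e' := (interpObj_eq j.cod_eq).trans (interpObj_eq j'.cod_eq).symm
      -- The provable equality holds at the types of `j`; `semHom_conv` then passes to the types of
      -- `j'`.
      have h₁ := semHom_eq_of_eqTm h j.typed h.typed.2
      have h₂ := semHom_conv e e' h.typed.2 j'.typed
      rw [h₁, h₂]
      simp)

theorem interpMap_hom {A B : Ty M.langSig.G} {L} (h : M.langSig.HasType [A] L B) :
    interpMap (hom (P := M.internalLanguage) L h) = semHom h :=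
  (Category.id_comp _).trans (Category.comp_id _)

variable (M) in
/-- The functor from the syntactic category of the internal language given by the
interpretation. -/
noncomputable def interp : Obj M.internalLanguage ⥤ M.C where
  obj := interpObj
  map := interpMap
  map_id X := by
    induction X using Obj.ind with | _ A
    exact (congrArg interpMap (id_hom A)).trans ((interpMap_hom _).trans (semHom_var _))
  map_comp {X Y Z} f g := by
    induction X using Obj.ind with | _ A
    induction Y using Obj.ind with | _ B
    induction Z using Obj.ind with | _ D
    obtain ⟨f, hf, rfl⟩ := exists_hom f
    obtain ⟨g, hg, rfl⟩ := exists_hom g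
    exact (congrArg interpMap (comp_hom hf hg)).trans ((interpMap_hom _).trans
      ((semHom_subst hf hg _).trans
        (congrArg₂ (· ≫ ·) (interpMap_hom hf).symm (interpMap_hom hg).symm)))

theorem interp_map_hom {A B : Ty M.langSig.G} {L} (h : M.langSig.HasType [A] L B) :
    (interp M).map (hom (P := M.internalLanguage) L h) = semHom h :=
  interpMap_hom h

/-- Completeness in categorical form. From here on, equations in the syntactic category of the
internal language are checked in the model. -/
instance : (interp M).Faithful where
  map_injective {X Y} f g h := by
    induction X using Obj.ind with | _ A
    induction Y using Obj.ind with | _ B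
    obtain ⟨f, hf, rfl⟩ := exists_hom f
    obtain ⟨g, hg, rfl⟩ := exists_hom g
    exact hom_eq (eqTm_of_semHom_eq hf hg
      ((interpMap_hom hf).symm.trans (Eq.trans h (interpMap_hom hg))))

/-- On classes of explicit types the comparison morphisms of `ModelHom` join definitionally equal
objects. This lemma and the next absorb them. -/
theorem eq_eqToHom_comp {C : Type u} [Category.{v} C] {X Y : C} {f g : X ⟶ Y} (h : f = g)
    (e : X = X) : f = eqToHom e ≫ g := by
  simp [h]

theorem eq_comp_eqToHom {C : Type u} [Category.{v} C] {X Y : C} {f g : X ⟶ Y} (h : f = g)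
    (e : Y = Y) : f = g ≫ eqToHom e := by
  simp [h]

/-- Heterogeneous, because for a class that is not given by an explicit type the two sides do not
have definitionally equal domains and codomains. -/
theorem interp_map_monMap (e : Eff) {X Y : Obj M.internalLanguage} (f : X ⟶ Y) :
    HEq ((interp M).map (monMap e f)) ((M.mon e).map ((interp M).map f)) := by
  induction X using Obj.ind with | _ A
  induction Y using Obj.ind with | _ B
  obtain ⟨f, hf, rfl⟩ := exists_hom f
  exact heq_of_eq ((interp_map_hom (hasType_map e hf)).trans ((semHom_map e hf _).trans
    (congrArg (M.mon e).map (interp_map_hom hf).symm)))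

variable (M) in
/-- The morphism of models given by the interpretation. -/
noncomputable def interpHom : ModelHom (syntacticModel M.internalLanguage) M where
  F := interp M
  obj_unit := rfl
  obj_prod X Y := by
    induction X using Obj.ind with | _ A
    induction Y using Obj.ind with | _ B
    rfl
  map_fst X Y := by
    induction X using Obj.ind with | _ A
    induction Y using Obj.ind with | _ B
    exact eq_eqToHom_comp ((congrArg (interp M).map (fstHom_hom A B)).trans
      ((interp_map_hom _).trans (semHom_fst _))) rfl
  map_snd X Y := by
    induction X using Obj.ind with | _ A
    induction Y using Obj.ind with | _ B
    exact eq_eqToHom_comp ((congrArg (interp M).map (sndHom_hom A B)).trans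
      ((interp_map_hom _).trans (semHom_snd _))) rfl
  obj_exp X Y := by
    induction X using Obj.ind with | _ A
    induction Y using Obj.ind with | _ B
    rfl
  map_ev X Y := by
    induction X using Obj.ind with | _ A
    induction Y using Obj.ind with | _ B
    exact eq_eqToHom_comp ((congrArg (interp M).map ((ihom_ev_def _ _).trans (evHom_hom A B))).trans
      ((interp_map_hom _).trans (semHom_ev _))) rfl
  obj_mon e X := by
    induction X using Obj.ind with | _ A
    -- `Model.mon` unfolds only on a constructor; the case splits on `e` below have the same
    -- purpose.
    cases e <;> rfl
  map_map e X Y f := by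
    induction X using Obj.ind with | _ A
    induction Y using Obj.ind with | _ B
    cases e
    · exact eq_eqToHom_comp (eq_comp_eqToHom (eq_of_heq (interp_map_monMap .S f)) rfl) rfl
    · exact eq_eqToHom_comp (eq_comp_eqToHom (eq_of_heq (interp_map_monMap .T f)) rfl) rfl
  map_η e X := by
    induction X using Obj.ind with | _ A
    cases e
    · exact eq_comp_eqToHom ((congrArg (interp M).map (monUnit_hom .S A)).trans
        ((interp_map_hom _).trans (semHom_η _ _))) rfl
    · exact eq_comp_eqToHom ((congrArg (interp M).map (monUnit_hom .T A)).trans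
        ((interp_map_hom _).trans (semHom_η _ _))) rfl
  map_μ e X := by
    induction X using Obj.ind with | _ A
    cases e
    · exact eq_eqToHom_comp (eq_comp_eqToHom ((congrArg (interp M).map (monMult_hom .S A)).trans
        ((interp_map_hom _).trans (semHom_μ _ _))) rfl) rfl
    · exact eq_eqToHom_comp (eq_comp_eqToHom ((congrArg (interp M).map (monMult_hom .T A)).trans
        ((interp_map_hom _).trans (semHom_μ _ _))) rfl) rfl
  map_str e X Y := by
    induction X using Obj.ind with | _ A
    induction Y using Obj.ind with | _ B
    cases e
    · exact eq_eqToHom_comp (eq_comp_eqToHom ((congrArg (interp M).map (monStr_hom .S A B)).trans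
        ((interp_map_hom _).trans (semHom_str _ _))) rfl) rfl
    · exact eq_eqToHom_comp (eq_comp_eqToHom ((congrArg (interp M).map (monStr_hom .T A B)).trans
        ((interp_map_hom _).trans (semHom_str _ _))) rfl) rfl
  map_ι X := by
    induction X using Obj.ind with | _ A
    exact eq_eqToHom_comp (eq_comp_eqToHom ((congrArg (interp M).map (iotaHom_hom A)).trans
      ((interp_map_hom _).trans (semHom_ι _))) rfl) rfl

/-! open Theory
# From the model to the syntactic model of its internal language -/

/-- The ground type of an object. -/
abbrev groundTy (X : M.C) : Ty M.langSig.G :=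
  Ty.ground (G := M.C) X

/-- The class of the ground type of an object. -/
def nameObj (X : M.C) : Obj M.internalLanguage :=
  Obj.cls (groundTy (M := M) X)

theorem hasType_name {X Y : M.C} (f : X ⟶ Y) : M.langSig.HasType [groundTy X]
    (.app (groundTy (M := M) X) (groundTy (M := M) Y) (.const ⟨X, Y, f⟩) (.var 0))
      (groundTy (M := M) Y) :=
  .app (.const (P := M.langSig) ⟨X, Y, f⟩) (.var rfl)

/-- The constant `c_f` denotes the currying of `f`, and evaluation undoes the currying. -/
theorem semHom_name {X Y : M.C} (f : X ⟶ Y) : semHom (hasType_name f) = f := by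
  refine semHom_eq _ (((Denotes.const f).app (A := groundTy (M := M) X) (B := groundTy (M := M) Y)
    Denotes.var_zero).congr_hom ?_)
  have e : lift (snd (𝟙_ M.C) X) (toUnit (𝟙_ M.C ⊗ X) ≫ MonoidalClosed.curry ((ρ_ X).hom ≫ f)) =
      lift (snd (𝟙_ M.C) X) (toUnit _) ≫ X ◁ MonoidalClosed.curry ((ρ_ X).hom ≫ f) := by
    ext <;> simp
  refine (congrArg (· ≫ (ihom.ev X).app Y) e).trans ((Category.assoc _ _ _).trans ?_)
  rw [← MonoidalClosed.uncurry_eq, MonoidalClosed.uncurry_curry, rightUnitor_hom,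
    lift_fst_assoc]
  rfl

/-- The morphism of the syntactic category named by a morphism of the model. -/
noncomputable def nameMap {X Y : M.C} (f : X ⟶ Y) :
    (nameObj X : Obj M.internalLanguage) ⟶ nameObj Y :=
  hom _ (hasType_name f)

theorem interp_map_nameMap {X Y : M.C} (f : X ⟶ Y) : (interp M).map (nameMap f) = f :=
  (interp_map_hom _).trans (semHom_name f)

variable (M) in
/-- The functor from a model to the syntactic category of its internal language. -/
noncomputable def name : M.C ⥤ Obj M.internalLanguage where
  obj := nameObj
  map := nameMap
  -- Functoriality is reflected by the faithful functor `interp`, which sends `nameMap f` back to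
  -- `f`.
  map_id X := (interp M).map_injective
    ((interp_map_nameMap _).trans ((interp M).map_id (nameObj X)).symm)
  map_comp f g := (interp M).map_injective ((interp_map_nameMap _).trans
    (.trans (congrArg₂ (· ≫ ·) (interp_map_nameMap f).symm (interp_map_nameMap g).symm)
      ((interp M).map_comp _ _).symm))

theorem interp_map_name_map {X Y : M.C} (f : X ⟶ Y) : (interp M).map ((name M).map f) = f :=
  interp_map_nameMap f

/-- The preservation equations for `name` hold up to nontrivial equalities of objects. With `Z` and
`W` arbitrary these can be eliminated, and faithfulness of `interp` leaves an equation in the model.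
The next two lemmas are the one-sided versions. -/
theorem name_map_eq {X Y : M.C} {Z W : Obj M.internalLanguage} (e : (name M).obj X = Z)
    (e' : W = (name M).obj Y) (f : X ⟶ Y) (g : Z ⟶ W)
    (h : (interp M).map g = eqToHom (congrArg (interp M).obj e).symm ≫ f ≫
      eqToHom (congrArg (interp M).obj e').symm) :
    (name M).map f = eqToHom e ≫ g ≫ eqToHom e' := by
  refine (interp M).map_injective ((interp_map_name_map f).trans ?_)
  subst e e'
  rw [eqToHom_refl, eqToHom_refl, Category.id_comp, Category.comp_id, h]
  exact eq_eqToHom_comp (eq_comp_eqToHom rfl rfl) rfl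

theorem name_map_eq_left {X Y : M.C} {Z : Obj M.internalLanguage} (e : (name M).obj X = Z)
    (f : X ⟶ Y) (g : Z ⟶ (name M).obj Y)
    (h : (interp M).map g = eqToHom (congrArg (interp M).obj e).symm ≫ f) :
    (name M).map f = eqToHom e ≫ g := by
  refine (interp M).map_injective ((interp_map_name_map f).trans ?_)
  subst e
  rw [eqToHom_refl, Category.id_comp, h]
  exact eq_eqToHom_comp rfl rfl

theorem name_map_eq_right {X Y : M.C} {W : Obj M.internalLanguage}
    (e : W = (name M).obj Y) (f : X ⟶ Y) (g : (name M).obj X ⟶ W)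
    (h : (interp M).map g = f ≫ eqToHom (congrArg (interp M).obj e).symm) :
    (name M).map f = g ≫ eqToHom e := by
  refine (interp M).map_injective ((interp_map_name_map f).trans ?_)
  subst e
  rw [eqToHom_refl, Category.comp_id, h]
  exact eq_comp_eqToHom rfl rfl

variable (M) in
/-- The morphism of models that names objects and morphisms. -/
noncomputable def nameHom : ModelHom M (syntacticModel M.internalLanguage) where
  F := name M
  -- Preservation on the nose comes from the type axioms: a ground type and a compound type with the
  -- same interpretation are equal in the internal language.
  obj_unit := Obj.sound (P := M.internalLanguage) (A := groundTy (M := M) (𝟙_ M.C))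
    (B := .unit) (.ax rfl)
  obj_prod X Y := Obj.sound (P := M.internalLanguage) (A := groundTy (M := M) (X ⊗ Y))
    (B := .prod (groundTy (M := M) X) (groundTy (M := M) Y)) (.ax rfl)
  map_fst X Y := name_map_eq_left _ _ (fstHom _ _) (eq_eqToHom_comp
    ((congrArg (interp M).map
      (fstHom_hom (P := M.internalLanguage) (groundTy X) (groundTy Y))).trans
      ((interp_map_hom _).trans (semHom_fst _))) rfl)
  map_snd X Y := name_map_eq_left _ _ (sndHom _ _) (eq_eqToHom_comp
    ((congrArg (interp M).map
      (sndHom_hom (P := M.internalLanguage) (groundTy X) (groundTy Y))).trans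
      ((interp_map_hom _).trans (semHom_snd _))) rfl)
  obj_exp X Y := Obj.sound (P := M.internalLanguage) (A := groundTy (M := M) ((ihom X).obj Y))
    (B := .arr (groundTy (M := M) X) (groundTy (M := M) Y)) (.ax rfl)
  map_ev X Y := name_map_eq_left _ _ ((ihom.ev (nameObj X)).app (nameObj Y)) (eq_eqToHom_comp
    ((congrArg (interp M).map ((ihom_ev_def _ _).trans
      (evHom_hom (P := M.internalLanguage) (groundTy X) (groundTy Y)))).trans
      ((interp_map_hom _).trans (semHom_ev _))) rfl)
  obj_mon e X := by
    cases e
    · exact Obj.sound (P := M.internalLanguage) (A := groundTy (M := M) ((M.mon .S).obj X))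
        (B := .mon .S (groundTy (M := M) X)) (.ax rfl)
    · exact Obj.sound (P := M.internalLanguage) (A := groundTy (M := M) ((M.mon .T).obj X))
        (B := .mon .T (groundTy (M := M) X)) (.ax rfl)
  map_map e X Y f := by
    -- `interp` of the syntactic structure map at named objects is the structure map of the model;
    -- the fields below follow the same pattern.
    have key : ∀ e, (interp M).map (monMap e ((name M).map f)) = (M.mon e).map f := fun e =>
      ((interp_map_hom (hasType_map (P := M.internalLanguage) e (hasType_name f))).trans
        ((semHom_map e (hasType_name f) _).trans
        (congrArg (M.mon e).map (semHom_name f))))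
    cases e
    · exact name_map_eq _ _ _ (monMap .S _) (eq_eqToHom_comp (eq_comp_eqToHom (key .S) rfl) rfl)
    · exact name_map_eq _ _ _ (monMap .T _) (eq_eqToHom_comp (eq_comp_eqToHom (key .T) rfl) rfl)
  map_η e X := by
    have key : ∀ e, (interp M).map (monUnit e (nameObj X)) = (M.mon e).η.app X := fun e =>
      (congrArg (interp M).map (monUnit_hom (P := M.internalLanguage) e (groundTy X))).trans
        ((interp_map_hom _).trans (semHom_η _ _))
    cases e
    · exact name_map_eq_right _ _ (monUnit .S _) (eq_comp_eqToHom (key .S) rfl)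
    · exact name_map_eq_right _ _ (monUnit .T _) (eq_comp_eqToHom (key .T) rfl)
  map_μ e X := by
    have key : ∀ e, (interp M).map (monMult e (nameObj X)) = (M.mon e).μ.app X := fun e =>
      (congrArg (interp M).map (monMult_hom (P := M.internalLanguage) e (groundTy X))).trans
        ((interp_map_hom _).trans (semHom_μ _ _))
    cases e
    · exact name_map_eq _ _ _ (monMult .S _) (eq_eqToHom_comp (eq_comp_eqToHom (key .S) rfl) rfl)
    · exact name_map_eq _ _ _ (monMult .T _) (eq_eqToHom_comp (eq_comp_eqToHom (key .T) rfl) rfl)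
  map_str e X Y := by
    have key : ∀ e, (interp M).map (monStr e (nameObj X) (nameObj Y)) = (M.mon e).str X Y :=
      fun e => (congrArg (interp M).map
        (monStr_hom (P := M.internalLanguage) e (groundTy X) (groundTy Y))).trans
        ((interp_map_hom _).trans (semHom_str _ _))
    cases e
    · exact name_map_eq _ _ _ (monStr .S _ _) (eq_eqToHom_comp (eq_comp_eqToHom (key .S) rfl) rfl)
    · exact name_map_eq _ _ _ (monStr .T _ _) (eq_eqToHom_comp (eq_comp_eqToHom (key .T) rfl) rfl)
  map_ι X := name_map_eq _ _ _ (iotaHom _) (eq_eqToHom_comp (eq_comp_eqToHom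
    ((congrArg (interp M).map (iotaHom_hom (P := M.internalLanguage) (groundTy X))).trans
      ((interp_map_hom _).trans (semHom_ι _))) rfl) rfl)

/-- A type and the ground type of its interpretation are equal by a type axiom. -/
theorem nameObj_interpObj (X : Obj M.internalLanguage) : nameObj (interpObj X) = X := by
  induction X using Obj.ind with | _ A
  exact Obj.sound (P := M.internalLanguage) (A := groundTy (M := M) (M.semTy A)) (B := A)
    (.ax rfl)

/-- Every model is equivalent to the syntactic model of its internal language. -/
theorem equivalent_syntacticModel (M : Model.{u, v}) :
    M.Equivalent (syntacticModel M.internalLanguage) := by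
  refine ⟨nameHom M, interpHom M, ⟨?_⟩, ⟨?_⟩⟩
  -- The components are identities up to equality of objects. Naturality is checked after `interp`,
  -- where they become trivial.
  · refine NatIso.ofComponents (F := interp M ⋙ name M) (G := 𝟭 _)
      (fun X => eqToIso (nameObj_interpObj X)) fun {X Y} f => ?_
    refine (interp M).map_injective (((interp M).map_comp _ _).trans
      (.trans ?_ ((interp M).map_comp _ _).symm))
    refine (congrArg (_ ≫ ·) (eqToHom_map (interp M) (nameObj_interpObj Y))).trans
      (.trans ?_ (congrArg (· ≫ _) (eqToHom_map (interp M) (nameObj_interpObj X))).symm)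
    have e := interp_map_name_map ((interp M).map f)
    induction X using Obj.ind with | _ A
    induction Y using Obj.ind with | _ B
    exact (Category.comp_id _).trans (e.trans (Category.id_comp _).symm)
  -- This composite fixes objects definitionally and morphisms by `interp_map_name_map`.
  · exact NatIso.ofComponents (F := 𝟭 _) (G := name M ⋙ interp M) (fun X => Iso.refl X)
      fun {X Y} f => (Category.comp_id _).trans
        ((interp_map_name_map f).symm.trans (Category.id_comp _).symm)

end Model

namespace Theory

variable {P : Theory.{g, k}}

/-! open Theory
# Congruence of substitution -/

theorem EqTm.up {Δ Γ : List (Ty P.G)} {s t : ℕ → Tm P.G P.K}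
    (h : ∀ n A, Γ[n]? = some A → P.EqTm Δ (s n) (t n) A) (B : Ty P.G) :
    ∀ n A, (B :: Γ)[n]? = some A → P.EqTm (B :: Δ) (Tm.up s n) (Tm.up t n) A := by
  intro n A hn
  cases n with
  | zero => exact .refl (.var hn)
  | succ n =>
    have := (h n A hn).subst (Δ := B :: Δ) (s := fun n => .var n.succ) fun m C hm => .var hm
    have e : ∀ M : Tm P.G P.K, M.subst (fun n => .var n.succ) = M.wk := fun M =>
      ((Tm.subst_var _).symm.trans (Tm.subst_rename _ _ _)).symm
    rwa [e, e] at this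

/-- Substitution preserves provable equality of the substituted terms. -/
theorem EqTm.subst_congr {Γ M A} (h : P.HasType Γ M A) : ∀ {Δ} {s t : ℕ → Tm P.G P.K},
    (∀ n A, Γ[n]? = some A → P.EqTm Δ (s n) (t n) A) →
      P.EqTm Δ (M.subst s) (M.subst t) A := by
  induction h with
  | var h => intro Δ s t hs; exact hs _ _ h
  | const c => intro Δ s t hs; exact .refl (.const c)
  | star => intro Δ s t hs; exact .refl .star
  | lam _ ih => intro Δ s t hs; exact .lam_eq (.refl _) (ih (.up hs _))
  | app _ _ ih₁ ih₂ => intro Δ s t hs; exact .app_eq (.refl _) (.refl _) (ih₁ hs) (ih₂ hs)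
  | pair _ _ ih₁ ih₂ => intro Δ s t hs; exact .pair_eq (ih₁ hs) (ih₂ hs)
  | fst _ ih => intro Δ s t hs; exact .fst_eq (.refl _) (.refl _) (ih hs)
  | snd _ ih => intro Δ s t hs; exact .snd_eq (.refl _) (.refl _) (ih hs)
  | ret X _ ih => intro Δ s t hs; exact .ret_eq X (ih hs)
  | iota _ ih => intro Δ s t hs; exact .iota_eq (.refl _) (ih hs)
  | bind _ _ ih₁ ih₂ =>
    intro Δ s t hs
    exact .bind_eq _ (.refl _) (.refl _) (ih₁ hs) (ih₂ (.up hs _))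
  | conv e _ ih => intro Δ s t hs; exact .conv e (ih hs)

/-! open Theory
# Contexts as product types -/

/-- The product of the types of a context. -/
def ctxTy : List (Ty P.G) → Ty P.G
  | [] => .unit
  | A :: Γ => .prod (ctxTy Γ) A

/-- The projections from the product of a context, as a substitution. -/
def projs : List (Ty P.G) → ℕ → Tm P.G P.K
  -- A default value for indices outside the context.
  | [], _ => .star
  | A :: Γ, 0 => .snd (ctxTy Γ) A (.var 0)
  | A :: Γ, n + 1 => (projs Γ n).subst fun _ => .fst (ctxTy Γ) A (.var 0)

/-- The tuple of the variables of a context. -/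
def tuple : List (Ty P.G) → Tm P.G P.K
  | [] => .star
  | _ :: Γ => .pair (tuple Γ).wk (.var 0)

theorem hasSubst_projs : ∀ Γ : List (Ty P.G), P.HasSubst [ctxTy Γ] (projs Γ) Γ
  | [], _, _, hn => nomatch hn
  | A :: Γ, 0, B, hn => by
    obtain rfl : A = B := by simpa using hn
    exact .snd (.var rfl)
  | _ :: Γ, n + 1, B, hn => (hasSubst_projs Γ n B hn).subst' (.fst (.var rfl))

theorem hasType_tuple : ∀ Γ : List (Ty P.G), P.HasType Γ (tuple Γ) (ctxTy Γ)
  | [] => .star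
  | A :: Γ => .pair ((hasType_tuple Γ).wk A) (.var rfl)

/-- Packing a context into a product and unpacking it again is the identity up to `β`. Hence nothing
is lost when terms are compared after substitution of `projs`. -/
theorem projs_tuple : ∀ (Γ : List (Ty P.G)) n A, Γ[n]? = some A →
    P.EqTm Γ ((projs Γ n).subst fun _ => tuple Γ) (.var n) A
  | [], _, _, hn => nomatch hn
  | A :: Γ, 0, B, hn => by
    obtain rfl : A = B := by simpa using hn
    exact .snd_beta ((hasType_tuple Γ).wk A) (.var rfl)
  | A :: Γ, n + 1, B, hn => by
    have h := hasSubst_projs Γ n B hn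
    have e : ((projs Γ n).subst fun _ => .fst (ctxTy Γ) A (.var 0)).subst
        (fun _ => tuple (A :: Γ)) =
        (projs Γ n).subst fun _ => .fst (ctxTy Γ) A (.pair (tuple Γ).wk (.var 0)) :=
      Tm.subst_subst _ _ _
    have h₁ : P.EqTm (A :: Γ) _ _ B := (EqTm.refl h).comp
      (.fst_beta ((hasType_tuple Γ).wk A) (.var (n := 0) rfl))
    have h₂ := (projs_tuple Γ n B hn).subst (Δ := A :: Γ) (s := fun n => .var n.succ)
      fun m C hm => .var hm
    have e' : ((projs Γ n).subst fun _ => tuple Γ).subst (fun n => .var n.succ) =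
        (projs Γ n).subst fun _ => (tuple Γ).wk := by
      refine (Tm.subst_subst _ _ _).trans (congrArg (fun t => (projs Γ n).subst fun _ => t) ?_)
      exact ((Tm.subst_var _).symm.trans (Tm.subst_rename _ _ _)).symm
    rw [e'] at h₂
    show P.EqTm _ (((projs Γ n).subst fun _ => .fst (ctxTy Γ) A (.var 0)).subst
        (fun _ => tuple (A :: Γ))) _ _
    rw [e]
    exact h₁.trans h₂

/-- Compares two ways to pack the context of the body of a binder: everything in one product, or the
bound variable kept apart. They agree up to `β` once the product is filled with the pair of the two
variables. -/
theorem projs_cons_pair (Γ : List (Ty P.G)) (A : Ty P.G) : ∀ n B, (A :: Γ)[n]? = some B →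
    P.EqTm [A, ctxTy Γ] ((projs (A :: Γ) n).subst fun _ => .pair (.var 1) (.var 0))
      (Tm.up (projs Γ) n) B
  | 0, B, hn => by
    obtain rfl : A = B := by simpa using hn
    exact .snd_beta (.var rfl) (.var rfl)
  | n + 1, B, hn => by
    have h := hasSubst_projs Γ n B hn
    have e : ((projs Γ n).subst fun _ => .fst (ctxTy Γ) A (.var 0)).subst
        (fun _ => .pair (.var 1) (.var 0)) =
        (projs Γ n).subst fun _ => .fst (ctxTy Γ) A (.pair (.var 1) (.var 0)) :=
      Tm.subst_subst _ _ _
    have e' : (projs Γ n).wk = (projs Γ n).subst fun _ => .var 1 := by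
      rw [← Tm.subst_var (projs Γ n).wk]
      exact (Tm.subst_rename _ _ _).trans (h.subst_one _)
    show P.EqTm _ (((projs Γ n).subst fun _ => .fst (ctxTy Γ) A (.var 0)).subst
        (fun _ => .pair (.var 1) (.var 0))) (projs Γ n).wk _
    rw [e, e']
    exact (EqTm.refl h).comp (.fst_beta (.var rfl) (.var rfl))

theorem EqTm.subst_projs_cons {Γ : List (Ty P.G)} {A B M} (h : P.HasType (A :: Γ) M B) :
    P.EqTm [A, ctxTy Γ] ((M.subst (projs (A :: Γ))).subst fun _ => .pair (.var 1) (.var 0))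
      (M.subst (Tm.up (projs Γ))) B := by
  rw [Tm.subst_subst]
  exact .subst_congr h (projs_cons_pair Γ A)

/-- Terms that agree after substitution of the projections from the product of the context are
provably equal. -/
theorem EqTm.of_subst_projs {Γ : List (Ty P.G)} {A M N} (hM : P.HasType Γ M A)
    (hN : P.HasType Γ N A) (h : P.EqTm [ctxTy Γ] (M.subst (projs Γ)) (N.subst (projs Γ)) A) :
    P.EqTm Γ M N A := by
  -- Substituting the tuple of variables undoes the substitution of the projections.
  have key : ∀ {M}, P.HasType Γ M A →
      P.EqTm Γ ((M.subst (projs Γ)).subst fun _ => tuple Γ) M A := by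
    intro M hM
    have := EqTm.subst_congr hM (projs_tuple Γ)
    rwa [Tm.subst_var, ← Tm.subst_subst] at this
  exact (key hM).symm.trans ((h.comp (.refl (hasType_tuple Γ))).trans (key hN))

/-! open Theory
# Representing terms of morphisms of the syntactic category -/

/-- The morphism `f` is the class of the judgement `x : A ⊢ M : B`. -/
def Represents (A B : Ty P.G) (M : Tm P.G P.K) {X Y : Obj P} (f : X ⟶ Y) : Prop :=
  ∃ (hA : Obj.cls A = X) (hB : Obj.cls B = Y) (h : P.HasType [A] M B), f = homOf A B hA hB M h

/-- Transposes are unique, so it is enough that the evaluation sends `curryHom f` back to `f`. -/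
theorem curry_def {X Y Z : Obj P} (f : X ⊗ Z ⟶ Y) : MonoidalClosed.curry f = curryHom f := by
  refine (MonoidalClosed.curry_eq_iff f (curryHom f)).mpr (.symm ?_)
  refine (MonoidalClosed.uncurry_eq (curryHom f)).trans ?_
  exact (congrArg₂ (· ≫ ·) (whiskerLeft_def X (curryHom f)) (ihom_ev_def X Y)).trans
    (uncurryHom_curryHom f)

namespace Represents

variable {A B C D : Ty P.G} {M N : Tm P.G P.K} {X Y Z : Obj P}

theorem of_hom (h : P.HasType [A] M B) : Represents A B M (hom M h) :=
  ⟨rfl, rfl, h, rfl⟩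

theorem congr {f : X ⟶ Y} (hf : Represents A B M f) (e : P.EqTm [A] M N B) :
    Represents A B N f := by
  obtain ⟨rfl, rfl, h, rfl⟩ := hf
  exact ⟨rfl, rfl, e.typed.2, hom_eq e⟩

/-- Equality of morphisms in the syntactic category is provable equality; this converts equal
denotations into equations of the theory. -/
theorem exact {f : X ⟶ Y} (hf : Represents A B M f) (hf' : Represents A B N f) :
    P.EqTm [A] M N B := by
  obtain ⟨rfl, rfl, h, rfl⟩ := hf
  obtain ⟨_, _, h', e⟩ := hf'
  exact hom_exact e

theorem unique {f f' : X ⟶ Y} (hf : Represents A B M f) (hf' : Represents A B M f') : f = f' := by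
  obtain ⟨rfl, rfl, h, rfl⟩ := hf
  obtain ⟨_, _, h', rfl⟩ := hf'
  rfl

theorem conv {f : X ⟶ Y} (hf : Represents A B M f) (e : P.TyEq B C) : Represents A C M f := by
  obtain ⟨rfl, rfl, h, rfl⟩ := hf
  exact ⟨rfl, (Obj.sound e).symm, .conv e h, (homOf_eq (.refl h)).symm⟩

/-- With the lemmas below, each operation used by the interpretation is matched with an operation on
representing terms. -/
theorem comp {f : X ⟶ Y} {g : Y ⟶ Z} (hf : Represents A B M f) (hg : Represents B C N g) :
    Represents A C (N.subst fun _ => M) (f ≫ g) := by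
  obtain ⟨rfl, rfl, h, rfl⟩ := hf
  obtain ⟨_, rfl, h', rfl⟩ := hg
  exact ⟨rfl, rfl, h'.subst' h, comp_hom h h'⟩

theorem fst (hA : Obj.cls A = X) (hB : Obj.cls B = Y) :
    Represents (.prod A B) A (.fst A B (.var 0)) (CartesianMonoidalCategory.fst X Y) := by
  subst hA hB
  exact ⟨rfl, rfl, .fst (.var rfl), fstHom_hom A B⟩

theorem snd (hA : Obj.cls A = X) (hB : Obj.cls B = Y) :
    Represents (.prod A B) B (.snd A B (.var 0)) (CartesianMonoidalCategory.snd X Y) := by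
  subst hA hB
  exact ⟨rfl, rfl, .snd (.var rfl), sndHom_hom A B⟩

theorem lift {f : Z ⟶ X} {g : Z ⟶ Y} (hf : Represents C A M f) (hg : Represents C B N g) :
    Represents C (.prod A B) (.pair M N) (CartesianMonoidalCategory.lift f g) := by
  obtain ⟨rfl, rfl, h, rfl⟩ := hf
  obtain ⟨_, rfl, h', rfl⟩ := hg
  exact ⟨rfl, rfl, .pair h h', lift_def _ _⟩

theorem toUnit (hA : Obj.cls A = X) :
    Represents A .unit .star (CartesianMonoidalCategory.toUnit X) := by
  subst hA
  exact ⟨rfl, rfl, .star, CartesianMonoidalCategory.toUnit_unique _ _⟩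

theorem ev (hA : Obj.cls A = X) (hB : Obj.cls B = Y) :
    Represents (.prod A (.arr A B)) B (.app A B (.snd A (.arr A B) (.var 0))
      (.fst A (.arr A B) (.var 0))) ((ihom.ev X).app Y) := by
  subst hA hB
  exact ⟨rfl, rfl, .app (.snd (.var rfl)) (.fst (.var rfl)),
    (ihom_ev_def _ _).trans (evHom_hom A B)⟩

theorem curry {f : X ⊗ Z ⟶ Y} (hA : Obj.cls A = X) (hC : Obj.cls C = Z)
    (hf : Represents (.prod A C) B M f) :
    Represents C (.arr A B) (.lam A (M.subst fun _ => .pair (.var 0) (.var 1)))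
      (MonoidalClosed.curry f) := by
  subst hA hC
  obtain ⟨_, rfl, h, rfl⟩ := hf
  exact ⟨rfl, rfl, .lam (h.subst' (hasType_pair A C [])), (curry_def _).trans (curryHom_hom h)⟩

theorem η (e : Eff) (hA : Obj.cls A = X) :
    Represents A (.mon e A) (.ret e (.var 0)) ((synMonad P e).η.app X) := by
  subst hA
  exact ⟨rfl, rfl, .ret e (.var rfl), monUnit_hom e A⟩

theorem ι (hA : Obj.cls A = X) :
    Represents (.mon .S A) (.mon .T A) (.iota A (.var 0)) (iotaHom X) := by
  subst hA
  exact ⟨rfl, rfl, .iota (.var rfl), iotaHom_hom A⟩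

/-- In the continuation the variable `0` is the result of `M` and `1` is the context, hence the pair
`⟨1, 0⟩`. The proof evaluates strength, functor and multiplication one after the other. -/
theorem bind (e : Eff) {f : Z ⟶ (synMonad P e).obj X} {g : Z ⊗ X ⟶ (synMonad P e).obj Y}
    (hA : Obj.cls A = X) (hB : Obj.cls B = Y)
    (hf : Represents C (.mon e A) M f) (hg : Represents (.prod C A) (.mon e B) N g) :
    Represents C (.mon e B) (.bind e A B M (N.subst fun _ => .pair (.var 1) (.var 0)))
      ((synMonad P e).bind f g) := by
  subst hA hB
  obtain ⟨rfl, _, h, rfl⟩ := hf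
  obtain ⟨_, _, h', rfl⟩ := hg
  have hp : P.HasType [A, C] (.pair (.var 1) (.var 0)) (.prod C A) :=
    .pair (.var rfl) (.var rfl)
  refine ⟨rfl, rfl, .bind h (h'.subst' hp), ?_⟩
  refine (congrArg (· ≫ _) ((lift_def _ _).trans (congrArg (fun t => pairHom t _)
    (id_hom C)))).trans ?_
  have l₁ := pair_str e (M := .var 0) (.var rfl) h
  have l₂ := (congrArg (· ≫ monMap e (hom N h')) l₁).trans (bindRet_map e h hp h')
  have l₃ := (congrArg (· ≫ monMult e (Obj.cls B)) l₂).trans (bindRet_mult e h (h'.subst' hp))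
  exact (comp_assoc4 _ _ _ _).trans l₃

end Represents

/-! open Theory
# From the internal language of the syntactic model to the theory -/

variable (P) in
/-- The internal language of the syntactic model. -/
noncomputable abbrev synLang : Theory.{g, max g k} := P.syntacticModel.internalLanguage

/-- The type given by a type of the internal language of the syntactic model. -/
noncomputable def reifyTy : Ty P.Obj → Ty P.G
  | .unit => .unit
  | .ground X => X.rep
  | .arr A B => .arr (reifyTy A) (reifyTy B)
  | .prod A B => .prod (reifyTy A) (reifyTy B)
  | .mon X A => .mon X (reifyTy A)

theorem cls_reifyTy : ∀ A : Ty P.Obj, Obj.cls (reifyTy A) = P.syntacticModel.semTy A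
  | .unit => rfl
  | .ground X => X.cls_rep
  | .arr A B => congrArg₂ Obj.arr (cls_reifyTy A) (cls_reifyTy B)
  | .prod A B => congrArg₂ Obj.prod (cls_reifyTy A) (cls_reifyTy B)
  | .mon .S A => congrArg (Obj.mon .S) (cls_reifyTy A)
  | .mon .T A => congrArg (Obj.mon .T) (cls_reifyTy A)

theorem cls_ctxTy_reifyTy : ∀ Γ : List (Ty P.Obj),
    Obj.cls (ctxTy (Γ.map reifyTy)) = P.syntacticModel.semCtx Γ
  | [] => rfl
  | A :: Γ => congrArg₂ Obj.prod (cls_ctxTy_reifyTy Γ) (cls_reifyTy A)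

/-- Objects of the syntactic model are types modulo provable equality, so equal interpretations mean
provably equal reified types. -/
theorem tyEq_reifyTy {A B : Ty P.Obj} (h : (synLang P).TyEq A B) :
    P.TyEq (reifyTy A) (reifyTy B) :=
  Obj.exact ((cls_reifyTy A).trans ((Model.semTy_eq h).trans (cls_reifyTy B).symm))

theorem exists_represents {X Y : Obj P} (f : X ⟶ Y) :
    ∃ t, P.HasType [X.rep] t Y.rep ∧ Represents X.rep Y.rep t f := by
  -- Generalised from the chosen representatives, since `X.rep` depends on `X` and the equation
  -- `X.cls_rep` cannot be eliminated.
  have key : ∀ {A B : Ty P.G} (hA : Obj.cls A = X) (hB : Obj.cls B = Y),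
      ∃ t, P.HasType [A] t B ∧ Represents A B t f := by
    intro A B hA hB
    subst hA hB
    obtain ⟨t, h, rfl⟩ := exists_hom f
    exact ⟨t, h, .of_hom h⟩
  exact key X.cls_rep Y.cls_rep

/-- A term representing a morphism of the syntactic category. -/
noncomputable def repTm {X Y : Obj P} (f : X ⟶ Y) : Tm P.G P.K :=
  (exists_represents f).choose

theorem hasType_repTm {X Y : Obj P} (f : X ⟶ Y) : P.HasType [X.rep] (repTm f) Y.rep :=
  (exists_represents f).choose_spec.1

theorem represents_repTm {X Y : Obj P} (f : X ⟶ Y) : Represents X.rep Y.rep (repTm f) f :=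
  (exists_represents f).choose_spec.2

/-- The term given by a term of the internal language of the syntactic model. -/
noncomputable def reifyTm : Tm P.Obj (Σ X Y : P.Obj, (X ⟶ Y)) → Tm P.G P.K
  | .var n => .var n
  | .const ⟨X, _, f⟩ => .lam X.rep (repTm f)
  | .star => .star
  | .lam A M => .lam (reifyTy A) (reifyTm M)
  | .app A B M N => .app (reifyTy A) (reifyTy B) (reifyTm M) (reifyTm N)
  | .pair M N => .pair (reifyTm M) (reifyTm N)
  | .fst A B M => .fst (reifyTy A) (reifyTy B) (reifyTm M)
  | .snd A B M => .snd (reifyTy A) (reifyTy B) (reifyTm M)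
  | .ret X M => .ret X (reifyTm M)
  | .iota A M => .iota (reifyTy A) (reifyTm M)
  | .bind X A B M N => .bind X (reifyTy A) (reifyTy B) (reifyTm M) (reifyTm N)

theorem getElem?_map_of_eq_some {α β : Type*} {l : List α} {n : ℕ} {a : α} (f : α → β)
    (h : l[n]? = some a) : (l.map f)[n]? = some (f a) := by
  simp [h]

theorem hasType_reifyTm {Γ L A} (h : (synLang P).HasType Γ L A) :
    P.HasType (Γ.map reifyTy) (reifyTm L) (reifyTy A) := by
  induction h with
  | var h => exact .var (getElem?_map_of_eq_some reifyTy h)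
  | const c => exact .lam ((hasType_repTm c.2.2).weaken _)
  | star => exact .star
  | lam _ ih => exact .lam ih
  | app _ _ ih₁ ih₂ => exact .app ih₁ ih₂
  | pair _ _ ih₁ ih₂ => exact .pair ih₁ ih₂
  | fst _ ih => exact .fst ih
  | snd _ ih => exact .snd ih
  | ret X _ ih => exact .ret X ih
  | iota _ ih => exact .iota ih
  | bind _ _ ih₁ ih₂ => exact .bind ih₁ ih₂
  | conv e _ ih => exact .conv (tyEq_reifyTy e) ih

open Model in
theorem exists_denotes_var : ∀ {Γ : List (Ty P.Obj)} {n A}, Γ[n]? = some A →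
    ∃ f : P.syntacticModel.semCtx Γ ⟶ P.syntacticModel.semTy A,
      Denotes (M := P.syntacticModel) Γ (.var n) f ∧
      Represents (ctxTy (Γ.map reifyTy)) (reifyTy A) (projs (Γ.map reifyTy) n) f
  | [], _, _, hn => nomatch hn
  | A :: Γ, 0, B, hn => by
    obtain rfl : A = B := Option.some.inj hn
    exact ⟨_, .var_zero, .snd (cls_ctxTy_reifyTy Γ) (cls_reifyTy A)⟩
  | A :: Γ, n + 1, B, hn => by
    obtain ⟨f, hf, hf'⟩ := exists_denotes_var (Γ := Γ) (n := n) (A := B) hn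
    exact ⟨_, Denotes.var_succ (M := P.syntacticModel) (A := A) hf,
      (Represents.fst (cls_ctxTy_reifyTy Γ) (cls_reifyTy A)).comp hf'⟩

open Model in
/-- The interpretation in the syntactic model of a term of its internal language is represented by
the corresponding term of the theory. -/
theorem exists_denotes {Γ L A} (h : (synLang P).HasType Γ L A) :
    ∃ f : P.syntacticModel.semCtx Γ ⟶ P.syntacticModel.semTy A,
      Denotes (M := P.syntacticModel) Γ L f ∧
      Represents (ctxTy (Γ.map reifyTy)) (reifyTy A)
        ((reifyTm L).subst (projs (Γ.map reifyTy))) f := by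
  have proj : ∀ {Γ L A}, (synLang P).HasType Γ L A → P.HasType [ctxTy (Γ.map reifyTy)]
      ((reifyTm L).subst (projs (Γ.map reifyTy))) (reifyTy A) :=
    fun h => (hasType_reifyTm h).subst (hasSubst_projs _)
  induction h with
  | var h => exact exists_denotes_var h
  | @const Γ c =>
    obtain ⟨X, Y, f⟩ := c
    refine ⟨_, .const f, ?_⟩
    have h := hasType_repTm f
    -- The constant denotes the currying of `f` precomposed with the projection from `X × 1`. One
    -- `β` step for this projection turns the representing term into `λ x. repTm f`.
    have hf := (Represents.fst X.cls_rep (B := .unit) rfl).comp (represents_repTm f)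
    refine Represents.congr ((Represents.toUnit (cls_ctxTy_reifyTy Γ)).comp
      (Represents.curry X.cls_rep rfl (by
        rw [CartesianMonoidalCategory.rightUnitor_hom]
        exact hf))) ?_
    refine .lam_eq (.refl _) ?_
    rw [Tm.subst_subst, Tm.subst_subst, h.subst_id (Tm.up (projs _)) rfl]
    have := (EqTm.refl h).comp (.fst_beta (Γ := [X.rep, ctxTy (Γ.map reifyTy)])
      (M := .var 0) (N := .star) (B := .unit) (.var rfl) .star)
    rwa [h.subst_zero] at this
  | star => exact ⟨_, .star, .toUnit (cls_ctxTy_reifyTy _)⟩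
  | @lam Γ A B L hL ih =>
    obtain ⟨f, hf, hf'⟩ := ih
    refine ⟨_, hf.lam, ?_⟩
    have hA := cls_reifyTy A
    have hΓ := cls_ctxTy_reifyTy Γ
    have hL' := hasType_reifyTm hL
    -- The `swap` in the interpretation of an abstraction is represented by the pair of projections
    -- in reverse order. After `β`, the body agrees with the substitution under the binder by
    -- `EqTm.subst_projs_cons`.
    refine Represents.congr (Represents.curry hA hΓ
      (((Represents.snd hA hΓ).lift (Represents.fst hA hΓ)).comp hf')) ?_
    refine .lam_eq (.refl _) (.trans ?_ (.subst_projs_cons hL'))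
    rw [Tm.subst_subst _ (fun _ => _) (fun _ => _)]
    exact (EqTm.refl (proj hL)).comp (.pair_eq (.snd_beta (.var rfl) (.var rfl))
      (.fst_beta (.var rfl) (.var rfl)))
  | @app Γ A B L N hL hN ih₁ ih₂ =>
    obtain ⟨f, hf, hf'⟩ := ih₁
    obtain ⟨f₁, hf₁, hf₁'⟩ := ih₂
    refine ⟨_, hf.app hf₁, ?_⟩
    refine Represents.congr ((hf₁'.lift hf').comp
      (Represents.ev (cls_reifyTy A) (cls_reifyTy B))) ?_
    exact .app_eq (.refl _) (.refl _) (.snd_beta (proj hN) (proj hL))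
      (.fst_beta (proj hN) (proj hL))
  | pair _ _ ih₁ ih₂ =>
    obtain ⟨f, hf, hf'⟩ := ih₁
    obtain ⟨f₁, hf₁, hf₁'⟩ := ih₂
    exact ⟨_, hf.pair hf₁, hf'.lift hf₁'⟩
  | fst _ ih =>
    obtain ⟨f, hf, hf'⟩ := ih
    exact ⟨_, hf.fst, hf'.comp (.fst (cls_reifyTy _) (cls_reifyTy _))⟩
  | snd _ ih =>
    obtain ⟨f, hf, hf'⟩ := ih
    exact ⟨_, hf.snd, hf'.comp (.snd (cls_reifyTy _) (cls_reifyTy _))⟩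
  | ret X _ ih =>
    obtain ⟨f, hf, hf'⟩ := ih
    refine ⟨_, hf.ret X, ?_⟩
    cases X
    · exact hf'.comp (.η .S (cls_reifyTy _))
    · exact hf'.comp (.η .T (cls_reifyTy _))
  | iota _ ih =>
    obtain ⟨f, hf, hf'⟩ := ih
    exact ⟨_, hf.iota, hf'.comp (.ι (cls_reifyTy _))⟩
  | @bind Γ X A B L N hL hN ih₁ ih₂ =>
    obtain ⟨f, hf, hf'⟩ := ih₁
    obtain ⟨f₁, hf₁, hf₁'⟩ := ih₂
    refine ⟨_, hf.bind X hf₁, ?_⟩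
    -- The continuation is represented over the whole context as one product; `e` splits off the
    -- bound variable again.
    have e := EqTm.bind_eq X (.refl (reifyTy A)) (.refl (reifyTy B)) (.refl (proj hL))
      (.subst_projs_cons (hasType_reifyTm hN))
    cases X
    · exact (Represents.bind .S (cls_reifyTy A) (cls_reifyTy B) hf' hf₁').congr e
    · exact (Represents.bind .T (cls_reifyTy A) (cls_reifyTy B) hf' hf₁').congr e
  | conv e _ ih =>
    obtain ⟨f, hf, hf'⟩ := ih
    have h := hf'.conv (tyEq_reifyTy e)
    rw [← semTy_eq e]
    exact ⟨f, hf, h⟩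

/-- By soundness both terms have one denotation in the syntactic model. Their reified forms
represent it, hence are provably equal after packing the context, and the context can be unpacked.
-/
theorem eqTm_reifyTm {Γ L N A} (h : (synLang P).EqTm Γ L N A) :
    P.EqTm (Γ.map reifyTy) (reifyTm L) (reifyTm N) (reifyTy A) := by
  obtain ⟨f, hL, hN⟩ := Model.denotes_of_eqTm h
  obtain ⟨f₁, hL₁, hL'⟩ := exists_denotes h.typed.1
  obtain ⟨f₂, hN₁, hN'⟩ := exists_denotes h.typed.2
  rw [hL₁.unique hL] at hL'
  rw [hN₁.unique hN] at hN'
  exact .of_subst_projs (hasType_reifyTm h.typed.1) (hasType_reifyTm h.typed.2) (hL'.exact hN')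

/-- Terms of the internal language of the syntactic model are provably equal if the corresponding
terms of the theory are. -/
theorem eqTm_of_eqTm_reifyTm {Γ L N A} (hL : (synLang P).HasType Γ L A)
    (hN : (synLang P).HasType Γ N A)
    (h : P.EqTm (Γ.map reifyTy) (reifyTm L) (reifyTm N) (reifyTy A)) :
    (synLang P).EqTm Γ L N A := by
  obtain ⟨f₁, hL₁, hL'⟩ := exists_denotes hL
  obtain ⟨f₂, hN₁, hN'⟩ := exists_denotes hN
  have e := (hL'.congr (.subst (hasSubst_projs _) h)).unique hN'
  exact .ax ⟨hL, hN, (hL₁.sem_eq hL).trans (e.trans (hN₁.sem_eq hN).symm)⟩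

variable (P) in
/-- The translation from the internal language of the syntactic model to the theory. -/
noncomputable def reify : Translation (synLang P) P where
  ty := reifyTy
  tm := reifyTm
  ty_unit := rfl
  ty_arr _ _ := rfl
  ty_prod _ _ := rfl
  ty_mon _ _ := rfl
  tm_var _ := rfl
  tm_star := rfl
  tm_lam _ _ := rfl
  tm_app _ _ _ _ := rfl
  tm_pair _ _ := rfl
  tm_fst _ _ _ := rfl
  tm_snd _ _ _ := rfl
  tm_ret _ _ := rfl
  tm_iota _ _ := rfl
  tm_bind _ _ _ _ _ := rfl
  tyEq := tyEq_reifyTy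
  hasType := hasType_reifyTm
  eqTm := eqTm_reifyTm

/-! open Theory
# From the theory to the internal language of its syntactic model -/

/-- The type of the internal language of the syntactic model given by a type. -/
def quoteTy : Ty P.G → Ty P.Obj
  | .unit => .unit
  | .ground a => .ground (Obj.cls (.ground a))
  | .arr A B => .arr (quoteTy A) (quoteTy B)
  | .prod A B => .prod (quoteTy A) (quoteTy B)
  | .mon X A => .mon X (quoteTy A)

theorem semTy_quoteTy : ∀ A : Ty P.G, P.syntacticModel.semTy (quoteTy A) = Obj.cls A
  | .unit => rfl
  | .ground _ => rfl
  | .arr A B => congrArg₂ Obj.arr (semTy_quoteTy A) (semTy_quoteTy B)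
  | .prod A B => congrArg₂ Obj.prod (semTy_quoteTy A) (semTy_quoteTy B)
  | .mon .S A => congrArg (Obj.mon .S) (semTy_quoteTy A)
  | .mon .T A => congrArg (Obj.mon .T) (semTy_quoteTy A)

theorem tyEq_quoteTy {A B : Ty P.G} (h : P.TyEq A B) :
    (synLang P).TyEq (quoteTy A) (quoteTy B) :=
  .ax ((semTy_quoteTy A).trans ((Obj.sound h).trans (semTy_quoteTy B).symm))

theorem tyEq_reifyTy_quoteTy (A : Ty P.G) : P.TyEq A (reifyTy (quoteTy A)) :=
  Obj.exact ((semTy_quoteTy A).symm.trans (cls_reifyTy _).symm)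

theorem tyEq_quoteTy_reifyTy (A : Ty P.Obj) : (synLang P).TyEq A (quoteTy (reifyTy A)) :=
  .ax ((cls_reifyTy A).symm.trans (semTy_quoteTy _).symm)

/-- The term of the internal language of the syntactic model given by a term. -/
def quoteTm : Tm P.G P.K → Tm P.Obj (Σ X Y : P.Obj, (X ⟶ Y))
  | .var n => .var n
  -- Constants of the internal language have function types, so `c` becomes the constant of the
  -- global element `1 ⟶ [tyOf c]` applied to `*`.
  | .const c => .app .unit (quoteTy (P.tyOf c)) (.const ⟨Obj.cls .unit, Obj.cls (P.tyOf c),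
      hom (.const c) (.const c)⟩) .star
  | .star => .star
  | .lam A M => .lam (quoteTy A) (quoteTm M)
  | .app A B M N => .app (quoteTy A) (quoteTy B) (quoteTm M) (quoteTm N)
  | .pair M N => .pair (quoteTm M) (quoteTm N)
  | .fst A B M => .fst (quoteTy A) (quoteTy B) (quoteTm M)
  | .snd A B M => .snd (quoteTy A) (quoteTy B) (quoteTm M)
  | .ret X M => .ret X (quoteTm M)
  | .iota A M => .iota (quoteTy A) (quoteTm M)
  | .bind X A B M N => .bind X (quoteTy A) (quoteTy B) (quoteTm M) (quoteTm N)

theorem hasType_quoteTm {Γ L A} (h : P.HasType Γ L A) :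
    (synLang P).HasType (Γ.map quoteTy) (quoteTm L) (quoteTy A) := by
  induction h with
  | var h => exact .var (getElem?_map_of_eq_some quoteTy h)
  | const c =>
    have e : (synLang P).TyEq (.ground (Obj.cls .unit)) .unit := .ax rfl
    have e' : (synLang P).TyEq (.ground (Obj.cls (P.tyOf c))) (quoteTy (P.tyOf c)) :=
      .ax (semTy_quoteTy (P.tyOf c)).symm
    -- The constant of a morphism is typed between ground types; type axioms replace these by `unit`
    -- and the quoted type.
    exact .app (.conv (.arr e e')
      (.const (P := (synLang P).toSig) ⟨Obj.cls .unit, Obj.cls (P.tyOf c), hom _ (.const c)⟩)) .star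
  | star => exact .star
  | lam _ ih => exact .lam ih
  | app _ _ ih₁ ih₂ => exact .app ih₁ ih₂
  | pair _ _ ih₁ ih₂ => exact .pair ih₁ ih₂
  | fst _ ih => exact .fst ih
  | snd _ ih => exact .snd ih
  | ret X _ ih => exact .ret X ih
  | iota _ ih => exact .iota ih
  | bind _ _ ih₁ ih₂ => exact .bind ih₁ ih₂
  | conv e _ ih => exact .conv (tyEq_quoteTy e) ih

/-- The round trip changes recorded types, which matter only up to provable equality, and turns each
constant into a `β`-redex that contracts to a term provably equal to it. -/
theorem eqTm_reifyTm_quoteTm {Γ L A} (h : P.HasType Γ L A) :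
    P.EqTm Γ L (reifyTm (quoteTm L)) A := by
  induction h with
  | var h => exact .refl (.var h)
  | @const Γ c =>
    have hc : P.HasType [.unit] (.const c) (P.tyOf c) := .const c
    have e : P.TyEq .unit (Obj.rep (Obj.cls .unit : Obj P)) := rep_eq _
    have h₁ : P.EqTm [.unit] (.const c) (repTm (hom _ hc)) (P.tyOf c) := by
      have h := represents_repTm (hom _ hc)
      obtain ⟨_, _, h', e'⟩ := h
      -- The equality of judgements is taken at the types of the first one, so it already has the
      -- domain `unit`.
      exact Quotient.exact e'
    have h₂ : P.EqTm Γ _ _ (P.tyOf c) := .app_eq (.refl .unit) (tyEq_reifyTy_quoteTy (P.tyOf c))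
      (.lam_eq e (h₁.weaken Γ)) (.refl .star)
    exact .trans (.symm (.lam_beta (.const c) .star)) h₂
  | star => exact .refl .star
  | lam _ ih => exact .lam_eq (tyEq_reifyTy_quoteTy _) ih
  | app _ _ ih₁ ih₂ =>
    exact .app_eq (tyEq_reifyTy_quoteTy _) (tyEq_reifyTy_quoteTy _) ih₁ ih₂
  | pair _ _ ih₁ ih₂ => exact .pair_eq ih₁ ih₂
  | fst _ ih => exact .fst_eq (tyEq_reifyTy_quoteTy _) (tyEq_reifyTy_quoteTy _) ih
  | snd _ ih => exact .snd_eq (tyEq_reifyTy_quoteTy _) (tyEq_reifyTy_quoteTy _) ih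
  | ret X _ ih => exact .ret_eq X ih
  | iota _ ih => exact .iota_eq (tyEq_reifyTy_quoteTy _) ih
  | bind _ _ ih₁ ih₂ =>
    exact .bind_eq _ (tyEq_reifyTy_quoteTy _) (tyEq_reifyTy_quoteTy _) ih₁ ih₂
  | conv e _ ih => exact .conv e ih

/-- No induction on the derivation is needed: equality in the internal language is reflected by
`reifyTm`, under which the quoted terms return to `L` and `N`. -/
theorem eqTm_quoteTm {Γ L N A} (h : P.EqTm Γ L N A) :
    (synLang P).EqTm (Γ.map quoteTy) (quoteTm L) (quoteTm N) (quoteTy A) := by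
  refine eqTm_of_eqTm_reifyTm (hasType_quoteTm h.typed.1) (hasType_quoteTm h.typed.2) ?_
  have h₁ := (eqTm_reifyTm_quoteTm h.typed.1).symm.trans
    (h.trans (eqTm_reifyTm_quoteTm h.typed.2))
  -- The identity substitution converts all types of the context at once.
  have h₂ := h₁.subst (Δ := (Γ.map quoteTy).map reifyTy) (s := .var) (by
    intro n B hn
    exact .conv (tyEq_reifyTy_quoteTy B).symm
      (.var (getElem?_map_of_eq_some reifyTy (getElem?_map_of_eq_some quoteTy hn))))
  rw [Tm.subst_var, Tm.subst_var] at h₂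
  exact .conv (tyEq_reifyTy_quoteTy A) h₂

variable (P) in
/-- The translation from a theory to the internal language of its syntactic model. -/
def quote : Translation P (synLang P) where
  ty := quoteTy
  tm := quoteTm
  ty_unit := rfl
  ty_arr _ _ := rfl
  ty_prod _ _ := rfl
  ty_mon _ _ := rfl
  tm_var _ := rfl
  tm_star := rfl
  tm_lam _ _ := rfl
  tm_app _ _ _ _ := rfl
  tm_pair _ _ := rfl
  tm_fst _ _ _ := rfl
  tm_snd _ _ _ := rfl
  tm_ret _ _ := rfl
  tm_iota _ _ := rfl
  tm_bind _ _ _ _ _ := rfl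
  tyEq := tyEq_quoteTy
  hasType := hasType_quoteTm
  eqTm := eqTm_quoteTm

/-! open Theory
# The equivalence -/

/-- Translations that agree up to provable equality of types and terms are isomorphic. -/
theorem _root_.CSC.Translation.isomorphic_of_eqTm {P : Theory.{g, k}} {Q : Theory.{g', k'}}
    {V W : Translation P Q} (hty : ∀ A, Q.TyEq (V.ty A) (W.ty A))
    (htm : ∀ {A B f}, P.HasType [A] f B → Q.EqTm [V.ty A] (V.tm f) (W.tm f) (W.ty B)) :
    V.Isomorphic W := by
  have hW : ∀ {A B f}, P.HasType [A] f B → (W.tm f).subst (fun _ => .var 0) = W.tm f :=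
    fun h => (show Q.HasType [W.ty _] _ _ from W.hasType h).subst_zero
  have hV : ∀ {A B f}, P.HasType [A] f B → (V.tm f).subst (fun _ => .var 0) = V.tm f :=
    fun h => (show Q.HasType [V.ty _] _ _ from V.hasType h).subst_zero
  -- All components are the variable, retyped along the provable equality of types; naturality then
  -- says that the two translations of `f` are provably equal.
  refine ⟨⟨fun _ => .var 0, fun A => .conv (hty A) (.var rfl), fun h => ?_⟩,
    ⟨fun _ => .var 0, fun A => .conv (hty A).symm (.var rfl), fun {A B f} h => ?_⟩,
    fun A => .refl (.var rfl), fun A => .refl (.var rfl)⟩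
  · rw [hW h]
    exact htm h
  · rw [hV h]
    exact (htm h).symm.conv_ctx (hty A) (hty B).symm

/-- Every theory is equivalent to the internal language of its syntactic model. -/
theorem equivalent_internalLanguage (P : Theory.{g, k}) :
    P.Equivalent P.syntacticModel.internalLanguage := by
  refine ⟨quote P, reify P, ?_, ?_⟩
  · refine Translation.isomorphic_of_eqTm (fun A => (tyEq_quoteTy_reifyTy A).symm)
      fun {A B f} h => ?_
    have e := tyEq_quoteTy_reifyTy A
    have h₁ : (synLang P).HasType [quoteTy (reifyTy A)] f B := h.conv_ctx e (.refl B)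
    have h₂ : (synLang P).HasType [quoteTy (reifyTy A)] (quoteTm (reifyTm f)) B :=
      .conv (tyEq_quoteTy_reifyTy B).symm (hasType_quoteTm (hasType_reifyTm h))
    -- It suffices to compare after `reifyTm`, where the claim is the other round trip applied to
    -- `reifyTm f`.
    exact eqTm_of_eqTm_reifyTm h₂ h₁ (eqTm_reifyTm_quoteTm (hasType_reifyTm h₁)).symm
  · refine Translation.isomorphic_of_eqTm tyEq_reifyTy_quoteTy fun {A B f} h => ?_
    exact .conv (tyEq_reifyTy_quoteTy B) (eqTm_reifyTm_quoteTm h)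

end Theory

end CSC

theorem theorem7 :
    (∀ M : CSC.Model.{u, v}, M.Equivalent (CSC.Theory.syntacticModel M.internalLanguage)) ∧
      (∀ P : CSC.Theory.{g, k}, P.Equivalent (CSC.Theory.syntacticModel P).internalLanguage) :=
  ⟨CSC.Model.equivalent_syntacticModel, CSC.Theory.equivalent_internalLanguage⟩
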